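/- Let $G$ be the complex simple group of type $F_4$, with Borel subgroup $B$ and simple roots $\alpha_1,\alpha_2$ (long), $\alpha_3,\alpha_4$ (short) in the standard numbering, and let $X=(F_4,\alpha_3)=G\cdot[v_3]\subset\mathbb P(V(\omega_3))$ be the 20-dimensional rational homogeneous manifold, where $v_3$ is a highest weight vector of the irreducible representation with highest weight the third fundamental weight $\omega_3$. For a semisimple group $L$ write $(L,\alpha_i,\alpha_j)$ for the closure of $L\cdot[v_i+v_j]$ in $\mathbb P(V(\omega_i)\oplus V(\omega_j))$, where $v_i,v_j$ are highest weight vectors. Let $Z\subset X$ be a (smooth) Schubert variety, i.e. the closure of a $B$-orbit in $X$, of type $(B_3,\alpha_2,\alpha_3)$ or $(C_2,\alpha_2,\alpha_1)$; that is, $Z$ is the closure of $L\cdot[v_i+v_j]$, where $L\subset G$ is the subgroup of type $B_3$ (simple roots $\alpha_1,\alpha_2,\alpha_3$ of $G$), respectively $C_2$ (simple roots $\alpha_3,\alpha_2$ of $G$), generated by the root subgroups of this subdiagram, and $v_i,v_j\in V(\omega_3)$ are $L$-highest weight vectors whose weights are the corresponding fundamental weights of $L$. Let $x$ be a general point of $Z$,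 namely a point of the open $B$-orbit of $Z$, and let $\mathcal A\subset\mathbb P(T_xX)$ and $\mathcal B\subset\mathbb P(T_xZ)\subset\mathbb P(T_xX)$ be the varieties of minimal rational tangents of $X$ and of $Z$ at $x$, i.e. the sets of tangent directions at $x$ of the lines of $\mathbb P(V(\omega_3))$ that pass through $x$ and are contained in $X$, respectively in $Z$. Let $\widetilde{\mathcal A},\widetilde{\mathcal B}\subset T_xX\setminus\{0\}$ be their affine cones. Then the pair $(\mathcal A,\mathcal B)$ is nondegenerate: for every $\beta\in\widetilde{\mathcal B}$, $$\{\zeta\in T_\beta\widetilde{\mathcal A} : \sigma_\beta(\zeta,\xi)=0 \text{ for all } \xi\in T_\beta\widetilde{\mathcal B}\}=\mathbb C\beta ,$$ where $\sigma_\beta: T_\beta\widetilde{\mathcal A}\times T_\beta\widetilde{\mathcal A}\to T_xX/T_\beta\widetilde{\mathcal A}$ is the second fundamental form of $\widetilde{\mathcal A}\subset T_xX$ at $\beta$ (the differential of the Gauss map): $\sigma_\beta(\alpha'(0),\rho(0))=\rho'(0) \bmod T_\beta\widetilde{\mathcal A}$ for every holomorphic path $\alpha$ in $\widetilde{\mathcal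 A}$ with $\alpha(0)=\beta$ and every holomorphic vector field $\rho$ along $\alpha$ with $\rho(t)\in T_{\alpha(t)}\widetilde{\mathcal A}$. -/

import Mathlib

open scoped Topology Matrix Kronecker

/-! ### Matrix representations of the Lie algebra of a Cartan matrix -/

/-- A representation, by complex `N × N` matrices, of the complex semisimple Lie algebra with
Cartan matrix `A`, given through Serre's presentation: images `e i`, `f i`, `h i` of the Chevalley
generators, subject to the Serre relations. The convention is `A i j = ⟨α_i, α_j^∨⟩`, so that
`[h i, e j] = ⟨α_j, α_i^∨⟩ e j = A j i • e j`; with it the matrices `CartanMatrix.F₄`,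
`CartanMatrix.B n`, `CartanMatrix.C n` have their simple roots in the standard numbering (for `F₄`
the roots `α₁, α₂` are long and `α₃, α₄` are short; index `k : Fin n` stands for `α_{k+1}`). -/
structure SerreRep {n : ℕ} (A : Matrix (Fin n) (Fin n) ℤ) (N : Type) [Fintype N]
    [DecidableEq N] where
  e : Fin n → Matrix N N ℂ
  f : Fin n → Matrix N N ℂ
  h : Fin n → Matrix N N ℂ
  lie_h_h : ∀ i j, ⁅h i, h j⁆ = 0
  lie_e_f : ∀ i j, ⁅e i, f j⁆ = if i = j then h i else 0
  lie_h_e : ∀ i j, ⁅h i, e j⁆ = A j i • e j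
  lie_h_f : ∀ i j, ⁅h i, f j⁆ = -(A j i • f j)
  ad_e : ∀ i j, i ≠ j → ((fun x => ⁅e i, x⁆)^[(1 - A j i).toNat]) (e j) = 0
  ad_f : ∀ i j, i ≠ j → ((fun x => ⁅f i, x⁆)^[(1 - A j i).toNat]) (f j) = 0

namespace SerreRep

variable {n : ℕ} {A : Matrix (Fin n) (Fin n) ℤ} {N : Type} [Fintype N] [DecidableEq N]

/-- The restriction of a representation to the Lie subalgebra of a subdiagram of the Dynkin
diagram, the subdiagram being the image of `ι`. -/
noncomputable def restrict (ρ : SerreRep A N) {m : ℕ} (ι : Fin m ↪ Fin n) : SerreRep (A.submatrix ι ι) N where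
  e i := ρ.e (ι i)
  f i := ρ.f (ι i)
  h i := ρ.h (ι i)
  lie_h_h i j := ρ.lie_h_h _ _
  lie_e_f i j := by simp [ρ.lie_e_f]
  lie_h_e i j := ρ.lie_h_e _ _
  lie_h_f i j := ρ.lie_h_f _ _
  ad_e i j hij := ρ.ad_e _ _ (ι.injective.ne hij)
  ad_f i j hij := ρ.ad_f _ _ (ι.injective.ne hij)

/-- The action `x ↦ x ⊗ 1 + 1 ⊗ x` of matrices on the tensor square. -/
noncomputable def tensorAct (x : Matrix N N ℂ) : Matrix (N × N) (N × N) ℂ := x ⊗ₖ 1 + 1 ⊗ₖ x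

theorem tensorAct_lie (x y : Matrix N N ℂ) : tensorAct ⁅x, y⁆ = ⁅tensorAct x, tensorAct y⁆ := by
  have h1 : (x * y - y * x) ⊗ₖ (1 : Matrix N N ℂ) = (x * y) ⊗ₖ 1 - (y * x) ⊗ₖ 1 := by
    ext; simp [sub_mul]
  have h2 : (1 : Matrix N N ℂ) ⊗ₖ (x * y - y * x) = 1 ⊗ₖ (x * y) - 1 ⊗ₖ (y * x) := by
    ext; simp [mul_sub]
  simp only [tensorAct, Ring.lie_def, add_mul, mul_add, ← Matrix.mul_kronecker_mul, one_mul,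
    mul_one, h1, h2]
  abel

theorem tensorAct_zero : tensorAct (0 : Matrix N N ℂ) = 0 := by
  simp [tensorAct]

theorem tensorAct_zsmul (k : ℤ) (x : Matrix N N ℂ) : tensorAct (k • x) = k • tensorAct x := by
  ext i j
  simp only [tensorAct, Matrix.add_apply, Matrix.smul_apply, Matrix.kroneckerMap_apply]
  simp only [zsmul_eq_mul]
  ring

theorem tensorAct_neg (x : Matrix N N ℂ) : tensorAct (-x) = -tensorAct x := by
  simpa using tensorAct_zsmul (-1) x

theorem tensorAct_iterate (x y : Matrix N N ℂ) (k : ℕ) :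
    tensorAct (((fun z => ⁅x, z⁆)^[k]) y) = ((fun z => ⁅tensorAct x, z⁆)^[k]) (tensorAct y) := by
  induction k with
  | zero => rfl
  | succ k ih => rw [Function.iterate_succ_apply', Function.iterate_succ_apply', tensorAct_lie, ih]

/-- The tensor square of a representation. -/
noncomputable def tensorSquare (ρ : SerreRep A N) : SerreRep A (N × N) where
  e i := tensorAct (ρ.e i)
  f i := tensorAct (ρ.f i)
  h i := tensorAct (ρ.h i)
  lie_h_h i j := by rw [← tensorAct_lie, ρ.lie_h_h, tensorAct_zero]
  lie_e_f i j := by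
    rw [← tensorAct_lie, ρ.lie_e_f]
    split_ifs
    · rfl
    · exact tensorAct_zero
  lie_h_e i j := by rw [← tensorAct_lie, ρ.lie_h_e, tensorAct_zsmul]
  lie_h_f i j := by rw [← tensorAct_lie, ρ.lie_h_f, tensorAct_neg, tensorAct_zsmul]
  ad_e i j hij := by rw [← tensorAct_iterate, ρ.ad_e i j hij, tensorAct_zero]
  ad_f i j hij := by rw [← tensorAct_iterate, ρ.ad_f i j hij, tensorAct_zero]

/-- `v` is a highest weight vector whose weight is the fundamental weight `ω_i`. -/
def IsFundamentalVector (ρ : SerreRep A N) (i : Fin n) (v : N → ℂ) : Prop :=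
  v ≠ 0 ∧ (∀ k, ρ.e k *ᵥ v = 0) ∧ ∀ k, ρ.h k *ᵥ v = if k = i then v else 0

/-- The connected semisimple group `G ⊆ GL_N(ℂ)` with Lie algebra the image of the
representation; it is generated by the root subgroups of the simple roots and their negatives. -/
noncomputable def group (ρ : SerreRep A N) : Subgroup (GL N ℂ) :=
  Subgroup.closure {g | ∃ (i : Fin n) (t : ℂ),
    (g : Matrix N N ℂ) = NormedSpace.exp (t • ρ.e i) ∨
    (g : Matrix N N ℂ) = NormedSpace.exp (t • ρ.f i)}

/-- The Borel subgroup of `ρ.group` belonging to the chosen simple roots; it is generated by the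
maximal torus and the root subgroups of the simple roots. -/
noncomputable def borel (ρ : SerreRep A N) : Subgroup (GL N ℂ) :=
  Subgroup.closure {g | ∃ (i : Fin n) (t : ℂ),
    (g : Matrix N N ℂ) = NormedSpace.exp (t • ρ.e i) ∨
    (g : Matrix N N ℂ) = NormedSpace.exp (t • ρ.h i)}

end SerreRep

/-! ### Projective varieties as cones: subvarieties of `ℙ(ℂ^N)` are represented by their affine
cones (here with the vertex `0`) in `ℂ^N` -/

section Cones

variable {N : Type} [Fintype N] [DecidableEq N]

/-- The affine cone over the orbit `H.[v] ⊆ ℙ(ℂ^N)`. -/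
def orbitCone (H : Subgroup (GL N ℂ)) (v : N → ℂ) : Set (N → ℂ) :=
  {y | ∃ g ∈ H, ∃ c : ℂ, y = c • ((g : Matrix N N ℂ) *ᵥ v)}

/-- `Z` is (the affine cone over) the closure of the orbit `H.[v]` in `ℙ(ℂ^N)`. -/
def IsOrbitClosure (H : Subgroup (GL N ℂ)) (v : N → ℂ) (Z : Set (N → ℂ)) : Prop :=
  v ≠ 0 ∧ Z = closure (orbitCone H v)

variable {n : ℕ} {A : Matrix (Fin n) (Fin n) ℤ}

/-- `Z` is a Schubert variety of the homogeneous variety `X`: the closure in `X` of an orbit of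
the Borel subgroup. -/
def IsSchubertVariety (ρ : SerreRep A N) (X Z : Set (N → ℂ)) : Prop :=
  ∃ x ∈ X, IsOrbitClosure ρ.borel x Z

/-- `x` represents a general point of the Schubert variety `Z`, i.e. a point of the open orbit of
the Borel subgroup in `Z`. -/
def IsGeneralPoint (ρ : SerreRep A N) (Z : Set (N → ℂ)) (x : N → ℂ) : Prop :=
  x ∈ Z ∧ IsOrbitClosure ρ.borel x Z

/-- `Z` is a horospherical variety `(L, α_i, α_j)`, where `L` is the semisimple group of the
representation: the closure in `ℙ(V(ω_i) ⊕ V(ω_j))` of the orbit `L.[v_i + v_j]`, where `v_i` and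
`v_j` are highest weight vectors of the weights `ω_i` and `ω_j`. -/
def IsHorospherical (ρ : SerreRep A N) (i j : Fin n) (Z : Set (N → ℂ)) : Prop :=
  ∃ v w : N → ℂ, ρ.IsFundamentalVector i v ∧ ρ.IsFundamentalVector j w ∧
    IsOrbitClosure ρ.group (v + w) Z

/-- `Z` is a horospherical variety of type `(A', α_i, α_j)`, where `A'` is the Cartan matrix of a
subdiagram of the Dynkin diagram, with respect to the subgroup belonging to this subdiagram. -/
def IsOfType (ρ : SerreRep A N) {m : ℕ} (A' : Matrix (Fin m) (Fin m) ℤ) (i j : Fin m)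
    (Z : Set (N → ℂ)) : Prop :=
  ∃ ι : Fin m ↪ Fin n, A.submatrix ι ι = A' ∧ IsHorospherical (ρ.restrict ι) i j Z

end Cones

/-! ### Varieties of minimal rational tangents, second fundamental form, nondegeneracy -/

section Tangents

instance isClosedLine {V : Type*} [NormedAddCommGroup V] [NormedSpace ℂ V] (x : V) :
    IsClosed ((ℂ ∙ x : Submodule ℂ V) : Set V) :=
  Submodule.closed_of_finiteDimensional _

/-- The affine cone (without vertex) of the variety of minimal rational tangents at `[x]` of the
projective variety `Y ⊆ ℙ(V)`: the tangent directions at `[x]` of the lines of `ℙ(V)` through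
`[x]` which are contained in `Y`. It lies in `T_{[x]} Y ⊆ T_{[x]} ℙ(V) = V / ℂ x`; the direction of
the line spanned by `x` and `w` is the class of `w`. -/
def vmrtCone {V : Type*} [NormedAddCommGroup V] [NormedSpace ℂ V] (Y : Set V) (x : V) :
    Set (V ⧸ (ℂ ∙ x)) :=
  {β | β ≠ 0 ∧ ∃ w : V, Submodule.Quotient.mk w = β ∧ ∀ a b : ℂ, a • x + b • w ∈ Y}

variable {E : Type*} [NormedAddCommGroup E] [NormedSpace ℂ E]

/-- `α` is (the germ at `0` of) a holomorphic path in `S` with `α 0 = β`. -/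
def IsPathIn (S : Set E) (β : E) (α : ℂ → E) : Prop :=
  AnalyticAt ℂ α 0 ∧ α 0 = β ∧ ∀ᶠ t in 𝓝 (0 : ℂ), α t ∈ S

/-- The tangent space `T_β S` at a (smooth) point: the space of the velocity vectors of
holomorphic paths in `S` through `β`. -/
noncomputable def tangent (S : Set E) (β : E) : Submodule ℂ E :=
  Submodule.span ℂ {ξ | ∃ α : ℂ → E, IsPathIn S β α ∧ deriv α 0 = ξ}

/-- `α` is a holomorphic path in `S` through `β` and `r` is a holomorphic vector field along `α`
which is tangent to `S`. -/
def IsMovingField (S : Set E) (β : E) (α r : ℂ → E) : Prop :=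
  IsPathIn S β α ∧ AnalyticAt ℂ r 0 ∧ ∀ᶠ t in 𝓝 (0 : ℂ), r t ∈ tangent S (α t)

/-- `σ` is the second fundamental form `T_β S × T_β S → E / T_β S` of `S ⊆ E` at `β`, the
differential of the Gauss map: `σ (α'(0), r(0)) = r'(0) mod T_β S` for every holomorphic path `α` in
`S` through `β` and every moving tangent field `r` along `α`. -/
def IsSecondFundamentalForm (S : Set E) (β : E)
    (σ : tangent S β →ₗ[ℂ] tangent S β →ₗ[ℂ] E ⧸ tangent S β) : Prop :=
  ∀ ζ ξ : tangent S β,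
    (∃ α r : ℂ → E, IsMovingField S β α r ∧ deriv α 0 = ζ ∧ r 0 = ξ) ∧
    ∀ α r : ℂ → E, IsMovingField S β α r → deriv α 0 = ζ → r 0 = ξ →
      σ ζ ξ = Submodule.Quotient.mk (deriv r 0)

/-- The pair of affine cones `𝒜 ⊇ ℬ` is nondegenerate: at every point `β` of `ℬ` the second
fundamental form `σ` of `𝒜` satisfies `Ker σ(·, T_β ℬ) = ℂ β`. -/
def IsNondegeneratePair (𝒜 ℬ : Set E) : Prop :=
  ℬ ⊆ 𝒜 ∧ ∀ β ∈ ℬ, ∃ σ : tangent 𝒜 β →ₗ[ℂ] tangent 𝒜 β →ₗ[ℂ] E ⧸ tangent 𝒜 β,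
    IsSecondFundamentalForm 𝒜 β σ ∧
    {ζ : E | ∃ h : ζ ∈ tangent 𝒜 β, ∀ ξ : tangent 𝒜 β, (ξ : E) ∈ tangent ℬ β → σ ⟨ζ, h⟩ ξ = 0} =
      ((ℂ ∙ β : Submodule ℂ E) : Set E)

end Tangents

/-! ### The 27-dimensional representation of `F₄` and the homogeneous manifold `(F₄, α₃)` -/

namespace F4

/-- The action of the Chevalley generators `f_1, …, f_4` on the weight basis `u_0, …, u_26` of the
representation `ℂ^27 = V(ω₄) ⊕ ℂ`: a pair `(a, b)` in the `i`-th list means that `u_b` occurs (with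
coefficient `1`) in `f_i u_a`. -/
def edges : Fin 4 → List (Fin 27 × Fin 27)
  | 0 => [(3, 4), (5, 6), (7, 9), (18, 20), (19, 22), (21, 23)]
  | 1 => [(2, 3), (6, 8), (9, 11), (16, 18), (17, 19), (23, 24)]
  | 2 => [(1, 2), (3, 5), (4, 6), (8, 10), (11, 13), (11, 14), (13, 16), (14, 16), (15, 17),
      (19, 21), (22, 23), (24, 25)]
  | 3 => [(0, 1), (5, 7), (6, 9), (8, 11), (10, 12), (10, 13), (12, 15), (13, 15), (16, 17),
      (18, 19), (20, 22), (25, 26)]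

/-- The basis vectors occurring in `f_i u_a`. -/
def fNbr (i : Fin 4) (a : Fin 27) : List (Fin 27) :=
  (edges i).filterMap fun p => if p.1 = a then some p.2 else none

/-- The basis vectors occurring in `e_i u_b`. -/
def eNbr (i : Fin 4) (b : Fin 27) : List (Fin 27) :=
  (edges i).filterMap fun p => if p.2 = b then some p.1 else none

/-- The matrix whose `s`-th column is the sum of the basis vectors in the list `nb s`. -/
noncomputable def adj (nb : Fin 27 → List (Fin 27)) : Matrix (Fin 27) (Fin 27) ℂ :=
  Matrix.of fun r s => ((nb s).count r : ℂ)

/-- Sum of the basis vectors in a list. -/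
noncomputable def listVec (l : List (Fin 27)) : Fin 27 → ℂ := fun r => (l.count r : ℂ)

theorem adj_mulVec (nb : Fin 27 → List (Fin 27)) (l : List (Fin 27)) :
    adj nb *ᵥ listVec l = listVec (l.flatMap nb) := by
  induction l with
  | nil => ext r; simp [listVec, Matrix.mulVec, dotProduct]
  | cons a l ih =>
    have h1 : listVec (a :: l) = Pi.single a 1 + listVec l := by
      ext r
      simp only [listVec, List.count_cons, Pi.add_apply, Pi.single_apply]
      by_cases h : a = r
      · subst h; simp [add_comm]
      · simp [h, Ne.symm h]
    rw [h1, Matrix.mulVec_add, ih]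
    ext r
    simp [listVec, adj, List.count_append]

theorem ext_col {M M' : Matrix (Fin 27) (Fin 27) ℂ}
    (h : ∀ k, M *ᵥ listVec [k] = M' *ᵥ listVec [k]) : M = M' := by
  apply Matrix.ext_of_mulVec_single
  intro k
  have h1 : listVec [k] = Pi.single k 1 := by
    ext r
    simp only [listVec, List.count_singleton, Pi.single_apply]
    by_cases h : k = r
    · subst h; simp
    · simp [h, Ne.symm h]
  simpa [h1] using h k

theorem listVec_append (l l' : List (Fin 27)) : listVec (l ++ l') = listVec l + listVec l' := by
  ext r; simp [listVec, List.count_append]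

theorem listVec_perm {l l' : List (Fin 27)} (h : l.Perm l') : listVec l = listVec l' := by
  ext r; simp [listVec, h.count_eq]

/-- `e_i` in the 27-dimensional representation. -/
noncomputable def e (i : Fin 4) : Matrix (Fin 27) (Fin 27) ℂ := adj (eNbr i)

/-- `f_i` in the 27-dimensional representation. -/
noncomputable def f (i : Fin 4) : Matrix (Fin 27) (Fin 27) ℂ := adj (fNbr i)

theorem adj_comm {a b : Fin 27 → List (Fin 27)}
    (h : ∀ k, ((b k).flatMap a).Perm ((a k).flatMap b)) : ⁅adj a, adj b⁆ = 0 := by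
  apply ext_col
  intro k
  simp only [Ring.lie_def, Matrix.sub_mulVec, ← Matrix.mulVec_mulVec, adj_mulVec,
    Matrix.zero_mulVec, sub_eq_zero]
  exact listVec_perm (by simpa using h k)

theorem adj_serre_two {a b : Fin 27 → List (Fin 27)}
    (h : ∀ k, (((b k).flatMap a).flatMap a ++ ((a k).flatMap a).flatMap b).Perm
      (((a k).flatMap b).flatMap a ++ ((a k).flatMap b).flatMap a)) :
    ⁅adj a, ⁅adj a, adj b⁆⁆ = 0 := by
  apply ext_col
  intro k
  have h1 := listVec_perm (h k)
  simp only [listVec_append] at h1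
  simp only [Ring.lie_def, mul_sub, sub_mul, Matrix.sub_mulVec, ← Matrix.mulVec_mulVec, adj_mulVec,
    Matrix.zero_mulVec, List.flatMap_singleton, mul_assoc]
  linear_combination (exp := 1) h1

theorem adj_serre_three {a b : Fin 27 → List (Fin 27)}
    (h : ∀ k, ((((b k).flatMap a).flatMap a).flatMap a ++ ((((a k).flatMap a).flatMap b).flatMap a ++
        ((((a k).flatMap a).flatMap b).flatMap a ++ (((a k).flatMap a).flatMap b).flatMap a))).Perm
      ((((a k).flatMap a).flatMap a).flatMap b ++ ((((a k).flatMap b).flatMap a).flatMap a ++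
        ((((a k).flatMap b).flatMap a).flatMap a ++ (((a k).flatMap b).flatMap a).flatMap a)))) :
    ⁅adj a, ⁅adj a, ⁅adj a, adj b⁆⁆⁆ = 0 := by
  apply ext_col
  intro k
  have h1 := listVec_perm (h k)
  simp only [listVec_append] at h1
  simp only [Ring.lie_def, mul_sub, sub_mul, Matrix.sub_mulVec, ← Matrix.mulVec_mulVec, adj_mulVec,
    Matrix.zero_mulVec, List.flatMap_singleton, mul_assoc]
  linear_combination (exp := 1) h1

theorem adj_weight {a b c : Fin 27 → List (Fin 27)} (m n : ℕ)
    (h : ∀ k, ((((c k).flatMap b).flatMap a ++ ((a k).flatMap b).flatMap c) ++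
        (List.replicate n (c k)).flatten).Perm
      ((((c k).flatMap a).flatMap b ++ ((b k).flatMap a).flatMap c) ++
        (List.replicate m (c k)).flatten)) :
    ⁅⁅adj a, adj b⁆, adj c⁆ = ((m : ℤ) - n) • adj c := by
  have hrep : ∀ (q : ℕ) (l : List (Fin 27)),
      listVec (List.replicate q l).flatten = (q : ℤ) • listVec l := by
    intro q l
    ext r
    simp [listVec, List.count_flatten]
  apply ext_col
  intro k
  have h1 := listVec_perm (h k)
  simp only [listVec_append, hrep] at h1
  simp only [Ring.lie_def, mul_sub, sub_mul, Matrix.sub_mulVec, ← Matrix.mulVec_mulVec, adj_mulVec,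
    List.flatMap_singleton, mul_assoc, Matrix.smul_mulVec, sub_smul]
  linear_combination (exp := 1) h1

theorem lie_e_f (i j : Fin 4) (hij : i ≠ j) : ⁅e i, f j⁆ = 0 :=
  adj_comm (by revert i j; decide +kernel)

theorem lie_h_e (i j : Fin 4) : ⁅⁅e i, f i⁆, e j⁆ = CartanMatrix.F₄ j i • e j := by
  have h := adj_weight (a := eNbr i) (b := fNbr i) (c := eNbr j)
    (CartanMatrix.F₄ j i).toNat (-CartanMatrix.F₄ j i).toNat (by revert i j; decide +kernel)
  rw [e, f, e, h, Int.toNat_sub_toNat_neg]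

theorem lie_h_f (i j : Fin 4) : ⁅⁅e i, f i⁆, f j⁆ = -(CartanMatrix.F₄ j i • f j) := by
  have h := adj_weight (a := eNbr i) (b := fNbr i) (c := fNbr j)
    (-CartanMatrix.F₄ j i).toNat (CartanMatrix.F₄ j i).toNat (by revert i j; decide +kernel)
  rw [e, f, f, h, ← neg_sub, Int.toNat_sub_toNat_neg, neg_smul]

theorem adj_serre {a b : Fin 27 → List (Fin 27)} (m : ℕ)
    (h : m = 1 ∧ (∀ k, ((b k).flatMap a).Perm ((a k).flatMap b)) ∨
      m = 2 ∧ (∀ k, (((b k).flatMap a).flatMap a ++ ((a k).flatMap a).flatMap b).Perm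
        (((a k).flatMap b).flatMap a ++ ((a k).flatMap b).flatMap a)) ∨
      m = 3 ∧ (∀ k, ((((b k).flatMap a).flatMap a).flatMap a ++
        ((((a k).flatMap a).flatMap b).flatMap a ++
          ((((a k).flatMap a).flatMap b).flatMap a ++ (((a k).flatMap a).flatMap b).flatMap a))).Perm
        ((((a k).flatMap a).flatMap a).flatMap b ++ ((((a k).flatMap b).flatMap a).flatMap a ++
        ((((a k).flatMap b).flatMap a).flatMap a ++ (((a k).flatMap b).flatMap a).flatMap a))))) :
    ((fun x => ⁅adj a, x⁆)^[m]) (adj b) = 0 := by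
  rcases h with ⟨rfl, h⟩ | ⟨rfl, h⟩ | ⟨rfl, h⟩
  · exact adj_comm h
  · exact adj_serre_two h
  · exact adj_serre_three h

theorem ad_e (i j : Fin 4) (hij : i ≠ j) :
    ((fun x => ⁅e i, x⁆)^[(1 - CartanMatrix.F₄ j i).toNat]) (e j) = 0 :=
  adj_serre _ (by revert i j; decide +kernel)

theorem ad_f (i j : Fin 4) (hij : i ≠ j) :
    ((fun x => ⁅f i, x⁆)^[(1 - CartanMatrix.F₄ j i).toNat]) (f j) = 0 :=
  adj_serre _ (by revert i j; decide +kernel)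

theorem lie_h_h (i j : Fin 4) : ⁅⁅e i, f i⁆, ⁅e j, f j⁆⁆ = 0 := by
  have h : ∀ x y z : Matrix (Fin 27) (Fin 27) ℂ, ⁅x, ⁅y, z⁆⁆ = ⁅⁅x, y⁆, z⁆ + ⁅y, ⁅x, z⁆⁆ := by
    intro x y z
    simp only [Ring.lie_def]
    noncomm_ring
  rw [h, lie_h_e, lie_h_f]
  simp only [Ring.lie_def, smul_mul_assoc, mul_smul_comm, mul_neg, neg_mul]
  abel

/-- The 27-dimensional representation of the simple Lie algebra of type `F₄`. -/
noncomputable def rep27 : SerreRep CartanMatrix.F₄ (Fin 27) where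
  e := e
  f := f
  h i := ⁅e i, f i⁆
  lie_h_h := lie_h_h
  lie_e_f i j := by
    split_ifs with h
    · rw [h]
    · exact lie_e_f i j h
  lie_h_e := lie_h_e
  lie_h_f := lie_h_f
  ad_e := ad_e
  ad_f := ad_f

/-- The representation of `F₄` on `ℂ^27 ⊗ ℂ^27`, which contains `Λ² V(ω₄)` and hence `V(ω₃)`. -/
noncomputable def rep : SerreRep CartanMatrix.F₄ (Fin 27 × Fin 27) := rep27.tensorSquare

/-- The bivector `x ∧ y = x ⊗ y - y ⊗ x`. -/
noncomputable def wedge (x y : Fin 27 → ℂ) : Fin 27 × Fin 27 → ℂ :=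
  fun p => x p.1 * y p.2 - y p.1 * x p.2

/-- The bivector `u_0 ∧ u_1`, a highest weight vector of weight `ω₃`
(see `v₃_isFundamentalVector`). -/
noncomputable def v₃ : Fin 27 × Fin 27 → ℂ := wedge (Pi.single 0 1) (Pi.single 1 1)

/-- The rational homogeneous manifold `X = (F₄, α₃)`, i.e. (the affine cone over) the `F₄`-orbit of
the highest weight line `[v₃]` in `ℙ(V(ω₃)) ⊆ ℙ(Λ² ℂ^27)`. -/
noncomputable def X : Set (Fin 27 × Fin 27 → ℂ) := orbitCone rep.group v₃

theorem listVec_singleton (a : Fin 27) : listVec [a] = Pi.single a 1 := by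
  ext r
  simp only [listVec, List.count_singleton, Pi.single_apply]
  by_cases h : a = r
  · subst h; simp
  · simp [h, Ne.symm h]

theorem kronecker_mulVec_mul (M M' : Matrix (Fin 27) (Fin 27) ℂ) (x y : Fin 27 → ℂ) :
    (M ⊗ₖ M') *ᵥ (fun p => x p.1 * y p.2) = fun p => (M *ᵥ x) p.1 * (M' *ᵥ y) p.2 := by
  ext p
  simp only [Matrix.mulVec, dotProduct, Matrix.kroneckerMap_apply, Fintype.sum_prod_type,
    Finset.sum_mul_sum]
  exact Finset.sum_congr rfl fun i _ => Finset.sum_congr rfl fun j _ => by ring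

theorem tensorAct_mulVec_wedge (M : Matrix (Fin 27) (Fin 27) ℂ) (x y : Fin 27 → ℂ) :
    SerreRep.tensorAct M *ᵥ wedge x y = wedge (M *ᵥ x) y + wedge x (M *ᵥ y) := by
  have h : wedge x y = (fun p => x p.1 * y p.2) - fun p => y p.1 * x p.2 := rfl
  rw [h, SerreRep.tensorAct, Matrix.mulVec_sub, Matrix.add_mulVec, Matrix.add_mulVec]
  simp only [kronecker_mulVec_mul, Matrix.one_mulVec]
  ext p
  simp only [wedge, Pi.add_apply, Pi.sub_apply]
  ring

theorem v₃_isFundamentalVector : rep.IsFundamentalVector 2 v₃ := by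
  have wz : ∀ x, wedge 0 x = 0 := fun x => by ext p; simp [wedge]
  have zw : ∀ x, wedge x 0 = 0 := fun x => by ext p; simp [wedge]
  have ww : ∀ x, wedge x x = 0 := fun x => by ext p; simp [wedge]
  have wn : ∀ x y, wedge x (-y) = -wedge x y := fun x y => by ext p; simp [wedge]; ring
  have l0 : listVec [] = 0 := by ext; simp [listVec]
  refine ⟨fun h => ?_, fun k => ?_, fun k => ?_⟩
  · have := congrFun h (0, 1)
    simp [v₃, wedge] at this
  · change SerreRep.tensorAct (adj (eNbr k)) *ᵥ v₃ = 0
    rw [v₃, tensorAct_mulVec_wedge, ← listVec_singleton, ← listVec_singleton, adj_mulVec,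
      adj_mulVec]
    have h0 : ∀ k, [0].flatMap (eNbr k) = [] := by decide
    have h1 : ∀ k, [1].flatMap (eNbr k) = [] ∨ [1].flatMap (eNbr k) = [0] := by decide
    rw [h0, l0, wz, zero_add]
    rcases h1 k with h | h
    · rw [h, l0, zw]
    · rw [h, ww]
  · change SerreRep.tensorAct ⁅adj (eNbr k), adj (fNbr k)⁆ *ᵥ v₃ = if k = 2 then v₃ else 0
    rw [v₃, tensorAct_mulVec_wedge, ← listVec_singleton, ← listVec_singleton]
    simp only [Ring.lie_def, Matrix.sub_mulVec, ← Matrix.mulVec_mulVec, adj_mulVec]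
    have h0 : ∀ k, k ≠ 3 → ([0].flatMap (fNbr k)).flatMap (eNbr k) = [] := by decide
    have h0' : ∀ k, ([0].flatMap (eNbr k)).flatMap (fNbr k) = [] := by decide
    have h03 : ([0].flatMap (fNbr 3)).flatMap (eNbr 3) = [0] := by decide
    have h1 : ∀ k, k ≠ 2 → ([1].flatMap (fNbr k)).flatMap (eNbr k) = [] := by decide
    have h1' : ∀ k, k ≠ 3 → ([1].flatMap (eNbr k)).flatMap (fNbr k) = [] := by decide
    have h12 : ([1].flatMap (fNbr 2)).flatMap (eNbr 2) = [1] := by decide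
    have h13 : ([1].flatMap (eNbr 3)).flatMap (fNbr 3) = [1] := by decide
    by_cases h2 : k = 2
    · subst h2
      rw [h0 2 (by decide), h0' 2, h12, h1' 2 (by decide)]
      simp [l0, wz]
    · by_cases h3 : k = 3
      · subst h3
        rw [h03, h0' 3, h1 3 (by decide), h13]
        simp [l0, wn]
      · rw [h0 k h3, h0', h1 k h2, h1' k h3]
        simp [l0, wz, zw, h2]

end F4

/-! A point of `X` is a plane in ℂ²⁷, embedded by Plücker coordinates, and `v₃` is the plane ⟨u₀,
u₁⟩. A line of `X` is a line of the Grassmannian, hence a pencil of planes through a common vector.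
For a line through `v₃` whose common vector is u₀, the other vector moves from u₁ along a line of
the quadric `quad` in the 8-dimensional spin representation of B₃. Such lines are parametrized by
the null vectors r of a form P on u₁^⊥/u₁ ≅ ℂ⁶. The root group of −α₄ fixes `v₃` and turns u₀ into
u₀ + t u₁. So, away from the pencils with common vector u₁, the cone 𝒜 consists of the vectors a r +
t b r + t² c r with P(r, r) = 0 (`chart_isChartOf`): a bundle over ℙ¹ with a 4-dimensional quadric
as fibre.

On such a cone the second fundamental form at a r₀ is explicit. Choose m with P(r₀, m) = 1 and P(m,
m) = 0. Modulo the tangent space {a r + s b r₀ : P(r₀, r) = 0}, σ(a r₁ + t₁ b r₀, a r₂ + t₂ b r₀) =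
−P(r₁, r₂) a m + t₁ b r₂ + t₂ b r₁ + 2 t₁ t₂ c r₀. Reading off the b-component, orthogonality to a
r₂ with r₂ ∉ ℂ r₀ forces t₁ = 0, and orthogonality to b r₀ forces r₁ ∈ ℂ r₀. Hence the pair is
nondegenerate at a r₀ as soon as the tangent space of ℬ contains b r₀ and one such a r₂
(`IsChartOf.nondegAt`). Almost nothing else about ℬ is needed.

The subvariety `Z` is identified with an explicit model (`exists_model`): the closure of the L-orbit
of α y₃ + γ v₃ with y₃ = u₁ ∧ u₂. A closed Borel-stable cone contains a highest weight vector, which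
here can only be `v₃`. Comparison of L-weights makes the vector of weight ω_j proportional to `v₃`.
The torus shows that `Z` contains the whole span of the two vectors, and the Plücker equations with
the weights then force the other one to be proportional to `y₃`.

L alone does not move a general point to `y₃`, but L, scalars and the root group of α₄ in the Borel
subgroup together do (`IsModel.exists_map_y₃`), and all of them preserve both `X` and `Z`. Up to the
SL₂ of α₃, which fixes `y₃`, the directions of lines of `Z` through `y₃` are u₁ ∧ (r₀ u₀ + r₃ u₃ +
r₄ u₄), with r₄ = 0 for C₂ (`IsModel.exists_of_mem_vmrtCone`). The element `carry` sends `y₃` to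
`v₃`, the root −α₃ to −α₄, and these directions to a P-isotropic linear space of dimension 3 or 2.
Moving t gives the tangent vector b r₀, moving inside the isotropic space gives a r₂, and the
criterion applies (`IsModel.nondegAt_carry`). -/

/-! ### Nondegeneracy at a point -/

/-- Nondegeneracy of the pair of cones `𝒜`, `ℬ` at the point `β`. -/
def NondegAt {E : Type*} [NormedAddCommGroup E] [NormedSpace ℂ E] (𝒜 ℬ : Set E) (β : E) : Prop :=
  ∃ σ : tangent 𝒜 β →ₗ[ℂ] tangent 𝒜 β →ₗ[ℂ] E ⧸ tangent 𝒜 β,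
    IsSecondFundamentalForm 𝒜 β σ ∧
    {ζ : E | ∃ h : ζ ∈ tangent 𝒜 β, ∀ ξ : tangent 𝒜 β, (ξ : E) ∈ tangent ℬ β → σ ⟨ζ, h⟩ ξ = 0} =
      ((ℂ ∙ β : Submodule ℂ E) : Set E)

theorem tangent_mono {E : Type*} [NormedAddCommGroup E] [NormedSpace ℂ E] {S S' : Set E}
    (h : S ⊆ S') (β : E) : tangent S β ≤ tangent S' β := by
  refine Submodule.span_mono ?_
  rintro ξ ⟨α, ⟨h1, h2, h3⟩, h4⟩
  exact ⟨α, ⟨h1, h2, h3.mono fun t ht => h ht⟩, h4⟩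

/-- A cone which, on the open set `πa ≠ 0`, is the image of `(t, r) ↦ a r + t b r + t² c r`, where
`r` runs through the null vectors of a symmetric bilinear form `P`. -/
structure QuadricChart (U E : Type*) [NormedAddCommGroup U] [NormedSpace ℂ U]
    [NormedAddCommGroup E] [NormedSpace ℂ E] where
  a : U →L[ℂ] E
  b : U →L[ℂ] E
  c : U →L[ℂ] E
  πa : E →L[ℂ] U
  πb : E →L[ℂ] U
  P : U →L[ℂ] U →L[ℂ] ℂ
  πa_a : ∀ r, πa (a r) = r
  πa_b : ∀ r, πa (b r) = 0
  πa_c : ∀ r, πa (c r) = 0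
  πb_a : ∀ r, πb (a r) = 0
  πb_b : ∀ r, πb (b r) = r
  πb_c : ∀ r, πb (c r) = 0
  P_symm : ∀ r r', P r r' = P r' r
  exists_dual : ∀ r, r ≠ 0 → ∃ m, P r m = 1 ∧ P m m = 0

/-! ### Tangent spaces and second fundamental form of a cone fibred in quadrics -/

namespace QuadricChart

variable {U E : Type*} [NormedAddCommGroup U] [NormedSpace ℂ U]
    [NormedAddCommGroup E] [NormedSpace ℂ E] (C : QuadricChart U E)

/-- The parametrization. -/
def param (t : ℂ) (r : U) : E := C.a r + t • C.b r + t ^ 2 • C.c r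

/-- The derivative of the parametrization at `(t, r)` in the direction `(t', r')`. -/
def dparam (t : ℂ) (r : U) (t' : ℂ) (r' : U) : E :=
  C.a r' + t • C.b r' + t ^ 2 • C.c r' + t' • (C.b r + (2 * t) • C.c r)

/-- `𝒜` is described by the chart where `πa ≠ 0`. -/
def IsChartOf (𝒜 : Set E) : Prop :=
  ∀ β, C.πa β ≠ 0 → (β ∈ 𝒜 ↔ ∃ t r, C.P r r = 0 ∧ β = C.param t r)

theorem πa_param (t : ℂ) (r : U) : C.πa (C.param t r) = r := by
  simp [param, C.πa_a, C.πa_b, C.πa_c]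

theorem πb_param (t : ℂ) (r : U) : C.πb (C.param t r) = t • r := by
  simp [param, C.πb_a, C.πb_b, C.πb_c]

theorem πa_dparam (t : ℂ) (r : U) (t' : ℂ) (r' : U) : C.πa (C.dparam t r t' r') = r' := by
  simp [dparam, C.πa_a, C.πa_b, C.πa_c]

theorem πb_dparam (t : ℂ) (r : U) (t' : ℂ) (r' : U) :
    C.πb (C.dparam t r t' r') = t • r' + t' • r := by
  simp [dparam, C.πb_a, C.πb_b, C.πb_c]

theorem hasDerivAt_param {t : ℂ → ℂ} {r : ℂ → U} {t' : ℂ} {r' : U} {x : ℂ}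
    (ht : HasDerivAt t t' x) (hr : HasDerivAt r r' x) :
    HasDerivAt (fun τ => C.param (t τ) (r τ)) (C.dparam (t x) (r x) t' r') x := by
  have ha := C.a.hasFDerivAt.comp_hasDerivAt x hr
  have hb := C.b.hasFDerivAt.comp_hasDerivAt x hr
  have hc := C.c.hasFDerivAt.comp_hasDerivAt x hr
  have h := (ha.add (ht.smul hb)).add ((ht.pow 2).smul hc)
  refine h.congr_deriv ?_
  simp only [dparam, Function.comp, Pi.pow_apply]
  module

theorem analyticAt_param {t : ℂ → ℂ} {r : ℂ → U} {x : ℂ}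
    (ht : AnalyticAt ℂ t x) (hr : AnalyticAt ℂ r x) :
    AnalyticAt ℂ (fun τ => C.param (t τ) (r τ)) x := by
  have h : ∀ f : U →L[ℂ] E, AnalyticAt ℂ (fun τ => f (r τ)) x := fun f =>
    (f.analyticAt _).comp hr
  exact ((h C.a).add (ht.smul (h C.b))).add ((ht.pow 2).smul (h C.c))

theorem analyticAt_form {r s : ℂ → U} {x : ℂ} (hr : AnalyticAt ℂ r x) (hs : AnalyticAt ℂ s x) :
    AnalyticAt ℂ (fun τ => C.P (r τ) (s τ)) x :=
  (C.P.analyticAt_bilinear (r x, s x)).comp₂ hr hs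

theorem hasDerivAt_form {r s : ℂ → U} {r' s' : U} {x : ℂ}
    (hr : HasDerivAt r r' x) (hs : HasDerivAt s s' x) :
    HasDerivAt (fun τ => C.P (r τ) (s τ)) (C.P r' (s x) + C.P (r x) s') x :=
  (C.P.hasFDerivAt.comp_hasDerivAt x hr).clm_apply hs

/-- Holomorphic paths in the cone lift to the chart. -/
theorem IsChartOf.lift {𝒜 : Set E} (h : C.IsChartOf 𝒜) {t₀ : ℂ} {r₀ m : U} (hm : C.P r₀ m = 1)
    {α : ℂ → E} (hα : IsPathIn 𝒜 (C.param t₀ r₀) α) :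
    ∃ t : ℂ → ℂ, AnalyticAt ℂ t 0 ∧ t 0 = t₀ ∧ AnalyticAt ℂ (fun τ => C.πa (α τ)) 0 ∧
      (∀ᶠ τ in 𝓝 0, C.P (C.πa (α τ)) m ≠ 0) ∧
      (∀ᶠ τ in 𝓝 0, C.P (C.πa (α τ)) (C.πa (α τ)) = 0) ∧
      ∀ᶠ τ in 𝓝 0, α τ = C.param (t τ) (C.πa (α τ)) := by
  obtain ⟨h1, h2, h3⟩ := hα
  have hra : AnalyticAt ℂ (fun τ => C.πa (α τ)) 0 := (C.πa.analyticAt _).comp h1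
  have hrb : AnalyticAt ℂ (fun τ => C.πb (α τ)) 0 := (C.πb.analyticAt _).comp h1
  have hla := C.analyticAt_form hra (analyticAt_const (v := m))
  have hlb := C.analyticAt_form hrb (analyticAt_const (v := m))
  have e1 : C.P (C.πa (α 0)) m = 1 := by rw [h2, πa_param, hm]
  have hne : ∀ᶠ τ in 𝓝 (0 : ℂ), C.P (C.πa (α τ)) m ≠ 0 :=
    hla.continuousAt.eventually_ne (by simp [e1])
  -- On the chart πb = t • πa, so pairing both with m recovers t as a quotient of holomorphic
  -- functions.
  have key : ∀ᶠ τ in 𝓝 (0 : ℂ), C.P (C.πa (α τ)) (C.πa (α τ)) = 0 ∧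
      α τ = C.param (C.P (C.πb (α τ)) m / C.P (C.πa (α τ)) m) (C.πa (α τ)) := by
    filter_upwards [hne, h3] with τ hτ hτ'
    have h0 : C.πa (α τ) ≠ 0 := by rintro h0; simp [h0] at hτ
    obtain ⟨t, r, hr, hα⟩ := (h _ h0).1 hτ'
    rw [hα, πa_param] at hτ ⊢
    refine ⟨hr, ?_⟩
    rw [πb_param]
    simp [hτ]
  refine ⟨fun τ => C.P (C.πb (α τ)) m / C.P (C.πa (α τ)) m, hlb.div hla (by simp [e1]), ?_, hra,
    hne, key.mono fun τ h => h.1, key.mono fun τ h => h.2⟩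
  simp only [h2, πa_param, πb_param, map_smul, smul_apply, hm]
  simp

/-- A null path with given value and velocity. -/
theorem exists_null_path {r₀ r₁ m : U} (h0 : C.P r₀ r₀ = 0) (h1 : C.P r₀ r₁ = 0)
    (hm : C.P r₀ m = 1) (hmm : C.P m m = 0) :
    ∃ r : ℂ → U, AnalyticAt ℂ r 0 ∧ r 0 = r₀ ∧ HasDerivAt r r₁ 0 ∧
      (∀ᶠ τ in 𝓝 0, C.P (r τ) m ≠ 0) ∧ ∀ᶠ τ in 𝓝 0, C.P (r τ) (r τ) = 0 := by
  set d : ℂ → ℂ := fun τ => 1 + τ * C.P r₁ m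
  have hd : AnalyticAt ℂ d 0 := by fun_prop
  have hd0 : ∀ᶠ τ in 𝓝 (0 : ℂ), d τ ≠ 0 := hd.continuousAt.eventually_ne (by simp [d])
  -- As m is null, P(r, r) = 0 for r = r₀ + τ r₁ + φ m becomes linear in φ, namely τ² P(r₁, r₁) + 2
  -- φ (1 + τ P(r₁, m)) = 0. The solution vanishes to second order and leaves the velocity r₁
  -- unchanged.
  set φ : ℂ → ℂ := fun τ => -(τ ^ 2 * C.P r₁ r₁) / (2 * d τ)
  have hφ : AnalyticAt ℂ φ 0 := by
    refine AnalyticAt.div (by fun_prop) (by fun_prop) (by simp [d])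
  have hφ' : HasDerivAt φ 0 0 := by
    have e1 : HasDerivAt (fun τ : ℂ => -(τ ^ 2 * C.P r₁ r₁)) 0 0 := by
      have := (((hasDerivAt_id (0 : ℂ)).pow 2).mul_const (C.P r₁ r₁)).fun_neg
      simpa using this
    have e2 : HasDerivAt (fun τ : ℂ => 2 * d τ) (deriv (fun τ : ℂ => 2 * d τ) 0) 0 :=
      (hd.differentiableAt.const_mul 2).hasDerivAt
    exact (e1.fun_div e2 (by simp [d])).congr_deriv (by simp)
  refine ⟨fun τ => r₀ + τ • r₁ + φ τ • m, by fun_prop, by simp [φ], ?_, ?_, ?_⟩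
  · have := (((hasDerivAt_id (0 : ℂ)).smul_const r₁).const_add r₀).fun_add (hφ'.smul_const m)
    simpa using this
  · filter_upwards [hd0] with τ hτ
    simpa [hm, hmm, d] using hτ
  · filter_upwards [hd0] with τ hτ
    have e1 : C.P m r₀ = 1 := by rw [C.P_symm, hm]
    have e2 : C.P r₁ r₀ = 0 := by rw [C.P_symm, h1]
    have e3 : C.P m r₁ = C.P r₁ m := C.P_symm _ _
    have e4 : φ τ * (2 * d τ) = -(τ ^ 2 * C.P r₁ r₁) := div_mul_cancel₀ _ (by simpa using hτ)
    simp only [map_add, map_smul, add_apply, smul_apply,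
      smul_eq_mul, h0, h1, hm, hmm, e1, e2, e3]
    linear_combination e4

/-- Paths lift to pairs (t, r) with r null, and differentiating P(r, r) = 0 makes the velocity of r
orthogonal to r₀. Conversely `exists_null_path` realizes every orthogonal velocity. -/
theorem IsChartOf.mem_tangent {𝒜 : Set E} (h : C.IsChartOf 𝒜) {t₀ : ℂ} {r₀ : U} (h0 : r₀ ≠ 0)
    (hr₀ : C.P r₀ r₀ = 0) {η : E} :
    η ∈ tangent 𝒜 (C.param t₀ r₀) ↔ ∃ t₁ r₁, C.P r₀ r₁ = 0 ∧ η = C.dparam t₀ r₀ t₁ r₁ := by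
  obtain ⟨m, hm, hmm⟩ := C.exists_dual r₀ h0
  constructor
  · intro hη
    induction hη using Submodule.span_induction with
    | mem η hη =>
      obtain ⟨α, hα, rfl⟩ := hη
      obtain ⟨t, ht, ht0, hr, hne, hnull, hlift⟩ := h.lift C hm hα
      have e1 := ht.differentiableAt.hasDerivAt
      have e2 := hr.differentiableAt.hasDerivAt
      have e3 := (C.hasDerivAt_param e1 e2).congr_of_eventuallyEq hlift
      have e4 := C.hasDerivAt_form e2 e2
      have e5 := e4.unique ((hasDerivAt_const (0 : ℂ) (0 : ℂ)).congr_of_eventuallyEq hnull)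
      have e6 : C.πa (α 0) = r₀ := by rw [hα.2.1, πa_param]
      refine ⟨deriv t 0, deriv (fun τ => C.πa (α τ)) 0, ?_, ?_⟩
      · rw [C.P_symm _ (C.πa (α 0)), e6] at e5
        linear_combination e5 / 2
      · rw [e3.deriv, ht0, e6]
    | zero => exact ⟨0, 0, by simp, by simp [dparam]⟩
    | add x y _ _ hx hy =>
      obtain ⟨t, r, hr, rfl⟩ := hx
      obtain ⟨t', r', hr', rfl⟩ := hy
      exact ⟨t + t', r + r', by simp [hr, hr'], by simp only [dparam, map_add]; module⟩
    | smul k x _ hx =>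
      obtain ⟨t, r, hr, rfl⟩ := hx
      exact ⟨k * t, k • r, by simp [hr], by simp only [dparam, map_smul]; module⟩
  · rintro ⟨t₁, r₁, hr₁, rfl⟩
    obtain ⟨r, hr, hr0, hr', hne, hnull⟩ := C.exists_null_path hr₀ hr₁ hm hmm
    have ht : HasDerivAt (fun τ : ℂ => t₀ + τ * t₁) t₁ 0 := by
      simpa using ((hasDerivAt_id (0 : ℂ)).mul_const t₁).const_add t₀
    have e := C.hasDerivAt_param ht hr'
    refine Submodule.subset_span ⟨fun τ => C.param (t₀ + τ * t₁) (r τ), ⟨?_, ?_, ?_⟩, ?_⟩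
    · exact C.analyticAt_param (by fun_prop) hr
    · simp [hr0]
    · filter_upwards [hne, hnull] with τ hτ hτ'
      refine (h _ ?_).2 ⟨_, _, hτ', rfl⟩
      rw [πa_param]
      rintro h
      simp [h] at hτ
    · rw [e.deriv, hr0]
      simp

theorem IsChartOf.mem_tangent_zero {𝒜 : Set E} (h : C.IsChartOf 𝒜) {r₀ : U} (h0 : r₀ ≠ 0)
    (hr₀ : C.P r₀ r₀ = 0) {η : E} :
    η ∈ tangent 𝒜 (C.a r₀) ↔ ∃ (t₁ : ℂ) (r₁ : U), C.P r₀ r₁ = 0 ∧ η = C.a r₁ + t₁ • C.b r₀ := by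
  have := h.mem_tangent C (t₀ := 0) h0 hr₀ (η := η)
  simpa [param, dparam] using this

/-- The second fundamental form at `a r₀`, before passing to the quotient. -/
noncomputable def sff (r₀ m : U) : E →ₗ[ℂ] E →ₗ[ℂ] E :=
  LinearMap.mk₂ ℂ (fun ζ ξ => -(C.P (C.πa ζ) (C.πa ξ)) • C.a m
      + C.P (C.πb ζ) m • C.b (C.πa ξ) + C.P (C.πb ξ) m • C.b (C.πa ζ)
      + (2 * C.P (C.πb ζ) m * C.P (C.πb ξ) m) • C.c r₀)
    (fun x y z => by simp only [map_add, add_apply]; module)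
    (fun k x z => by
      simp only [map_smul, smul_apply, smul_eq_mul]; module)
    (fun x y z => by simp only [map_add, add_apply]; module)
    (fun k x z => by
      simp only [map_smul, smul_apply, smul_eq_mul]; module)

theorem sff_apply (r₀ m : U) (ζ ξ : E) : C.sff r₀ m ζ ξ =
    -(C.P (C.πa ζ) (C.πa ξ)) • C.a m
      + C.P (C.πb ζ) m • C.b (C.πa ξ) + C.P (C.πb ξ) m • C.b (C.πa ζ)
      + (2 * C.P (C.πb ζ) m * C.P (C.πb ξ) m) • C.c r₀ := rfl

/-- The second fundamental form at `a r₀`. -/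
noncomputable def sffQuot (𝒜 : Set E) (r₀ m : U) :
    tangent 𝒜 (C.a r₀) →ₗ[ℂ] tangent 𝒜 (C.a r₀) →ₗ[ℂ] E ⧸ tangent 𝒜 (C.a r₀) :=
  ((C.sff r₀ m).compl₁₂ (Submodule.subtype _) (Submodule.subtype _)).compr₂
    (Submodule.mkQ (tangent 𝒜 (C.a r₀)))

theorem sffQuot_apply (𝒜 : Set E) (r₀ m : U) (ζ ξ : tangent 𝒜 (C.a r₀)) :
    C.sffQuot 𝒜 r₀ m ζ ξ = Submodule.Quotient.mk (C.sff r₀ m ζ ξ) := rfl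

/-- A moving tangent field has the form `dparam t r t₂ s` with P(r, s) = 0. Its derivative at 0 is a
s' + t' b s + t₂' b r₀ + t₂ (b r' + 2 t' c r₀). Differentiating P(r, s) = 0 gives P(r₀, s') = −P(r',
s), so a s' agrees with −P(r', s) a m modulo the tangent space, which also contains t₂' b r₀. Thus
only first-order data remain. -/
theorem IsChartOf.isSecondFundamentalForm {𝒜 : Set E} (h : C.IsChartOf 𝒜) {r₀ m : U}
    (h0 : r₀ ≠ 0) (hr₀ : C.P r₀ r₀ = 0) (hm : C.P r₀ m = 1) (hmm : C.P m m = 0) :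
    IsSecondFundamentalForm 𝒜 (C.a r₀) (C.sffQuot 𝒜 r₀ m) := by
  have hβ : C.a r₀ = C.param 0 r₀ := by simp [param]
  rintro ⟨ζ, hζ⟩ ⟨ξ, hξ⟩
  constructor
  · obtain ⟨t₁, r₁, hr₁, rfl⟩ := (h.mem_tangent_zero C h0 hr₀).1 hζ
    obtain ⟨t₂, r₂, hr₂, rfl⟩ := (h.mem_tangent_zero C h0 hr₀).1 hξ
    obtain ⟨r, hr, hr0, hr', hne, hnull⟩ := C.exists_null_path hr₀ hr₁ hm hmm
    have hrne : ∀ᶠ τ in 𝓝 (0 : ℂ), r τ ≠ 0 := by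
      filter_upwards [hne] with τ hτ
      rintro h
      simp [h] at hτ
    -- The correction along m keeps r₂ + ψ m orthogonal to the moving null vector r; it is zero at 0
    -- because P(r₀, r₂) = 0.
    set ψ : ℂ → ℂ := fun τ => -C.P (r τ) r₂ / C.P (r τ) m
    have hψ : AnalyticAt ℂ ψ 0 :=
      (C.analyticAt_form hr analyticAt_const).neg.div (C.analyticAt_form hr analyticAt_const)
        (by simp [hr0, hm])
    have hs : AnalyticAt ℂ (fun τ => r₂ + ψ τ • m) 0 := by fun_prop
    have hψ0 : ψ 0 = 0 := by simp [ψ, hr0, hr₂]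
    have ht : HasDerivAt (fun τ : ℂ => τ * t₁) t₁ 0 := by
      simpa using ((hasDerivAt_id (0 : ℂ)).mul_const t₁)
    refine ⟨fun τ => C.param (τ * t₁) (r τ),
      fun τ => C.dparam (τ * t₁) (r τ) t₂ (r₂ + ψ τ • m), ⟨⟨?_, ?_, ?_⟩, ?_, ?_⟩, ?_, ?_⟩
    · exact C.analyticAt_param (by fun_prop) hr
    · simp [hr0, param]
    · filter_upwards [hrne, hnull] with τ hτ hτ'
      refine (h _ ?_).2 ⟨_, _, hτ', rfl⟩
      rwa [πa_param]
    · have h1 : ∀ (f : U →L[ℂ] E) {u : ℂ → U}, AnalyticAt ℂ u 0 →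
        AnalyticAt ℂ (fun τ => f (u τ)) 0 := fun f u hu => (f.analyticAt _).comp hu
      have t1 : AnalyticAt ℂ (fun τ : ℂ => τ * t₁) 0 := by fun_prop
      exact (((h1 C.a hs).add (t1.smul (h1 C.b hs))).add ((t1.pow 2).smul (h1 C.c hs))).add
        ((analyticAt_const (v := t₂)).smul
          ((h1 C.b hr).add (((analyticAt_const (v := (2 : ℂ))).mul t1).smul (h1 C.c hr))))
    · filter_upwards [hrne, hnull, hne] with τ hτ hτ' hτ''
      refine (h.mem_tangent C hτ hτ').2 ⟨_, _, ?_, rfl⟩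
      simp only [map_add, map_smul, smul_eq_mul, ψ]
      field_simp
      ring
    · have e := C.hasDerivAt_param ht hr'
      rw [e.deriv, hr0]
      simp [dparam]
    · simp [dparam, hψ0, hr0]
  · rintro α ρ ⟨hα, hρ, hρt⟩ h1 h2
    rw [hβ] at hα
    simp only at h1 h2
    have hα0 : α 0 = C.param 0 r₀ := hα.2.1
    obtain ⟨t, ht, ht0, hr, hne, hnull, hlift⟩ := h.lift C hm hα
    have hs : AnalyticAt ℂ (fun τ => C.πa (ρ τ)) 0 := (C.πa.analyticAt _).comp hρ
    have hsb : AnalyticAt ℂ (fun τ => C.πb (ρ τ)) 0 := (C.πb.analyticAt _).comp hρ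
    have hrb : AnalyticAt ℂ (fun τ => C.πb (α τ)) 0 := (C.πb.analyticAt _).comp hα.1
    -- By `πb_dparam` the vector πb ρ − t πa ρ is the multiple t₂ of πa α; pairing with m extracts
    -- the factor holomorphically.
    set t₂ : ℂ → ℂ := fun τ =>
      C.P (C.πb (ρ τ) - t τ • C.πa (ρ τ)) m / C.P (C.πa (α τ)) m
    have ht₂ : AnalyticAt ℂ t₂ 0 :=
      (C.analyticAt_form (hsb.sub (ht.smul hs)) analyticAt_const).div
        (C.analyticAt_form hr analyticAt_const) (by simp [hα0, πa_param, hm])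
    have key : ∀ᶠ τ in 𝓝 (0 : ℂ), C.P (C.πa (α τ)) (C.πa (ρ τ)) = 0 ∧
        ρ τ = C.dparam (t τ) (C.πa (α τ)) (t₂ τ) (C.πa (ρ τ)) := by
      filter_upwards [hne, hnull, hlift, hρt] with τ hτ hτ1 hτ2 hτ3
      have h0 : C.πa (α τ) ≠ 0 := by rintro h0; simp [h0] at hτ
      rw [hτ2] at hτ3
      obtain ⟨s, r, hr, hρτ⟩ := (h.mem_tangent C h0 hτ1).1 hτ3
      have e1 : C.πa (ρ τ) = r := by rw [hρτ, πa_dparam]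
      have e2 : t₂ τ = s := by
        simp only [t₂]
        rw [e1, hρτ, πb_dparam, add_sub_cancel_left, map_smul, smul_apply,
          smul_eq_mul, mul_div_cancel_right₀ _ hτ]
      rw [e1, e2]
      exact ⟨hr, hρτ⟩
    have dt := ht.differentiableAt.hasDerivAt
    have dt₂ := ht₂.differentiableAt.hasDerivAt
    have dr := C.πa.hasFDerivAt.comp_hasDerivAt 0 hα.1.differentiableAt.hasDerivAt
    have drb := C.πb.hasFDerivAt.comp_hasDerivAt 0 hα.1.differentiableAt.hasDerivAt
    have ds := C.πa.hasFDerivAt.comp_hasDerivAt 0 hρ.differentiableAt.hasDerivAt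
    simp only [h1, Function.comp_def] at dr drb ds
    set s' := C.πa (deriv ρ 0)
    have hr0 : C.πa (α 0) = r₀ := by rw [hα0, πa_param]
    have hs0 : C.πa (ρ 0) = C.πa ξ := by rw [h2]
    have et : deriv t 0 = C.P (C.πb ζ) m := by
      have h3 := C.hasDerivAt_form drb (hasDerivAt_const (0 : ℂ) m)
      have h4 := dt.mul (C.hasDerivAt_form dr (hasDerivAt_const (0 : ℂ) m))
      have h5 : (fun τ => C.P (C.πb (α τ)) m) =ᶠ[𝓝 0] fun τ => t τ * C.P (C.πa (α τ)) m := by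
        filter_upwards [hlift] with τ hτ
        conv_lhs => rw [hτ, πb_param]
        simp
      have h6 := (h4.congr_of_eventuallyEq h5).unique h3
      rw [ht0, hr0, hm] at h6
      simpa using h6
    have et₂ : t₂ 0 = C.P (C.πb ξ) m := by simp [t₂, ht0, hr0, hm, h2]
    have eP : C.P (C.πa ζ) (C.πa ξ) + C.P r₀ s' = 0 := by
      have h3 := C.hasDerivAt_form dr ds
      have h4 := h3.unique ((hasDerivAt_const (0 : ℂ) (0 : ℂ)).congr_of_eventuallyEq
        (key.mono fun τ h => h.1))
      rwa [hr0, hs0] at h4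
    have dρ : deriv ρ 0 = C.a s' + deriv t 0 • C.b (C.πa ξ) + deriv t₂ 0 • C.b r₀
        + t₂ 0 • (C.b (C.πa ζ) + (2 * deriv t 0) • C.c r₀) := by
      have h3 := C.hasDerivAt_param dt ds
      have db := C.b.hasFDerivAt.comp_hasDerivAt 0 dr
      have dc := C.c.hasFDerivAt.comp_hasDerivAt 0 dr
      have h4 := h3.add (dt₂.smul (db.add ((dt.const_mul 2).smul dc)))
      have h5 := (h4.congr_of_eventuallyEq (key.mono fun τ h => h.2)).deriv
      rw [h5]
      simp only [dparam, Function.comp_def, Pi.add_apply, Pi.smul_apply', ht0, hr0, hs0]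
      module
    rw [sffQuot_apply, eq_comm, Submodule.Quotient.eq, h.mem_tangent_zero C h0 hr₀]
    refine ⟨deriv t₂ 0, s' + C.P (C.πa ζ) (C.πa ξ) • m, ?_, ?_⟩
    · simp only [map_add, map_smul, hm, smul_eq_mul]
      linear_combination eP
    · rw [dρ, sff_apply, et, et₂, map_add, map_smul]
      module

/-- The nondegeneracy criterion: it suffices that the tangent space of `ℬ` contains the direction
of the parameter `t` and one direction of the quadric besides that of the point itself. -/
theorem IsChartOf.nondegAt {𝒜 ℬ : Set E} (h : C.IsChartOf 𝒜) (hℬ : ℬ ⊆ 𝒜) {r₀ r₂ : U}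
    (h0 : r₀ ≠ 0) (hr₀ : C.P r₀ r₀ = 0) (hb : C.b r₀ ∈ tangent ℬ (C.a r₀))
    (ha : C.a r₂ ∈ tangent ℬ (C.a r₀)) (hr₂ : r₂ ∉ (ℂ ∙ r₀ : Submodule ℂ U)) :
    NondegAt 𝒜 ℬ (C.a r₀) := by
  obtain ⟨m, hm, hmm⟩ := C.exists_dual r₀ h0
  refine ⟨C.sffQuot 𝒜 r₀ m, h.isSecondFundamentalForm C h0 hr₀ hm hmm, ?_⟩
  have hT := fun η => h.mem_tangent_zero C h0 hr₀ (η := η)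
  ext ζ
  simp only [Set.mem_ofPred_eq, SetLike.mem_coe, Submodule.mem_span_singleton]
  constructor
  · rintro ⟨hζ, hker⟩
    have k1 := hker ⟨_, tangent_mono hℬ _ ha⟩ ha
    have k2 := hker ⟨_, tangent_mono hℬ _ hb⟩ hb
    obtain ⟨t₁, r₁, hr₁, rfl⟩ := (hT ζ).1 hζ
    rw [sffQuot_apply, Submodule.Quotient.mk_eq_zero, hT, sff_apply] at k1 k2
    obtain ⟨s, u, -, hk1⟩ := k1
    obtain ⟨s', u', -, hk2⟩ := k2
    -- The projection πb does not see a m and c r₀; what is left is t₁ r₂ = s r₀ and r₁ = s' r₀.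
    have e1 := congrArg C.πb hk1
    have e2 := congrArg C.πb hk2
    simp only [map_add, map_smul, C.πa_a, C.πb_a, C.πa_b, C.πb_b, C.πb_c, hm, map_zero,
      smul_zero, zero_add, add_zero, zero_smul, smul_apply,
      smul_eq_mul, zero_apply, mul_one, one_smul] at e1 e2
    have ht : t₁ = 0 := by
      by_contra ht
      apply hr₂
      rw [Submodule.mem_span_singleton]
      refine ⟨t₁⁻¹ * s, ?_⟩
      rw [mul_smul, ← e1, smul_smul, inv_mul_cancel₀ ht, one_smul]
    exact ⟨s', by rw [← map_smul, ← e2, ht]; simp⟩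
  · rintro ⟨k, rfl⟩
    refine ⟨(hT _).2 ⟨0, k • r₀, by simp [hr₀], by simp⟩, ?_⟩
    rintro ⟨ξ, hξ'⟩ -
    obtain ⟨t₂, r₂, hr₂, rfl⟩ := (hT ξ).1 hξ'
    rw [sffQuot_apply, Submodule.Quotient.mk_eq_zero, hT]
    refine ⟨t₂ * k, 0, by simp, ?_⟩
    rw [sff_apply]
    simp [C.πa_a, C.πb_a, C.πa_b, C.πb_b, hm, hr₂, smul_smul]

end QuadricChart

/-! ### Invariance under linear isomorphisms -/

section Transport

variable {E E' : Type*} [NormedAddCommGroup E] [NormedSpace ℂ E]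
  [NormedAddCommGroup E'] [NormedSpace ℂ E'] (φ : E ≃L[ℂ] E')

theorem IsPathIn.map {S : Set E} {β : E} {α : ℂ → E} (h : IsPathIn S β α) :
    IsPathIn (φ '' S) (φ β) (fun t => φ (α t)) :=
  ⟨((φ : E →L[ℂ] E').analyticAt _).comp h.1, congrArg φ h.2.1,
    h.2.2.mono fun _ ht => Set.mem_image_of_mem φ ht⟩

theorem deriv_equiv_comp {α : ℂ → E} (h : AnalyticAt ℂ α 0) :
    deriv (fun t => φ (α t)) 0 = φ (deriv α 0) :=
  ((φ : E →L[ℂ] E').hasFDerivAt.comp_hasDerivAt 0 h.differentiableAt.hasDerivAt).deriv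

theorem map_mem_tangent {S : Set E} {β x : E} (h : x ∈ tangent S β) :
    φ x ∈ tangent (φ '' S) (φ β) := by
  induction h using Submodule.span_induction with
  | mem x hx =>
    obtain ⟨α, hα, rfl⟩ := hx
    exact Submodule.subset_span ⟨_, hα.map φ, deriv_equiv_comp φ hα.1⟩
  | zero => simp
  | add x y _ _ hx hy => rw [map_add]; exact add_mem hx hy
  | smul c x _ hx => rw [map_smul]; exact Submodule.smul_mem _ _ hx

theorem map_mem_tangent_iff {S : Set E} {β x : E} :
    φ x ∈ tangent (φ '' S) (φ β) ↔ x ∈ tangent S β := by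
  refine ⟨fun h => ?_, map_mem_tangent φ⟩
  have := map_mem_tangent φ.symm h
  simpa [Set.image_image] using this

theorem IsMovingField.map {S : Set E} {β : E} {α r : ℂ → E} (h : IsMovingField S β α r) :
    IsMovingField (φ '' S) (φ β) (fun t => φ (α t)) (fun t => φ (r t)) :=
  ⟨h.1.map φ, ((φ : E →L[ℂ] E').analyticAt _).comp h.2.1,
    h.2.2.mono fun _ ht => map_mem_tangent φ ht⟩

/-- Everything is defined through holomorphic paths, so σ is transported by pulling its arguments
back and pushing its values forward. The independence of the chosen path on the image follows by
pulling paths back along `φ.symm`. -/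
theorem NondegAt.map {𝒜 ℬ : Set E} {β : E} (h : NondegAt 𝒜 ℬ β) :
    NondegAt (φ '' 𝒜) (φ '' ℬ) (φ β) := by
  obtain ⟨σ, hσ, hker⟩ := h
  have hT : ∀ x, x ∈ tangent (φ '' 𝒜) (φ β) → φ.symm x ∈ tangent 𝒜 β := fun x hx =>
    (map_mem_tangent_iff φ).1 (by simpa using hx)
  let e : tangent (φ '' 𝒜) (φ β) →ₗ[ℂ] tangent 𝒜 β :=
    (φ.symm : E' →L[ℂ] E).toLinearMap.restrict hT
  let q : (E ⧸ tangent 𝒜 β) →ₗ[ℂ] E' ⧸ tangent (φ '' 𝒜) (φ β) :=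
    Submodule.mapQ _ _ (φ : E →L[ℂ] E').toLinearMap fun x hx => map_mem_tangent φ hx
  have hq : ∀ x, q x = 0 → x = 0 := by
    intro x
    obtain ⟨x, rfl⟩ := Submodule.Quotient.mk_surjective _ x
    intro hx
    change Submodule.Quotient.mk (φ x) = 0 at hx
    rw [Submodule.Quotient.mk_eq_zero] at hx ⊢
    exact (map_mem_tangent_iff φ).1 hx
  refine ⟨(σ.compl₁₂ e e).compr₂ q, ?_, ?_⟩
  · intro ζ ξ
    obtain ⟨⟨α, r, h1, h2, h3⟩, h4⟩ := hσ (e ζ) (e ξ)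
    refine ⟨⟨_, _, h1.map φ, ?_, ?_⟩, ?_⟩
    · rw [deriv_equiv_comp φ h1.1.1, h2]
      exact φ.apply_symm_apply _
    · rw [h3]
      exact φ.apply_symm_apply _
    · intro α' r' h1' h2' h3'
      have h5 := h1'.map φ.symm
      simp only [Set.image_image, ContinuousLinearEquiv.symm_apply_apply, Set.image_id'] at h5
      have h6 := h4 _ _ h5 (by rw [deriv_equiv_comp φ.symm h1'.1.1, h2']; rfl)
        (by rw [h3']; rfl)
      change q (σ (e ζ) (e ξ)) = _
      rw [h6, deriv_equiv_comp φ.symm h1'.2.1]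
      change Submodule.Quotient.mk (φ (φ.symm _)) = _
      rw [φ.apply_symm_apply]
  · ext ζ
    have hk := Set.ext_iff.1 hker (φ.symm ζ)
    simp only [Set.mem_ofPred_eq, SetLike.mem_coe, Submodule.mem_span_singleton] at hk ⊢
    have e1 : (∃ a : ℂ, a • φ β = ζ) ↔ ∃ a : ℂ, a • β = φ.symm ζ := by
      refine exists_congr fun a => ?_
      rw [← map_smul, ← φ.eq_symm_apply]
    rw [e1, ← hk]
    constructor
    · rintro ⟨h, hh⟩
      refine ⟨hT _ h, fun ξ hξ => hq _ ?_⟩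
      have := hh ⟨φ ξ, map_mem_tangent φ ξ.2⟩ (map_mem_tangent φ hξ)
      have e2 : e ⟨φ ξ, map_mem_tangent φ ξ.2⟩ = ξ := Subtype.ext (φ.symm_apply_apply ξ)
      change q (σ (e _) (e _)) = 0 at this
      rwa [e2] at this
    · rintro ⟨h, hh⟩
      have h' : ζ ∈ tangent (φ '' 𝒜) (φ β) := by
        have := map_mem_tangent φ h
        rwa [φ.apply_symm_apply] at this
      refine ⟨h', fun ξ hξ => ?_⟩
      have : φ.symm ξ ∈ tangent ℬ β := (map_mem_tangent_iff φ).1 (by simpa using hξ)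
      change q (σ ⟨φ.symm ζ, _⟩ ⟨φ.symm ξ, _⟩) = 0
      rw [hh ⟨φ.symm ξ, hT _ ξ.2⟩ this, map_zero]

end Transport

/-! ### Minimal rational tangents under linear automorphisms -/

section Vmrt

variable {V : Type*} [NormedAddCommGroup V] [NormedSpace ℂ V] [FiniteDimensional ℂ V]

/-- The isomorphism of tangent spaces of projective space induced by a linear automorphism. -/
noncomputable def quotEquiv (Φ : V ≃ₗ[ℂ] V) {x x' : V} (hx : Φ x = x') :
    (V ⧸ (ℂ ∙ x)) ≃L[ℂ] (V ⧸ (ℂ ∙ x')) :=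
  (Submodule.Quotient.equiv (ℂ ∙ x) (ℂ ∙ x') Φ
    (by rw [Submodule.map_span, Set.image_singleton]; simp [hx])).toContinuousLinearEquiv

theorem quotEquiv_mk (Φ : V ≃ₗ[ℂ] V) {x x' : V} (hx : Φ x = x') (w : V) :
    quotEquiv Φ hx (Submodule.Quotient.mk w) = Submodule.Quotient.mk (Φ w) := rfl

theorem quotEquiv_image_subset (Φ : V ≃ₗ[ℂ] V) {x x' : V} (hx : Φ x = x') {Y Y' : Set V}
    (hY : ∀ y ∈ Y, Φ y ∈ Y') : quotEquiv Φ hx '' vmrtCone Y x ⊆ vmrtCone Y' x' := by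
  rintro _ ⟨β, ⟨h0, w, rfl, hw⟩, rfl⟩
  refine ⟨?_, Φ w, rfl, fun a b => ?_⟩
  · rwa [ne_eq, (quotEquiv Φ hx).map_eq_zero_iff]
  · have := hY _ (hw a b)
    rwa [map_add, map_smul, map_smul, hx] at this

theorem quotEquiv_image (Φ : V ≃ₗ[ℂ] V) {x x' : V} (hx : Φ x = x') {Y Y' : Set V}
    (hY : Φ '' Y = Y') : quotEquiv Φ hx '' vmrtCone Y x = vmrtCone Y' x' := by
  subst hY
  have hx' : Φ.symm x' = x := by rw [← hx, Φ.symm_apply_apply]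
  refine (quotEquiv_image_subset Φ hx fun y hy => Set.mem_image_of_mem _ hy).antisymm ?_
  intro β hβ
  obtain ⟨w, rfl⟩ := Submodule.Quotient.mk_surjective _ β
  have := quotEquiv_image_subset Φ.symm hx' (Y' := Y)
    (by rintro _ ⟨y, hy, rfl⟩; simpa using hy) (Set.mem_image_of_mem _ hβ)
  rw [quotEquiv_mk] at this
  exact ⟨_, this, by rw [quotEquiv_mk, Φ.apply_symm_apply]⟩

/-- Used to bring a single tangent direction into standard position, where the automorphism may
change the base point and the subvarieties. -/
theorem nondegAt_vmrtCone_map (Φ : V ≃ₗ[ℂ] V) {x x' : V} (hx : Φ x = x') {X X' Z Z' : Set V}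
    (hX : Φ '' X = X') (hZ : Φ '' Z = Z') {w : V}
    (h : NondegAt (vmrtCone X x) (vmrtCone Z x) (Submodule.Quotient.mk w)) :
    NondegAt (vmrtCone X' x') (vmrtCone Z' x') (Submodule.Quotient.mk (Φ w)) := by
  rw [← quotEquiv_mk Φ hx, ← quotEquiv_image Φ hx hX, ← quotEquiv_image Φ hx hZ]
  exact h.map _

/-- A linear automorphism preserving `X` and `Z` carries nondegeneracy from `x` to its image. -/
theorem isNondegeneratePair_vmrtCone_map (Φ : V ≃ₗ[ℂ] V) {x x' : V} (hx : Φ x = x')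
    {X X' Z Z' : Set V} (hX : Φ '' X = X') (hZ : Φ '' Z = Z')
    (h : IsNondegeneratePair (vmrtCone X x) (vmrtCone Z x)) :
    IsNondegeneratePair (vmrtCone X' x') (vmrtCone Z' x') := by
  rw [← quotEquiv_image Φ hx hX, ← quotEquiv_image Φ hx hZ]
  refine ⟨Set.image_mono h.1, ?_⟩
  rintro _ ⟨β, hβ, rfl⟩
  exact NondegAt.map _ (h.2 β hβ)

end Vmrt

/-! ### Groups generated by exponentials -/

theorem SerreRep.tensorAct_smul {N : Type} [DecidableEq N] (t : ℂ)
    (x : Matrix N N ℂ) : tensorAct (t • x) = t • tensorAct x := by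
  ext i j
  simp only [tensorAct, Matrix.add_apply, Matrix.smul_apply, Matrix.kroneckerMap_apply,
    smul_eq_mul]
  ring

section Exponential

variable {N : Type} [Fintype N] [DecidableEq N]

/-- The matrices which map a subspace into itself. -/
def stabilizingSubalgebra (W : Submodule ℂ (N → ℂ)) : Subalgebra ℂ (Matrix N N ℂ) where
  carrier := {M | ∀ w ∈ W, M *ᵥ w ∈ W}
  mul_mem' {M M'} h h' w hw := by
    rw [← Matrix.mulVec_mulVec]
    exact h _ (h' _ hw)
  one_mem' w hw := by rwa [Matrix.one_mulVec]
  add_mem' {M M'} h h' w hw := by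
    rw [Matrix.add_mulVec]
    exact add_mem (h _ hw) (h' _ hw)
  algebraMap_mem' c w hw := by
    rw [Algebra.algebraMap_eq_smul_one, Matrix.smul_mulVec, Matrix.one_mulVec]
    exact W.smul_mem c hw

theorem mem_stabilizingSubalgebra {W : Submodule ℂ (N → ℂ)} {M : Matrix N N ℂ} :
    M ∈ stabilizingSubalgebra W ↔ ∀ w ∈ W, M *ᵥ w ∈ W := Iff.rfl

/-- The stabilizer of a subspace is a closed subalgebra, and closed subalgebras contain the
exponentials of their elements. -/
theorem exp_mulVec_mem {W : Submodule ℂ (N → ℂ)} {M : Matrix N N ℂ} (h : ∀ w ∈ W, M *ᵥ w ∈ W)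
    {w : N → ℂ} (hw : w ∈ W) : NormedSpace.exp M *ᵥ w ∈ W := by
  have hc : IsClosed (stabilizingSubalgebra W : Set (Matrix N N ℂ)) := by
    have : (stabilizingSubalgebra W : Set (Matrix N N ℂ)) =
        ⋂ w ∈ W, (fun M : Matrix N N ℂ => M *ᵥ w) ⁻¹' (W : Set (N → ℂ)) := by
      ext M; simp [mem_stabilizingSubalgebra]
    rw [this]
    exact isClosed_biInter fun w _ => W.closed_of_finiteDimensional.preimage
      (Continuous.matrix_mulVec continuous_id continuous_const)
  exact NormedSpace.exp_mem hc (mem_stabilizingSubalgebra.2 h) w hw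

theorem exp_of_pow_three {M : Matrix N N ℂ} (h : M * M * M = 0) :
    NormedSpace.exp M = 1 + M + (2⁻¹ : ℂ) • (M * M) := by
  have h3 : M ^ 3 = 0 := by rw [pow_succ, pow_two, h]
  rw [NormedSpace.exp_eq_tsum ℂ]
  simp only
  rw [tsum_eq_sum (s := Finset.range 3)]
  · simp [Finset.sum_range_succ, pow_two]
  · intro k hk
    have : 3 ≤ k := by simpa using hk
    rw [pow_eq_zero_of_le this h3, smul_zero]

/-- The summands M ⊗ 1 and 1 ⊗ M commute, and both embeddings of the matrix algebra are continuous
ring homomorphisms, which commute with the exponential. -/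
theorem exp_tensorAct (M : Matrix N N ℂ) :
    NormedSpace.exp (SerreRep.tensorAct M) = NormedSpace.exp M ⊗ₖ NormedSpace.exp M := by
  have hcomm : Commute (M ⊗ₖ (1 : Matrix N N ℂ)) ((1 : Matrix N N ℂ) ⊗ₖ M) := by
    simp [Commute, SemiconjBy, ← Matrix.mul_kronecker_mul]
  let l : Matrix N N ℂ →+* Matrix (N × N) (N × N) ℂ :=
    { toFun := fun M => M ⊗ₖ 1
      map_one' := by simp
      map_mul' := fun A B => by rw [← Matrix.mul_kronecker_mul, one_mul]
      map_zero' := by simp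
      map_add' := fun A B => Matrix.add_kronecker _ _ _ }
  let r : Matrix N N ℂ →+* Matrix (N × N) (N × N) ℂ :=
    { toFun := fun M => 1 ⊗ₖ M
      map_one' := by simp
      map_mul' := fun A B => by rw [← Matrix.mul_kronecker_mul, one_mul]
      map_zero' := by simp
      map_add' := fun A B => Matrix.kronecker_add _ _ _ }
  have hl : Continuous l :=
    continuous_matrix fun i j => by
      simp only [l, RingHom.coe_mk, MonoidHom.coe_mk, OneHom.coe_mk, Matrix.kroneckerMap_apply]
      fun_prop
  have hr : Continuous r :=
    continuous_matrix fun i j => by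
      simp only [r, RingHom.coe_mk, MonoidHom.coe_mk, OneHom.coe_mk, Matrix.kroneckerMap_apply]
      fun_prop
  have el : NormedSpace.exp (M ⊗ₖ (1 : Matrix N N ℂ)) = NormedSpace.exp M ⊗ₖ 1 := by
    open scoped Matrix.Norms.Operator in exact (NormedSpace.map_exp l hl M).symm
  have er : NormedSpace.exp ((1 : Matrix N N ℂ) ⊗ₖ M) = 1 ⊗ₖ NormedSpace.exp M := by
    open scoped Matrix.Norms.Operator in exact (NormedSpace.map_exp r hr M).symm
  rw [SerreRep.tensorAct, Matrix.exp_add_of_commute _ _ hcomm, el, er, ← Matrix.mul_kronecker_mul,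
    one_mul, mul_one]

/-- The exponential of a matrix as an element of `GL`. -/
noncomputable def expGL (M : Matrix N N ℂ) : GL N ℂ :=
  (Matrix.isUnit_exp M).unit

theorem coe_expGL (M : Matrix N N ℂ) : (expGL M : Matrix N N ℂ) = NormedSpace.exp M := rfl

theorem coe_expGL_inv (M : Matrix N N ℂ) :
    ((expGL M)⁻¹ : GL N ℂ) = expGL (-M) := by
  refine inv_eq_of_mul_eq_one_right (Units.ext ?_)
  rw [Units.val_mul, coe_expGL, coe_expGL,
    ← Matrix.exp_add_of_commute _ _ (Commute.neg_right (Commute.refl M)),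
    add_neg_cancel, NormedSpace.exp_zero, Units.val_one]

/-- The homomorphism `g ↦ g ⊗ g`. -/
noncomputable def tensorGL : GL N ℂ →* GL (N × N) ℂ :=
  Units.map
    { toFun := fun M => M ⊗ₖ M
      map_one' := by simp
      map_mul' := fun A B => Matrix.mul_kronecker_mul _ _ _ _ }

theorem tensorGL_expGL (M : Matrix N N ℂ) : tensorGL (expGL M) = expGL (SerreRep.tensorAct M) :=
  Units.ext (exp_tensorAct M).symm

end Exponential

/-! ### Groups generated by root subgroups and their tensor squares -/

namespace SerreRep

variable {n : ℕ} {A : Matrix (Fin n) (Fin n) ℤ} {N : Type} [Fintype N] [DecidableEq N]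
  (ρ : SerreRep A N)

theorem exp_e_mem (i : Fin n) (t : ℂ) : expGL (t • ρ.e i) ∈ ρ.group :=
  Subgroup.subset_closure ⟨i, t, Or.inl rfl⟩

theorem exp_f_mem (i : Fin n) (t : ℂ) : expGL (t • ρ.f i) ∈ ρ.group :=
  Subgroup.subset_closure ⟨i, t, Or.inr rfl⟩

theorem exp_e_mem_borel (i : Fin n) (t : ℂ) : expGL (t • ρ.e i) ∈ ρ.borel :=
  Subgroup.subset_closure ⟨i, t, Or.inl rfl⟩

theorem exp_h_mem_borel (i : Fin n) (t : ℂ) : expGL (t • ρ.h i) ∈ ρ.borel :=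
  Subgroup.subset_closure ⟨i, t, Or.inr rfl⟩

/-- The elements generating `ρ.group` and `ρ.borel`. -/
def expSet (x y : Fin n → Matrix N N ℂ) : Set (GL N ℂ) := {g | ∃ (i : Fin n) (t : ℂ),
  (g : Matrix N N ℂ) = NormedSpace.exp (t • x i) ∨ (g : Matrix N N ℂ) = NormedSpace.exp (t • y i)}

/-- The generating set is stable under inversion, by t ↦ −t, so inverses need no case of their own.
-/
theorem closure_exp_induction {x y : Fin n → Matrix N N ℂ}
    {p : (g : GL N ℂ) → g ∈ Subgroup.closure (expSet x y) → Prop}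
    (hx : ∀ i (t : ℂ), p (expGL (t • x i)) (Subgroup.subset_closure ⟨i, t, Or.inl rfl⟩))
    (hy : ∀ i (t : ℂ), p (expGL (t • y i)) (Subgroup.subset_closure ⟨i, t, Or.inr rfl⟩))
    (one : p 1 (one_mem _))
    (mul : ∀ g g' hg hg', p g hg → p g' hg' → p (g * g') (mul_mem hg hg')) {g : GL N ℂ}
    (hg : g ∈ Subgroup.closure (expSet x y)) : p g hg := by
  induction hg using Subgroup.closure_induction'' with
  | mem g hg =>
    obtain ⟨i, t, h | h⟩ := hg
    · obtain rfl : g = expGL _ := Units.ext h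
      exact hx i t
    · obtain rfl : g = expGL _ := Units.ext h
      exact hy i t
  | inv_mem g hg =>
    obtain ⟨i, t, h | h⟩ := hg
    · obtain rfl : g = expGL _ := Units.ext h
      have := hx i (-t)
      simp only [neg_smul, ← coe_expGL_inv] at this
      exact this
    · obtain rfl : g = expGL _ := Units.ext h
      have := hy i (-t)
      simp only [neg_smul, ← coe_expGL_inv] at this
      exact this
  | one => exact one
  | mul g g' _ _ h h' => exact mul g g' _ _ h h'

theorem group_induction {p : (g : GL N ℂ) → g ∈ ρ.group → Prop}
    (he : ∀ i (t : ℂ), p (expGL (t • ρ.e i)) (ρ.exp_e_mem i t))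
    (hf : ∀ i (t : ℂ), p (expGL (t • ρ.f i)) (ρ.exp_f_mem i t)) (one : p 1 (one_mem _))
    (mul : ∀ g g' hg hg', p g hg → p g' hg' → p (g * g') (mul_mem hg hg')) {g : GL N ℂ}
    (hg : g ∈ ρ.group) : p g hg :=
  closure_exp_induction he hf one mul hg

theorem borel_induction {p : (g : GL N ℂ) → g ∈ ρ.borel → Prop}
    (he : ∀ i (t : ℂ), p (expGL (t • ρ.e i)) (ρ.exp_e_mem_borel i t))
    (hh : ∀ i (t : ℂ), p (expGL (t • ρ.h i)) (ρ.exp_h_mem_borel i t)) (one : p 1 (one_mem _))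
    (mul : ∀ g g' hg hg', p g hg → p g' hg' → p (g * g') (mul_mem hg hg')) {g : GL N ℂ}
    (hg : g ∈ ρ.borel) : p g hg :=
  closure_exp_induction he hh one mul hg

/-- Reduces the action on bivectors to matrices acting on ℂ²⁷. -/
theorem mem_tensorSquare_group {g : GL (N × N) ℂ} :
    g ∈ ρ.tensorSquare.group ↔ ∃ g' ∈ ρ.group, tensorGL g' = g := by
  constructor
  · intro hg
    induction hg using ρ.tensorSquare.group_induction with
    | he i t => exact ⟨_, ρ.exp_e_mem i t, by rw [tensorGL_expGL, tensorAct_smul]; rfl⟩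
    | hf i t => exact ⟨_, ρ.exp_f_mem i t, by rw [tensorGL_expGL, tensorAct_smul]; rfl⟩
    | one => exact ⟨1, one_mem _, map_one _⟩
    | mul g g' _ _ h h' =>
      obtain ⟨k, hk, rfl⟩ := h
      obtain ⟨k', hk', rfl⟩ := h'
      exact ⟨_, mul_mem hk hk', map_mul _ _ _⟩
  · rintro ⟨g', hg', rfl⟩
    induction hg' using ρ.group_induction with
    | he i t => rw [tensorGL_expGL, tensorAct_smul]; exact ρ.tensorSquare.exp_e_mem i t
    | hf i t => rw [tensorGL_expGL, tensorAct_smul]; exact ρ.tensorSquare.exp_f_mem i t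
    | one => rw [map_one]; exact one_mem _
    | mul g g' _ _ h h' => rw [map_mul]; exact mul_mem h h'

/-! ### The submodule generated by a highest weight vector -/

/-- `v` is a weight vector of weight `μ`. -/
def IsWeightVector (μ : Fin n → ℤ) (v : N → ℂ) : Prop := ∀ k, ρ.h k *ᵥ v = (μ k : ℂ) • v

/-- `FWord ρ v w d`: the vector `w` is obtained from `v` by repeated application of the `f i`, each
`f i` occurring `d i` times. -/
inductive FWord (v : N → ℂ) : (N → ℂ) → (Fin n → ℕ) → Prop
  | base : FWord v v 0
  | step (i : Fin n) (w : N → ℂ) (d : Fin n → ℕ) (h : FWord v w d) :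
      FWord v (ρ.f i *ᵥ w) (d + Pi.single i 1)

/-- The span of the vectors obtained from `v` by repeated application of the `f i`. -/
def hwSpan (v : N → ℂ) : Submodule ℂ (N → ℂ) := Submodule.span ℂ {w | ∃ d, ρ.FWord v w d}

variable {ρ}

theorem self_mem_hwSpan (v : N → ℂ) : v ∈ ρ.hwSpan v := Submodule.subset_span ⟨0, FWord.base⟩

theorem f_mem_hwSpan {v w : N → ℂ} (i : Fin n) (h : w ∈ ρ.hwSpan v) :
    ρ.f i *ᵥ w ∈ ρ.hwSpan v := by
  induction h using Submodule.span_induction with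
  | mem w hw =>
    obtain ⟨d, hd⟩ := hw
    exact Submodule.subset_span ⟨_, FWord.step i w d hd⟩
  | zero => rw [Matrix.mulVec_zero]; exact zero_mem _
  | add x y _ _ hx hy => rw [Matrix.mulVec_add]; exact add_mem hx hy
  | smul c x _ hx => rw [Matrix.mulVec_smul]; exact Submodule.smul_mem _ _ hx

/-- Each application of `f i` lowers the weight by α_i. -/
theorem FWord.weight {v : N → ℂ} {μ : Fin n → ℤ} (hv : ρ.IsWeightVector μ v) {w : N → ℂ}
    {d : Fin n → ℕ} (h : ρ.FWord v w d) :
    ρ.IsWeightVector (fun k => μ k - ∑ i, d i * A i k) w := by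
  induction h with
  | base => intro k; simpa using hv k
  | step i w d h ih =>
    intro k
    have h1 := ρ.lie_h_f k i
    rw [Ring.lie_def, sub_eq_iff_eq_add] at h1
    rw [Matrix.mulVec_mulVec, h1, Matrix.add_mulVec, ← Matrix.mulVec_mulVec, ih k,
      Matrix.mulVec_smul, Matrix.neg_mulVec, Matrix.smul_mulVec, ← neg_smul, ← Int.cast_smul_eq_zsmul ℂ,
      ← add_smul]
    congr 1
    have : ∑ j, ((d + Pi.single i 1 : Fin n → ℕ) j : ℤ) * A j k = ∑ j, d j * A j k + A i k := by
      simp [add_mul, Finset.sum_add_distrib, Pi.single_apply]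
    simp only [this]
    push_cast
    ring

theorem h_mem_hwSpan {v w : N → ℂ} {μ : Fin n → ℤ} (hv : ρ.IsWeightVector μ v) (k : Fin n)
    (h : w ∈ ρ.hwSpan v) : ρ.h k *ᵥ w ∈ ρ.hwSpan v := by
  induction h using Submodule.span_induction with
  | mem w hw =>
    obtain ⟨d, hd⟩ := hw
    rw [hd.weight hv k]
    exact Submodule.smul_mem _ _ (Submodule.subset_span ⟨_, hd⟩)
  | zero => rw [Matrix.mulVec_zero]; exact zero_mem _
  | add x y _ _ hx hy => rw [Matrix.mulVec_add]; exact add_mem hx hy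
  | smul c x _ hx => rw [Matrix.mulVec_smul]; exact Submodule.smul_mem _ _ hx

/-- Induction on the word with e_k f_i = f_i e_k + δ_{ik} h_k: the span of the lowering words of a
highest weight vector is already stable under the raising operators. -/
theorem FWord.e_mem {v : N → ℂ} {μ : Fin n → ℤ} (hv : ρ.IsWeightVector μ v)
    (he : ∀ k, ρ.e k *ᵥ v = 0) {w : N → ℂ} {d : Fin n → ℕ} (h : ρ.FWord v w d) (k : Fin n) :
    ρ.e k *ᵥ w ∈ ρ.hwSpan v := by
  induction h with
  | base => rw [he]; exact zero_mem _
  | step i w d h ih =>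
    have h1 := ρ.lie_e_f k i
    rw [Ring.lie_def, sub_eq_iff_eq_add] at h1
    rw [Matrix.mulVec_mulVec, h1, Matrix.add_mulVec, ← Matrix.mulVec_mulVec]
    refine add_mem ?_ (f_mem_hwSpan i ih)
    split_ifs
    · exact h_mem_hwSpan hv k (Submodule.subset_span ⟨_, h⟩)
    · rw [Matrix.zero_mulVec]; exact zero_mem _

theorem e_mem_hwSpan {v w : N → ℂ} {μ : Fin n → ℤ} (hv : ρ.IsWeightVector μ v)
    (he : ∀ k, ρ.e k *ᵥ v = 0) (k : Fin n) (h : w ∈ ρ.hwSpan v) : ρ.e k *ᵥ w ∈ ρ.hwSpan v := by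
  induction h using Submodule.span_induction with
  | mem w hw =>
    obtain ⟨d, hd⟩ := hw
    exact hd.e_mem hv he k
  | zero => rw [Matrix.mulVec_zero]; exact zero_mem _
  | add x y _ _ hx hy => rw [Matrix.mulVec_add]; exact add_mem hx hy
  | smul c x _ hx => rw [Matrix.mulVec_smul]; exact Submodule.smul_mem _ _ hx

/-- A subspace stable under the generators is stable under the group. -/
theorem group_mulVec_mem {W : Submodule ℂ (N → ℂ)} (he : ∀ k, ∀ w ∈ W, ρ.e k *ᵥ w ∈ W)
    (hf : ∀ k, ∀ w ∈ W, ρ.f k *ᵥ w ∈ W) {g : GL N ℂ} (hg : g ∈ ρ.group) :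
    ∀ w ∈ W, (g : Matrix N N ℂ) *ᵥ w ∈ W := by
  induction hg using ρ.group_induction with
  | he i t =>
    intro w hw
    refine exp_mulVec_mem (fun w hw => ?_) hw
    rw [Matrix.smul_mulVec]
    exact W.smul_mem _ (he i w hw)
  | hf i t =>
    intro w hw
    refine exp_mulVec_mem (fun w hw => ?_) hw
    rw [Matrix.smul_mulVec]
    exact W.smul_mem _ (hf i w hw)
  | one => intro w hw; simpa using hw
  | mul g g' _ _ h h' =>
    intro w hw
    rw [Units.val_mul, ← Matrix.mulVec_mulVec]
    exact h _ (h' _ hw)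

theorem group_mem_hwSpan {v w : N → ℂ} {μ : Fin n → ℤ} (hv : ρ.IsWeightVector μ v)
    (he : ∀ k, ρ.e k *ᵥ v = 0) {g : GL N ℂ} (hg : g ∈ ρ.group) (h : w ∈ ρ.hwSpan v) :
    (g : Matrix N N ℂ) *ᵥ w ∈ ρ.hwSpan v :=
  group_mulVec_mem (fun k _ => e_mem_hwSpan hv he k) (fun k _ => f_mem_hwSpan k) hg w h

/-- A linear functional vanishing on `v` and on the ranges of all `f i` vanishes on the
submodule generated by `v`. -/
theorem apply_eq_zero_of_mem_hwSpan {v w : N → ℂ} (ψ : (N → ℂ) →ₗ[ℂ] ℂ) (h0 : ψ v = 0)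
    (hψ : ∀ i w, ψ (ρ.f i *ᵥ w) = 0) (h : w ∈ ρ.hwSpan v) : ψ w = 0 := by
  induction h using Submodule.span_induction with
  | mem w hw =>
    obtain ⟨d, hd⟩ := hw
    cases hd with
    | base => exact h0
    | step i w d h => exact hψ _ _
  | zero => simp
  | add x y _ _ hx hy => rw [map_add, hx, hy, add_zero]
  | smul c x _ hx => rw [map_smul, hx, smul_zero]

theorem IsFundamentalVector.isWeightVector {i : Fin n} {v : N → ℂ}
    (h : ρ.IsFundamentalVector i v) : ρ.IsWeightVector (Pi.single i 1) v := by
  intro k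
  rw [h.2.2 k]
  by_cases hk : k = i
  · subst hk; simp
  · simp [hk]

end SerreRep

namespace F4

/-! ### Coordinates in the 27-dimensional representation -/

/-- The weight basis. -/
def u (a : Fin 27) : Fin 27 → ℂ := Pi.single a 1

theorem sum_count_mul (l : List (Fin 27)) (y : Fin 27 → ℂ) :
    ∑ s, (l.count s : ℂ) * y s = (l.map y).sum := by
  induction l with
  | nil => simp
  | cons a l ih =>
    simp only [List.count_cons, Nat.cast_add, add_mul, Finset.sum_add_distrib, ih, List.map_cons,
      List.sum_cons, beq_iff_eq, Nat.cast_ite, Nat.cast_one, Nat.cast_zero, ite_mul, one_mul,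
      zero_mul, Finset.sum_ite_eq, Finset.mem_univ, if_true]
    ring

theorem count_eNbr : ∀ i a b, (eNbr i a).count b = (fNbr i b).count a := by decide +kernel

theorem e_apply (i : Fin 4) (y : Fin 27 → ℂ) (a : Fin 27) :
    (e i *ᵥ y) a = ((fNbr i a).map y).sum := by
  rw [← sum_count_mul]
  simp [e, adj, Matrix.mulVec, dotProduct, count_eNbr]

theorem f_apply (i : Fin 4) (y : Fin 27 → ℂ) (a : Fin 27) :
    (f i *ᵥ y) a = ((eNbr i a).map y).sum := by
  rw [← sum_count_mul]
  simp [f, adj, Matrix.mulVec, dotProduct, count_eNbr]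

theorem listVec_eq_sum (l : List (Fin 27)) : listVec l = (l.map u).sum := by
  induction l with
  | nil => ext; simp [listVec]
  | cons a l ih =>
    rw [List.map_cons, List.sum_cons, ← ih, u, ← listVec_singleton, ← listVec_append]
    rfl

theorem e_u (i : Fin 4) (a : Fin 27) : e i *ᵥ u a = ((eNbr i a).map u).sum := by
  rw [← listVec_eq_sum, u, ← listVec_singleton, e, adj_mulVec]
  simp

theorem f_u (i : Fin 4) (a : Fin 27) : f i *ᵥ u a = ((fNbr i a).map u).sum := by
  rw [← listVec_eq_sum, u, ← listVec_singleton, f, adj_mulVec]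
  simp

/-- The weights of the weight basis. -/
def wt (i : Fin 4) (a : Fin 27) : ℤ :=
  (((fNbr i a).flatMap (eNbr i)).count a : ℤ) - ((eNbr i a).flatMap (fNbr i)).count a

/-- Splitting the weight into its positive and negative parts turns the eigenvalue equation of [e_i,
f_i] into an identity of multisets that can be decided. -/
theorem h_perm : ∀ i a, ((fNbr i a).flatMap (eNbr i) ++ List.replicate (-wt i a).toNat a).Perm
    ((eNbr i a).flatMap (fNbr i) ++ List.replicate (wt i a).toNat a) := by decide +kernel

theorem listVec_replicate (q : ℕ) (a : Fin 27) :
    listVec (List.replicate q a) = (q : ℂ) • listVec [a] := by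
  ext r
  by_cases h : a = r
  · subst h; simp [listVec]
  · simp [listVec, List.count_replicate, h]

theorem h_eq_diagonal (i : Fin 4) : rep27.h i = Matrix.diagonal fun a => (wt i a : ℂ) := by
  apply ext_col
  intro a
  have h1 := listVec_perm (h_perm i a)
  simp only [listVec_append, listVec_replicate] at h1
  have h2 : ((wt i a).toNat : ℂ) - ((-wt i a).toNat : ℂ) = (wt i a : ℂ) := by
    exact_mod_cast Int.toNat_sub_toNat_neg (wt i a)
  have h3 : (Matrix.diagonal fun a => (wt i a : ℂ)) *ᵥ listVec [a] = (wt i a : ℂ) • listVec [a] := by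
    rw [listVec_singleton, Matrix.diagonal_mulVec_single]
    ext r
    simp [Pi.single_apply]
  rw [h3, ← h2, sub_smul]
  change ⁅adj (eNbr i), adj (fNbr i)⁆ *ᵥ _ = _
  simp only [Ring.lie_def, Matrix.sub_mulVec, ← Matrix.mulVec_mulVec, adj_mulVec,
    List.flatMap_singleton]
  linear_combination (exp := 1) h1

theorem h_apply (i : Fin 4) (y : Fin 27 → ℂ) (a : Fin 27) :
    (rep27.h i *ᵥ y) a = wt i a * y a := by
  rw [h_eq_diagonal, Matrix.mulVec_diagonal]

/-- Simple root strings through the weights of ℂ²⁷ have at most three members, so the root groups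
act by quadratic polynomials. -/
theorem e_pow_three (i : Fin 4) : e i * e i * e i = 0 := by
  apply ext_col
  intro k
  simp only [← Matrix.mulVec_mulVec, e, adj_mulVec, Matrix.zero_mulVec]
  have : ∀ i k, (([k].flatMap (eNbr i)).flatMap (eNbr i)).flatMap (eNbr i) = [] := by
    decide +kernel
  rw [this]
  ext; simp [listVec]

theorem f_pow_three (i : Fin 4) : f i * f i * f i = 0 := by
  apply ext_col
  intro k
  simp only [← Matrix.mulVec_mulVec, f, adj_mulVec, Matrix.zero_mulVec]
  have : ∀ i k, (([k].flatMap (fNbr i)).flatMap (fNbr i)).flatMap (fNbr i) = [] := by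
    decide +kernel
  rw [this]
  ext; simp [listVec]

/-- The one-parameter group of `e i`. -/
noncomputable def xe (i : Fin 4) (t : ℂ) : GL (Fin 27) ℂ := expGL (t • e i)

/-- The one-parameter group of `f i`. -/
noncomputable def xf (i : Fin 4) (t : ℂ) : GL (Fin 27) ℂ := expGL (t • f i)

theorem exp_smul_mulVec {M : Matrix (Fin 27) (Fin 27) ℂ} (h : M * M * M = 0) (t : ℂ)
    (y : Fin 27 → ℂ) : NormedSpace.exp (t • M) *ᵥ y =
      y + t • (M *ᵥ y) + (t ^ 2 / 2) • (M *ᵥ (M *ᵥ y)) := by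
  have h' : (t • M) * (t • M) * (t • M) = 0 := by simp [h]
  rw [exp_of_pow_three h', Matrix.add_mulVec, Matrix.add_mulVec, Matrix.one_mulVec,
    Matrix.smul_mulVec, smul_mul_smul_comm, Matrix.smul_mulVec, Matrix.smul_mulVec, smul_smul,
    ← Matrix.mulVec_mulVec]
  congr 2
  ring

theorem xe_mulVec (i : Fin 4) (t : ℂ) (y : Fin 27 → ℂ) :
    (xe i t : Matrix (Fin 27) (Fin 27) ℂ) *ᵥ y =
      y + t • (e i *ᵥ y) + (t ^ 2 / 2) • (e i *ᵥ (e i *ᵥ y)) :=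
  exp_smul_mulVec (e_pow_three i) t y

theorem xf_mulVec (i : Fin 4) (t : ℂ) (y : Fin 27 → ℂ) :
    (xf i t : Matrix (Fin 27) (Fin 27) ℂ) *ᵥ y =
      y + t • (f i *ᵥ y) + (t ^ 2 / 2) • (f i *ᵥ (f i *ᵥ y)) :=
  exp_smul_mulVec (f_pow_three i) t y

/-! ### Bivectors -/

theorem kronecker_mulVec_wedge (M : Matrix (Fin 27) (Fin 27) ℂ) (x y : Fin 27 → ℂ) :
    (M ⊗ₖ M) *ᵥ wedge x y = wedge (M *ᵥ x) (M *ᵥ y) := by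
  have h : wedge x y = (fun p => x p.1 * y p.2) - fun p => y p.1 * x p.2 := rfl
  rw [h, Matrix.mulVec_sub, kronecker_mulVec_mul, kronecker_mulVec_mul]
  rfl

theorem wedge_add_left (x x' y : Fin 27 → ℂ) : wedge (x + x') y = wedge x y + wedge x' y := by
  ext p; simp [wedge]; ring

theorem wedge_add_right (x y y' : Fin 27 → ℂ) : wedge x (y + y') = wedge x y + wedge x y' := by
  ext p; simp [wedge]; ring

theorem wedge_smul_left (c : ℂ) (x y : Fin 27 → ℂ) : wedge (c • x) y = c • wedge x y := by
  ext p; simp [wedge]; ring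

theorem wedge_smul_right (c : ℂ) (x y : Fin 27 → ℂ) : wedge x (c • y) = c • wedge x y := by
  ext p; simp [wedge]; ring

theorem wedge_self (x : Fin 27 → ℂ) : wedge x x = 0 := by
  ext p; simp [wedge]

theorem wedge_swap (x y : Fin 27 → ℂ) : wedge y x = -wedge x y := by
  ext p; simp [wedge]

theorem wedge_zero_left (y : Fin 27 → ℂ) : wedge 0 y = 0 := by
  ext p; simp [wedge]

theorem wedge_zero_right (x : Fin 27 → ℂ) : wedge x 0 = 0 := by
  ext p; simp [wedge]

theorem v₃_eq : v₃ = wedge (u 0) (u 1) := rfl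

theorem tensor_apply (M : Matrix (Fin 27) (Fin 27) ℂ) (z : Fin 27 × Fin 27 → ℂ) (a b : Fin 27) :
    (SerreRep.tensorAct M *ᵥ z) (a, b) =
      (M *ᵥ fun a' => z (a', b)) a + (M *ᵥ fun b' => z (a, b')) b := by
  rw [SerreRep.tensorAct, Matrix.add_mulVec, Pi.add_apply]
  congr 1 <;> simp [Matrix.mulVec, dotProduct, Fintype.sum_prod_type, Matrix.one_apply]

theorem tensor_e_apply (i : Fin 4) (z : Fin 27 × Fin 27 → ℂ) (a b : Fin 27) :
    (rep.e i *ᵥ z) (a, b) = ((fNbr i a).map fun a' => z (a', b)).sum +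
      ((fNbr i b).map fun b' => z (a, b')).sum := by
  rw [← e_apply, ← e_apply]
  exact tensor_apply _ _ _ _

theorem tensor_f_apply (i : Fin 4) (z : Fin 27 × Fin 27 → ℂ) (a b : Fin 27) :
    (rep.f i *ᵥ z) (a, b) = ((eNbr i a).map fun a' => z (a', b)).sum +
      ((eNbr i b).map fun b' => z (a, b')).sum := by
  rw [← f_apply, ← f_apply]
  exact tensor_apply _ _ _ _

theorem tensor_h_apply (i : Fin 4) (z : Fin 27 × Fin 27 → ℂ) (a b : Fin 27) :
    (rep.h i *ᵥ z) (a, b) = (wt i a + wt i b) * z (a, b) := by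
  have : (rep.h i *ᵥ z) (a, b) = _ := tensor_apply (rep27.h i) z a b
  rw [this, h_apply, h_apply]
  ring

theorem rep_e_wedge (i : Fin 4) (x y : Fin 27 → ℂ) :
    rep.e i *ᵥ wedge x y = wedge (e i *ᵥ x) y + wedge x (e i *ᵥ y) := tensorAct_mulVec_wedge _ _ _

/-! ### Semi-invariant functionals -/

/-- The linear functional which vanishes on the complement of the trivial summand. -/
noncomputable def tr : (Fin 27 → ℂ) →ₗ[ℂ] ℂ :=
  LinearMap.proj (R := ℂ) (φ := fun _ => ℂ) 12 - LinearMap.proj 13 + LinearMap.proj 14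

theorem tr_apply (y : Fin 27 → ℂ) : tr y = y 12 - y 13 + y 14 := rfl

theorem tr_f (i : Fin 4) (y : Fin 27 → ℂ) : tr (f i *ᵥ y) = 0 := by
  rw [tr_apply, f_apply, f_apply, f_apply]
  fin_cases i <;> simp [eNbr, edges]

/-- The functional `z ↦ ∑ c z(a,b)` belonging to a list of triples `(a, b, c)`. -/
noncomputable def functional (l : List (Fin 27 × Fin 27 × ℤ)) :
    (Fin 27 × Fin 27 → ℂ) →ₗ[ℂ] ℂ where
  toFun z := (l.map fun p => (p.2.2 : ℂ) * z (p.1, p.2.1)).sum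
  map_add' z z' := by
    simp only [Pi.add_apply, mul_add]
    exact List.sum_map_add
  map_smul' c z := by
    simp only [Pi.smul_apply, smul_eq_mul, mul_left_comm _ c, RingHom.id_apply]
    exact List.sum_map_mul_left _ _ _

theorem functional_apply (l : List (Fin 27 × Fin 27 × ℤ)) (z : Fin 27 × Fin 27 → ℂ) :
    functional l z = (l.map fun p => (p.2.2 : ℂ) * z (p.1, p.2.1)).sum := rfl

/-- The functional on bivectors belonging to the highest root. -/
noncomputable def adjFunctional : (Fin 27 × Fin 27 → ℂ) →ₗ[ℂ] ℂ :=
  functional [(0, 7, 1), (7, 0, -1), (1, 5, -1), (5, 1, 1), (2, 3, 1), (3, 2, -1)]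

/-- The symmetric functional of weight `ω₄`. -/
noncomputable def symFunctional : (Fin 27 × Fin 27 → ℂ) →ₗ[ℂ] ℂ :=
  functional [(0, 12, 1), (12, 0, 1), (1, 10, -1), (10, 1, -1), (2, 8, 1), (8, 2, 1), (3, 6, -1),
    (6, 3, -1), (4, 5, 1), (5, 4, 1)]

/-- The invariant symmetric functional. -/
noncomputable def invFunctional : (Fin 27 × Fin 27 → ℂ) →ₗ[ℂ] ℂ :=
  functional [(0, 26, 1), (26, 0, 1), (1, 25, -1), (25, 1, -1), (2, 24, 1), (24, 2, 1),
    (3, 23, -1), (23, 3, -1), (4, 21, 1), (21, 4, 1), (5, 22, 1), (22, 5, 1), (6, 19, -1),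
    (19, 6, -1), (7, 20, -1), (20, 7, -1), (8, 17, 1), (17, 8, 1), (9, 18, 1), (18, 9, 1),
    (10, 15, -1), (15, 10, -1), (11, 16, -1), (16, 11, -1), (12, 12, 1), (13, 13, 1), (14, 14, 1)]

/-- The signs in the list are chosen so that the contributions of each lowering operator cancel. By
`apply_eq_zero_of_mem_hwSpan` such a functional vanishes on any highest weight module whose
generator it kills. The same holds for the two symmetric functionals below. -/
theorem adjFunctional_f (i : Fin 4) (z : Fin 27 × Fin 27 → ℂ) :
    adjFunctional (rep.f i *ᵥ z) = 0 := by
  simp only [adjFunctional, functional_apply, List.map_cons, List.map_nil, List.sum_cons,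
    List.sum_nil, tensor_f_apply]
  fin_cases i <;> (simp [eNbr, edges]; try ring)

theorem symFunctional_f (i : Fin 4) (z : Fin 27 × Fin 27 → ℂ) :
    symFunctional (rep.f i *ᵥ z) = 0 := by
  simp only [symFunctional, functional_apply, List.map_cons, List.map_nil, List.sum_cons,
    List.sum_nil, tensor_f_apply]
  fin_cases i <;> (simp [eNbr, edges]; try ring)

theorem invFunctional_f (i : Fin 4) (z : Fin 27 × Fin 27 → ℂ) :
    invFunctional (rep.f i *ᵥ z) = 0 := by
  simp only [invFunctional, functional_apply, List.map_cons, List.map_nil, List.sum_cons,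
    List.sum_nil, tensor_f_apply]
  fin_cases i <;> (simp [eNbr, edges]; try ring)

end F4

/-! ### The action of matrix groups -/

/-- The linear automorphism belonging to an invertible matrix. -/
noncomputable def glEquiv {N : Type} [Fintype N] [DecidableEq N] (g : GL N ℂ) :
    (N → ℂ) ≃ₗ[ℂ] (N → ℂ) where
  toFun y := (g : Matrix N N ℂ) *ᵥ y
  invFun y := ((g⁻¹ : GL N ℂ) : Matrix N N ℂ) *ᵥ y
  left_inv y := by
    change _ *ᵥ (_ *ᵥ y) = y
    rw [Matrix.mulVec_mulVec, ← Units.val_mul, inv_mul_cancel, Units.val_one,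
    Matrix.one_mulVec]
  right_inv y := by
    change _ *ᵥ (_ *ᵥ y) = y
    rw [Matrix.mulVec_mulVec, ← Units.val_mul, mul_inv_cancel, Units.val_one,
    Matrix.one_mulVec]
  map_add' := Matrix.mulVec_add _
  map_smul' c y := Matrix.mulVec_smul _ c y

theorem glEquiv_apply {N : Type} [Fintype N] [DecidableEq N] (g : GL N ℂ) (y : N → ℂ) :
    glEquiv g y = (g : Matrix N N ℂ) *ᵥ y := rfl

theorem glEquiv_mul {N : Type} [Fintype N] [DecidableEq N] (g g' : GL N ℂ) (y : N → ℂ) :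
    glEquiv (g * g') y = glEquiv g (glEquiv g' y) := by
  rw [glEquiv_apply, glEquiv_apply, glEquiv_apply, Units.val_mul, Matrix.mulVec_mulVec]

theorem glEquiv_one {N : Type} [Fintype N] [DecidableEq N] (y : N → ℂ) :
    glEquiv (1 : GL N ℂ) y = y := by
  rw [glEquiv_apply, Units.val_one, Matrix.one_mulVec]

theorem glEquiv_inv_apply {N : Type} [Fintype N] [DecidableEq N] (g : GL N ℂ) (y : N → ℂ) :
    glEquiv g⁻¹ (glEquiv g y) = y := by
  rw [← glEquiv_mul, inv_mul_cancel, glEquiv_one]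

namespace F4

/-- The action on bivectors. -/
noncomputable def biv (g : GL (Fin 27) ℂ) : (Fin 27 × Fin 27 → ℂ) ≃ₗ[ℂ] (Fin 27 × Fin 27 → ℂ) :=
  glEquiv (tensorGL g)

theorem biv_wedge (g : GL (Fin 27) ℂ) (x y : Fin 27 → ℂ) :
    biv g (wedge x y) = wedge (glEquiv g x) (glEquiv g y) :=
  kronecker_mulVec_wedge _ _ _

theorem biv_mul (g g' : GL (Fin 27) ℂ) (z : Fin 27 × Fin 27 → ℂ) :
    biv (g * g') z = biv g (biv g' z) := by
  rw [biv, map_mul, glEquiv_mul]; rfl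

theorem biv_one (z : Fin 27 × Fin 27 → ℂ) : biv 1 z = z := by
  rw [biv, map_one, glEquiv_one]

theorem biv_inv_apply (g : GL (Fin 27) ℂ) (z : Fin 27 × Fin 27 → ℂ) :
    biv g⁻¹ (biv g z) = z := by
  rw [← biv_mul, inv_mul_cancel, biv_one]

theorem xe_apply (i : Fin 4) (t : ℂ) (y : Fin 27 → ℂ) :
    glEquiv (xe i t) y = y + t • (e i *ᵥ y) + (t ^ 2 / 2) • (e i *ᵥ (e i *ᵥ y)) := xe_mulVec i t y

theorem xf_apply (i : Fin 4) (t : ℂ) (y : Fin 27 → ℂ) :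
    glEquiv (xf i t) y = y + t • (f i *ᵥ y) + (t ^ 2 / 2) • (f i *ᵥ (f i *ᵥ y)) := xf_mulVec i t y

theorem xe_inv (i : Fin 4) (t : ℂ) : (xe i t)⁻¹ = xe i (-t) := by
  rw [xe, xe, coe_expGL_inv, neg_smul]

theorem xf_inv (i : Fin 4) (t : ℂ) : (xf i t)⁻¹ = xf i (-t) := by
  rw [xf, xf, coe_expGL_inv, neg_smul]

/-- The subgroup generated by the root subgroups of the simple roots in `I` and their negatives. -/
noncomputable def gen (I : Set (Fin 4)) : Subgroup (GL (Fin 27) ℂ) :=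
  Subgroup.closure {g | ∃ i ∈ I, ∃ t : ℂ, g = xe i t ∨ g = xf i t}

theorem xe_mem_gen {I : Set (Fin 4)} {i : Fin 4} (hi : i ∈ I) (t : ℂ) : xe i t ∈ gen I :=
  Subgroup.subset_closure ⟨i, hi, t, Or.inl rfl⟩

theorem xf_mem_gen {I : Set (Fin 4)} {i : Fin 4} (hi : i ∈ I) (t : ℂ) : xf i t ∈ gen I :=
  Subgroup.subset_closure ⟨i, hi, t, Or.inr rfl⟩

theorem gen_mono {I J : Set (Fin 4)} (h : I ⊆ J) : gen I ≤ gen J := by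
  refine Subgroup.closure_mono ?_
  rintro g ⟨i, hi, h'⟩
  exact ⟨i, h hi, h'⟩

theorem gen_induction {I : Set (Fin 4)} {p : (g : GL (Fin 27) ℂ) → g ∈ gen I → Prop}
    (he : ∀ i (hi : i ∈ I) (t : ℂ), p (xe i t) (xe_mem_gen hi t))
    (hf : ∀ i (hi : i ∈ I) (t : ℂ), p (xf i t) (xf_mem_gen hi t)) (one : p 1 (one_mem _))
    (mul : ∀ g g' hg hg', p g hg → p g' hg' → p (g * g') (mul_mem hg hg')) {g : GL (Fin 27) ℂ}
    (hg : g ∈ gen I) : p g hg := by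
  induction hg using Subgroup.closure_induction'' with
  | mem g hg =>
    obtain ⟨i, hi, t, rfl | rfl⟩ := hg
    · exact he i hi t
    · exact hf i hi t
  | inv_mem g hg =>
    obtain ⟨i, hi, t, rfl | rfl⟩ := hg
    · have := he i hi (-t)
      simp only [← xe_inv] at this
      exact this
    · have := hf i hi (-t)
      simp only [← xf_inv] at this
      exact this
  | one => exact one
  | mul g g' _ _ h h' => exact mul g g' _ _ h h'

theorem restrict_group_eq {m : ℕ} (ι : Fin m ↪ Fin 4) :
    (rep27.restrict ι).group = gen (Set.range ι) := by
  apply le_antisymm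
  · intro g hg
    induction hg using SerreRep.group_induction with
    | he i t => exact xe_mem_gen (Set.mem_range_self i) t
    | hf i t => exact xf_mem_gen (Set.mem_range_self i) t
    | one => exact one_mem _
    | mul g g' _ _ h h' => exact mul_mem h h'
  · intro g hg
    induction hg using gen_induction with
    | he i hi t => obtain ⟨i, rfl⟩ := hi; exact (rep27.restrict ι).exp_e_mem i t
    | hf i hi t => obtain ⟨i, rfl⟩ := hi; exact (rep27.restrict ι).exp_f_mem i t
    | one => exact one_mem _
    | mul g g' _ _ h h' => exact mul_mem h h'

theorem group_eq : rep27.group = gen Set.univ := by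
  apply le_antisymm
  · intro g hg
    induction hg using SerreRep.group_induction with
    | he i t => exact xe_mem_gen (Set.mem_univ i) t
    | hf i t => exact xf_mem_gen (Set.mem_univ i) t
    | one => exact one_mem _
    | mul g g' _ _ h h' => exact mul_mem h h'
  · intro g hg
    induction hg using gen_induction with
    | he i hi t => exact rep27.exp_e_mem i t
    | hf i hi t => exact rep27.exp_f_mem i t
    | one => exact one_mem _
    | mul g g' _ _ h h' => exact mul_mem h h'

theorem mem_orbitCone_restrict {m : ℕ} {ι : Fin m ↪ Fin 4} {v z : Fin 27 × Fin 27 → ℂ} :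
    z ∈ orbitCone (rep.restrict ι).group v ↔ ∃ g ∈ gen (Set.range ι), ∃ c : ℂ, z = c • biv g v := by
  rw [← restrict_group_eq]
  constructor
  · rintro ⟨g, hg, c, rfl⟩
    obtain ⟨g, hg', rfl⟩ := (rep27.restrict ι).mem_tensorSquare_group.1 hg
    exact ⟨g, hg', c, rfl⟩
  · rintro ⟨g, hg, c, rfl⟩
    exact ⟨_, (rep27.restrict ι).mem_tensorSquare_group.2 ⟨g, hg, rfl⟩, c, rfl⟩

theorem mem_X_iff {z : Fin 27 × Fin 27 → ℂ} :
    z ∈ X ↔ ∃ g ∈ gen Set.univ, ∃ c : ℂ, z = c • biv g v₃ := by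
  rw [← group_eq]
  constructor
  · rintro ⟨g, hg, c, rfl⟩
    obtain ⟨g, hg', rfl⟩ := rep27.mem_tensorSquare_group.1 hg
    exact ⟨g, hg', c, rfl⟩
  · rintro ⟨g, hg, c, rfl⟩
    exact ⟨_, rep27.mem_tensorSquare_group.2 ⟨g, hg, rfl⟩, c, rfl⟩

theorem biv_mem_X {g : GL (Fin 27) ℂ} (hg : g ∈ gen Set.univ) {z : Fin 27 × Fin 27 → ℂ}
    (hz : z ∈ X) : biv g z ∈ X := by
  obtain ⟨g', hg', c, rfl⟩ := mem_X_iff.1 hz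
  exact mem_X_iff.2 ⟨g * g', mul_mem hg hg', c, by rw [map_smul, biv_mul]⟩

theorem biv_mem_X_iff {g : GL (Fin 27) ℂ} (hg : g ∈ gen Set.univ) {z : Fin 27 × Fin 27 → ℂ} :
    biv g z ∈ X ↔ z ∈ X :=
  ⟨fun h => by simpa [biv_inv_apply] using biv_mem_X (inv_mem hg) h, biv_mem_X hg⟩

theorem smul_mem_X (c : ℂ) {z : Fin 27 × Fin 27 → ℂ} (hz : z ∈ X) : c • z ∈ X := by
  obtain ⟨g', hg', c', rfl⟩ := mem_X_iff.1 hz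
  exact mem_X_iff.2 ⟨g', hg', c * c', by rw [smul_smul]⟩

theorem v₃_mem_X : v₃ ∈ X := mem_X_iff.2 ⟨1, one_mem _, 1, by rw [biv_one, one_smul]⟩

/-! ### Elimination of coordinates -/

theorem vanish_xe {i : Fin 4} {K : Finset (Fin 27)} (hK : ∀ c ∈ K, ∀ d ∈ fNbr i c, d ∈ K) (t : ℂ)
    {y : Fin 27 → ℂ} (hy : ∀ c ∈ K, y c = 0) : ∀ c ∈ K, glEquiv (xe i t) y c = 0 := by
  have h : ∀ y : Fin 27 → ℂ, (∀ c ∈ K, y c = 0) → ∀ c ∈ K, (e i *ᵥ y) c = 0 := by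
    intro y hy c hc
    rw [e_apply]
    refine List.sum_eq_zero fun x hx => ?_
    obtain ⟨d, hd, rfl⟩ := List.mem_map.1 hx
    exact hy d (hK c hc d hd)
  intro c hc
  rw [xe_apply]
  simp [-Matrix.mulVec_mulVec, hy c hc, h y hy c hc, h _ (h y hy) c hc]

theorem vanish_xf {i : Fin 4} {K : Finset (Fin 27)} (hK : ∀ c ∈ K, ∀ d ∈ eNbr i c, d ∈ K) (t : ℂ)
    {y : Fin 27 → ℂ} (hy : ∀ c ∈ K, y c = 0) : ∀ c ∈ K, glEquiv (xf i t) y c = 0 := by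
  have h : ∀ y : Fin 27 → ℂ, (∀ c ∈ K, y c = 0) → ∀ c ∈ K, (f i *ᵥ y) c = 0 := by
    intro y hy c hc
    rw [f_apply]
    refine List.sum_eq_zero fun x hx => ?_
    obtain ⟨d, hd, rfl⟩ := List.mem_map.1 hx
    exact hy d (hK c hc d hd)
  intro c hc
  rw [xf_apply]
  simp [-Matrix.mulVec_mulVec, hy c hc, h y hy c hc, h _ (h y hy) c hc]

/-- The group `SL₂` of a simple root can be used to make the second coordinate of a pair of
neighbouring coordinates zero, without disturbing zeros elsewhere. -/
theorem exists_eliminate (i : Fin 4) (a b : Fin 27) (K : Finset (Fin 27))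
    (hab : fNbr i a = [b] ∧ eNbr i b = [a] ∧ eNbr i a = [] ∧ fNbr i b = [])
    (hK : ∀ c ∈ K, (∀ d ∈ fNbr i c, d ∈ K) ∧ ∀ d ∈ eNbr i c, d ∈ K)
    (y : Fin 27 → ℂ) (hy : ∀ c ∈ K, y c = 0) :
    ∃ s t : ℂ, glEquiv (xf i t * xe i s) y b = 0 ∧
      ∀ c ∈ K, glEquiv (xf i t * xe i s) y c = 0 := by
  obtain ⟨h1, h2, h3, h4⟩ := hab
  have hK1 := fun c hc => (hK c hc).1
  have hK2 := fun c hc => (hK c hc).2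
  have he : ∀ s, glEquiv (xe i s) y a = y a + s * y b ∧ glEquiv (xe i s) y b = y b := by
    intro s
    simp [-Matrix.mulVec_mulVec, xe_apply, e_apply, h1, h4]
  have hf : ∀ (t : ℂ) (y : Fin 27 → ℂ), glEquiv (xf i t) y b = y b + t * y a := by
    intro t y
    simp [-Matrix.mulVec_mulVec, xf_apply, f_apply, h2, h3]
  -- The lowering step can clear `y b` only against a nonzero `y a`; the preliminary raising step
  -- provides one unless `y b` is zero already, and in that case the quotient chosen below for t is
  -- 0, whatever the denominator.
  have key : ∃ s : ℂ, y a + s * y b ≠ 0 ∨ y b = 0 := by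
    by_cases ha : y a = 0
    · refine ⟨1, ?_⟩
      rw [ha, zero_add, one_mul]
      exact (em (y b = 0)).symm
    · exact ⟨0, Or.inl (by simpa using ha)⟩
  obtain ⟨s, hs⟩ := key
  refine ⟨s, -(y b) / (y a + s * y b), ?_, ?_⟩
  · rw [glEquiv_mul, hf, (he s).1, (he s).2]
    rcases hs with hs | hs
    · rw [div_mul_cancel₀ _ hs, add_neg_cancel]
    · simp [hs]
  · intro c hc
    rw [glEquiv_mul]
    exact vanish_xf hK2 _ (vanish_xe hK1 _ hy) c hc

/-- The coordinates of the spin representation of `B₃` generated by `u 1`. -/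
def spin : Finset (Fin 27) := {1, 2, 3, 4, 5, 6, 8, 10}

/-- The invariant quadratic form of the spin representation. -/
def quad (y : Fin 27 → ℂ) : ℂ := -(y 1 * y 10) + y 2 * y 8 - y 3 * y 6 + y 4 * y 5

theorem quad_xe {i : Fin 4} (hi : i ≠ 3) (t : ℂ) (y : Fin 27 → ℂ) :
    quad (glEquiv (xe i t) y) = quad y := by
  fin_cases i
  · simp [-Matrix.mulVec_mulVec, quad, xe_apply, e_apply, fNbr, edges]; ring
  · simp [-Matrix.mulVec_mulVec, quad, xe_apply, e_apply, fNbr, edges]; ring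
  · simp [-Matrix.mulVec_mulVec, quad, xe_apply, e_apply, fNbr, edges]; ring
  · exact absurd rfl hi

theorem quad_xf {i : Fin 4} (hi : i ≠ 3) (t : ℂ) (y : Fin 27 → ℂ) :
    quad (glEquiv (xf i t) y) = quad y := by
  fin_cases i
  · simp [-Matrix.mulVec_mulVec, quad, xf_apply, f_apply, eNbr, edges]; ring
  · simp [-Matrix.mulVec_mulVec, quad, xf_apply, f_apply, eNbr, edges]; ring
  · simp [-Matrix.mulVec_mulVec, quad, xf_apply, f_apply, eNbr, edges]; ring
  · exact absurd rfl hi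

theorem quad_gen {g : GL (Fin 27) ℂ} (hg : g ∈ gen {0, 1, 2}) (y : Fin 27 → ℂ) :
    quad (glEquiv g y) = quad y := by
  induction hg using gen_induction generalizing y with
  | he i hi t => exact quad_xe (by rintro rfl; simp at hi) t y
  | hf i hi t => exact quad_xf (by rintro rfl; simp at hi) t y
  | one => rw [glEquiv_one]
  | mul g g' _ _ h h' => rw [glEquiv_mul, h, h']

theorem eq_smul_u_of_vanish {a : Fin 27} {y : Fin 27 → ℂ} (h : ∀ c, c ≠ a → y c = 0) :
    y = y a • u a := by
  ext c
  by_cases hc : c = a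
  · subst hc; simp [u]
  · simp [u, hc, h c hc]

theorem xf_mul_xe_mem {I : Set (Fin 4)} {i : Fin 4} (hi : i ∈ I) (s t : ℂ) :
    xf i t * xe i s ∈ gen I := mul_mem (xf_mem_gen hi t) (xe_mem_gen hi s)

/-- Null vectors of the spin representation of `B₃` are conjugate to multiples of `u 1`. -/
theorem exists_gen_smul_of_null {y : Fin 27 → ℂ} (hy : ∀ c, c ∉ spin → y c = 0)
    (hq : quad y = 0) : ∃ g ∈ gen {0, 1, 2}, ∃ c : ℂ, glEquiv g y = c • u 1 := by
  have h0 : (0 : Fin 4) ∈ ({0, 1, 2} : Set (Fin 4)) := by simp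
  have h1 : (1 : Fin 4) ∈ ({0, 1, 2} : Set (Fin 4)) := by simp
  have h2 : (2 : Fin 4) ∈ ({0, 1, 2} : Set (Fin 4)) := by simp
  -- The weight diagram is 1–2–3, then a diamond 3, {4, 5}, 6, then 6–8–10. The lowest coordinates
  -- 10, 8, 6 are cleared in turn, each time with a root SL₂ that preserves the zeros already
  -- obtained.
  obtain ⟨s₁, t₁, z1, k1⟩ := exists_eliminate 2 8 10 spinᶜ (by decide) (by decide) y
    fun c hc => hy c (Finset.mem_compl.1 hc)
  set g₁ := xf 2 t₁ * xe 2 s₁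
  have hg₁ : g₁ ∈ gen {0, 1, 2} := xf_mul_xe_mem h2 _ _
  obtain ⟨s₂, t₂, z2, k2⟩ := exists_eliminate 1 6 8 (insert 10 spinᶜ) (by decide) (by decide)
    (glEquiv g₁ y) (by simpa [z1] using k1)
  rw [← glEquiv_mul] at z2
  simp only [← glEquiv_mul] at k2
  set g₂ := xf 1 t₂ * xe 1 s₂ * g₁
  have hg₂ : g₂ ∈ gen {0, 1, 2} := mul_mem (xf_mul_xe_mem h1 _ _) hg₁
  obtain ⟨s₃, t₃, z3, k3⟩ := exists_eliminate 0 5 6 (insert 8 (insert 10 spinᶜ)) (by decide)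
    (by decide) (glEquiv g₂ y) (by simpa [z2] using k2)
  rw [← glEquiv_mul] at z3
  simp only [← glEquiv_mul] at k3
  set g₃ := xf 0 t₃ * xe 0 s₃ * g₂
  have hg₃ : g₃ ∈ gen {0, 1, 2} := mul_mem (xf_mul_xe_mem h0 _ _) hg₂
  -- With 6, 8 and 10 cleared, `quad` reduces to y₄ y₅. So nullity removes one of the two middle
  -- coordinates, and the other can be cleared against coordinate 3.
  have hq3 : glEquiv g₃ y 4 * glEquiv g₃ y 5 = 0 := by
    have := quad_gen hg₃ y
    rw [hq] at this
    simpa [quad, z3, k3 8 (by simp), k3 10 (by simp)] using this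
  have step : ∃ g₄ ∈ gen {0, 1, 2},
      ∀ c ∈ insert 4 (insert 5 (insert 6 (insert 8 (insert 10 spinᶜ)))), glEquiv g₄ y c = 0 := by
    rcases mul_eq_zero.1 hq3 with h4 | h5
    · obtain ⟨s, t, z, k⟩ := exists_eliminate 2 3 5 (insert 4 (insert 6 (insert 8 (insert 10 spinᶜ))))
        (by decide) (by decide) (glEquiv g₃ y) (by simpa [h4, z3] using k3)
      rw [← glEquiv_mul] at z
      simp only [← glEquiv_mul] at k
      refine ⟨_, mul_mem (xf_mul_xe_mem h2 s t) hg₃, ?_⟩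
      rw [Finset.insert_comm]
      simpa [z] using k
    · obtain ⟨s, t, z, k⟩ := exists_eliminate 0 3 4 (insert 5 (insert 6 (insert 8 (insert 10 spinᶜ))))
        (by decide) (by decide) (glEquiv g₃ y) (by simpa [h5, z3] using k3)
      rw [← glEquiv_mul] at z
      simp only [← glEquiv_mul] at k
      refine ⟨_, mul_mem (xf_mul_xe_mem h0 s t) hg₃, ?_⟩
      simpa [z] using k
  obtain ⟨g₄, hg₄, k4⟩ := step
  obtain ⟨s₅, t₅, z5, k5⟩ := exists_eliminate 1 2 3
    (insert 4 (insert 5 (insert 6 (insert 8 (insert 10 spinᶜ))))) (by decide)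
    (by decide) (glEquiv g₄ y) k4
  rw [← glEquiv_mul] at z5
  simp only [← glEquiv_mul] at k5
  set g₅ := xf 1 t₅ * xe 1 s₅ * g₄
  have hg₅ : g₅ ∈ gen {0, 1, 2} := mul_mem (xf_mul_xe_mem h1 _ _) hg₄
  obtain ⟨s₆, t₆, z6, k6⟩ := exists_eliminate 2 1 2
    (insert 3 (insert 4 (insert 5 (insert 6 (insert 8 (insert 10 spinᶜ)))))) (by decide)
    (by decide) (glEquiv g₅ y) (by simpa [z5] using k5)
  rw [← glEquiv_mul] at z6
  simp only [← glEquiv_mul] at k6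
  refine ⟨_, mul_mem (xf_mul_xe_mem h2 s₆ t₆) hg₅, _, eq_smul_u_of_vanish fun c hc => ?_⟩
  by_cases h : c = 2
  · rw [h]; exact z6
  · refine k6 c ?_
    revert hc h
    revert c
    decide

/-- The vectors of the four-dimensional representation of `C₂` generated by `u 1` are conjugate to
multiples of `u 1`. -/
theorem exists_gen_smul_of_vanish {y : Fin 27 → ℂ}
    (hy : ∀ c, c ∉ ({1, 2, 3, 5} : Finset (Fin 27)) → y c = 0) :
    ∃ g ∈ gen {1, 2}, ∃ c : ℂ, glEquiv g y = c • u 1 := by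
  have h1 : (1 : Fin 4) ∈ ({1, 2} : Set (Fin 4)) := by simp
  have h2 : (2 : Fin 4) ∈ ({1, 2} : Set (Fin 4)) := by simp
  obtain ⟨s₁, t₁, z1, k1⟩ := exists_eliminate 2 3 5 {1, 2, 3, 5}ᶜ (by decide) (by decide) y
    fun c hc => hy c (Finset.mem_compl.1 hc)
  set g₁ := xf 2 t₁ * xe 2 s₁
  have hg₁ : g₁ ∈ gen {1, 2} := xf_mul_xe_mem h2 _ _
  obtain ⟨s₂, t₂, z2, k2⟩ := exists_eliminate 1 2 3 {1, 2, 3}ᶜ (by decide) (by decide)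
    (glEquiv g₁ y) (by
      intro c hc
      by_cases h : c = 5
      · rw [h]; exact z1
      · refine k1 c ?_
        revert hc h
        revert c
        decide)
  rw [← glEquiv_mul] at z2
  simp only [← glEquiv_mul] at k2
  set g₂ := xf 1 t₂ * xe 1 s₂ * g₁
  have hg₂ : g₂ ∈ gen {1, 2} := mul_mem (xf_mul_xe_mem h1 _ _) hg₁
  obtain ⟨s₃, t₃, z3, k3⟩ := exists_eliminate 2 1 2 {1, 2}ᶜ (by decide) (by decide)
    (glEquiv g₂ y) (by
      intro c hc
      by_cases h : c = 3
      · rw [h]; exact z2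
      · refine k2 c ?_
        revert hc h
        revert c
        decide)
  rw [← glEquiv_mul] at z3
  simp only [← glEquiv_mul] at k3
  refine ⟨_, mul_mem (xf_mul_xe_mem h2 s₃ t₃) hg₂, _, eq_smul_u_of_vanish fun c hc => ?_⟩
  by_cases h : c = 2
  · rw [h]; exact z3
  · refine k3 c ?_
    revert hc h
    revert c
    decide

end F4

namespace F4

/-! ### Decomposable bivectors -/

/-- The Plücker equations. -/
def IsPluecker (z : Fin 27 × Fin 27 → ℂ) : Prop :=
  (∀ a b, z (a, b) = -z (b, a)) ∧
    ∀ a b c d, z (a, b) * z (c, d) - z (a, c) * z (b, d) + z (a, d) * z (b, c) = 0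

theorem isPluecker_wedge (p q : Fin 27 → ℂ) : IsPluecker (wedge p q) := by
  constructor
  · intro a b
    simp only [wedge]
    ring
  · intro a b c d
    simp only [wedge]
    ring

/-- If z(a, b) ≠ 0, the rows a and b span the plane, and the relations for the indices a, b, c, d
express every entry through them. -/
theorem IsPluecker.exists_wedge {z : Fin 27 × Fin 27 → ℂ} (h : IsPluecker z) :
    ∃ p q, z = wedge p q := by
  by_cases h0 : ∃ a b, z (a, b) ≠ 0
  · obtain ⟨a, b, hab⟩ := h0
    refine ⟨fun c => z (a, c) / z (a, b), fun c => z (b, c), ?_⟩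
    ext ⟨c, d⟩
    have h1 := h.2 a b c d
    simp only [wedge]
    field_simp
    linear_combination h1
  · push Not at h0
    refine ⟨0, 0, ?_⟩
    rw [wedge_zero_left]
    ext ⟨a, b⟩
    exact h0 a b

theorem IsPluecker.smul {z : Fin 27 × Fin 27 → ℂ} (h : IsPluecker z) (c : ℂ) :
    IsPluecker (c • z) := by
  obtain ⟨p, q, rfl⟩ := h.exists_wedge
  rw [← wedge_smul_left]
  exact isPluecker_wedge _ _

theorem IsPluecker.biv {z : Fin 27 × Fin 27 → ℂ} (h : IsPluecker z) (g : GL (Fin 27) ℂ) :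
    IsPluecker (biv g z) := by
  obtain ⟨p, q, rfl⟩ := h.exists_wedge
  rw [biv_wedge]
  exact isPluecker_wedge _ _

theorem isClosed_isPluecker : IsClosed {z | IsPluecker z} := by
  refine IsClosed.inter (s₁ := {z : Fin 27 × Fin 27 → ℂ | ∀ a b, z (a, b) = -z (b, a)})
    (s₂ := {z | ∀ a b c d, z (a, b) * z (c, d) - z (a, c) * z (b, d) + z (a, d) * z (b, c) = 0})
    ?_ ?_
  · simp only [Set.ofPred_forall]
    exact isClosed_iInter fun a => isClosed_iInter fun b =>
      isClosed_eq (by fun_prop) (by fun_prop)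
  · simp only [Set.ofPred_forall]
    exact isClosed_iInter fun a => isClosed_iInter fun b => isClosed_iInter fun c =>
      isClosed_iInter fun d => isClosed_eq (by fun_prop) (by fun_prop)

theorem isPluecker_of_mem_X {z : Fin 27 × Fin 27 → ℂ} (hz : z ∈ X) : IsPluecker z := by
  obtain ⟨g, hg, c, rfl⟩ := mem_X_iff.1 hz
  exact ((isPluecker_wedge _ _).biv g).smul c

/-- The contraction of a bivector with a linear form. -/
def contract (ξ : Fin 27 → ℂ) : (Fin 27 × Fin 27 → ℂ) →ₗ[ℂ] (Fin 27 → ℂ) where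
  toFun z b := ∑ a, ξ a * z (a, b)
  map_add' z z' := by
    ext b
    simp [mul_add, Finset.sum_add_distrib]
  map_smul' c z := by
    ext b
    simp only [Pi.smul_apply, smul_eq_mul, Finset.mul_sum, RingHom.id_apply]
    exact Finset.sum_congr rfl fun a _ => by ring

theorem contract_apply (ξ : Fin 27 → ℂ) (z : Fin 27 × Fin 27 → ℂ) (b : Fin 27) :
    contract ξ z b = ∑ a, ξ a * z (a, b) := rfl

theorem contract_wedge (ξ p q : Fin 27 → ℂ) :
    contract ξ (wedge p q) = (∑ a, ξ a * p a) • q - (∑ a, ξ a * q a) • p := by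
  ext b
  simp only [contract_apply, wedge, Pi.sub_apply, Pi.smul_apply, smul_eq_mul, Finset.sum_mul,
    ← Finset.sum_sub_distrib]
  exact Finset.sum_congr rfl fun a _ => by ring

/-- The contractions of a nonzero decomposable bivector fill its plane; a nonzero 2 × 2 minor yields
the dual form. -/
theorem exists_contract_eq {p q : Fin 27 → ℂ} (h : wedge p q ≠ 0) :
    ∃ ξ, contract ξ (wedge p q) = p := by
  obtain ⟨⟨a, b⟩, hab⟩ := Function.ne_iff.1 h
  simp only [wedge, Pi.zero_apply] at hab
  refine ⟨(p a * q b - q a * p b)⁻¹ • (p b • u a - p a • u b), ?_⟩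
  have h1 : ∀ y : Fin 27 → ℂ, ∑ c, ((p a * q b - q a * p b)⁻¹ • (p b • u a - p a • u b)) c * y c =
      (p a * q b - q a * p b)⁻¹ * (p b * y a - p a * y b) := by
    intro y
    simp [u, Pi.single_apply, mul_sub, sub_mul, Finset.sum_sub_distrib, mul_assoc]
  rw [contract_wedge, h1, h1]
  ext c
  simp only [Pi.sub_apply, Pi.smul_apply, smul_eq_mul]
  field_simp
  ring

/-! ### Equations of `X` -/

theorem gen_univ_mono (I : Set (Fin 4)) : gen I ≤ gen Set.univ := gen_mono (Set.subset_univ I)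

theorem glEquiv_fix {i : Fin 4} {y : Fin 27 → ℂ} (he : e i *ᵥ y = 0) (hf : f i *ᵥ y = 0) (t : ℂ) :
    glEquiv (xe i t) y = y ∧ glEquiv (xf i t) y = y := by
  constructor
  · simp [xe_apply, he, -Matrix.mulVec_mulVec]
  · simp [xf_apply, hf, -Matrix.mulVec_mulVec]

theorem glEquiv_gen_fix {I : Set (Fin 4)} {y : Fin 27 → ℂ}
    (h : ∀ i ∈ I, e i *ᵥ y = 0 ∧ f i *ᵥ y = 0) {g : GL (Fin 27) ℂ} (hg : g ∈ gen I) :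
    glEquiv g y = y := by
  induction hg using gen_induction with
  | he i hi t => exact (glEquiv_fix (h i hi).1 (h i hi).2 t).1
  | hf i hi t => exact (glEquiv_fix (h i hi).1 (h i hi).2 t).2
  | one => exact glEquiv_one y
  | mul g g' _ _ h h' => rw [glEquiv_mul, h', h]

theorem glEquiv_u_zero {g : GL (Fin 27) ℂ} (hg : g ∈ gen {0, 1, 2}) : glEquiv g (u 0) = u 0 := by
  refine glEquiv_gen_fix (fun i hi => ?_) hg
  rcases hi with rfl | rfl | rfl <;> simp [e_u, f_u, eNbr, fNbr, edges]

theorem glEquiv_u_one {g : GL (Fin 27) ℂ} (hg : g ∈ gen {0, 1}) : glEquiv g (u 1) = u 1 := by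
  refine glEquiv_gen_fix (fun i hi => ?_) hg
  rcases hi with rfl | rfl <;> simp [e_u, f_u, eNbr, fNbr, edges]

/-- The vectors in the plane of `v₃` are conjugate to multiples of `u 0`. -/
theorem exists_gen_smul_u_zero (s t : ℂ) :
    ∃ g ∈ gen {3}, ∃ c : ℂ, glEquiv g (s • u 0 + t • u 1) = c • u 0 := by
  obtain ⟨s', t', z, k⟩ := exists_eliminate 3 0 1 {0, 1}ᶜ (by decide) (by decide)
    (s • u 0 + t • u 1) (by
      intro c hc
      simp only [Finset.mem_compl, Finset.mem_insert, Finset.mem_singleton, not_or] at hc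
      simp [u, hc])
  refine ⟨_, xf_mul_xe_mem (Set.mem_singleton _) s' t', _, eq_smul_u_of_vanish fun c hc => ?_⟩
  by_cases h : c = 1
  · rw [h]; exact z
  · exact k c (by simp [hc, h])

/-- Every nonzero vector in the plane of a point of `X` lies in the orbit of `u 0`. -/
theorem exists_contract_mem_orbit {z : Fin 27 × Fin 27 → ℂ} (hz : z ∈ X) (ξ : Fin 27 → ℂ) :
    ∃ g ∈ gen Set.univ, ∃ c : ℂ, contract ξ z = c • glEquiv g (u 0) := by
  obtain ⟨g, hg, c, rfl⟩ := mem_X_iff.1 hz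
  rw [v₃_eq, biv_wedge, map_smul, contract_wedge]
  set s := ∑ a, ξ a * glEquiv g (u 0) a
  set t := ∑ a, ξ a * glEquiv g (u 1) a
  obtain ⟨g', hg', c', h⟩ := exists_gen_smul_u_zero (-t) s
  have hu : c' • glEquiv g'⁻¹ (u 0) = -t • u 0 + s • u 1 := by
    rw [← map_smul, ← h, glEquiv_inv_apply]
  refine ⟨g * g'⁻¹, mul_mem hg (inv_mem (gen_univ_mono _ hg')), c * c', ?_⟩
  have hgu := congrArg (glEquiv g) hu
  rw [map_smul, map_add, map_smul, map_smul] at hgu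
  rw [glEquiv_mul, mul_smul, hgu]
  module

theorem rep27_isWeightVector : rep27.IsWeightVector (Pi.single 3 1) (u 0) := by
  intro k
  ext a
  rw [h_apply]
  by_cases ha : a = 0
  · subst ha
    fin_cases k <;> simp [u, wt, eNbr, fNbr, edges]
  · simp [u, ha]

theorem e_u_zero (k : Fin 4) : e k *ᵥ u 0 = 0 := by
  have : ∀ k, eNbr k 0 = [] := by decide
  simp [e_u, this]

/-- The square `x ⊗ x`. -/
def sq (x : Fin 27 → ℂ) : Fin 27 × Fin 27 → ℂ := fun p => x p.1 * x p.2

theorem biv_sq (g : GL (Fin 27) ℂ) (x : Fin 27 → ℂ) : biv g (sq x) = sq (glEquiv g x) :=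
  kronecker_mulVec_mul _ _ _ _

theorem tr_orbit {g : GL (Fin 27) ℂ} (hg : g ∈ gen Set.univ) : tr (glEquiv g (u 0)) = 0 := by
  rw [← group_eq] at hg
  exact SerreRep.apply_eq_zero_of_mem_hwSpan (ρ := rep27) tr (by simp [tr_apply, u]) tr_f
    (SerreRep.group_mem_hwSpan rep27_isWeightVector e_u_zero hg (SerreRep.self_mem_hwSpan _))

/-- The tensor u₀ ⊗ u₀ is a highest weight vector, so a functional killed by the lowering operators
and vanishing there vanishes on its whole orbit. This yields quadratic equations for the orbit of `u
0`. -/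
theorem functional_sq_orbit {ψ : (Fin 27 × Fin 27 → ℂ) →ₗ[ℂ] ℂ}
    (hψ : ∀ i z, ψ (rep.f i *ᵥ z) = 0) (h0 : ψ (sq (u 0)) = 0) {g : GL (Fin 27) ℂ}
    (hg : g ∈ gen Set.univ) : ψ (sq (glEquiv g (u 0))) = 0 := by
  rw [← group_eq] at hg
  have hw : rep.IsWeightVector (2 * Pi.single 3 1) (sq (u 0)) := by
    intro k
    ext ⟨a, b⟩
    have h1 := congrFun (rep27_isWeightVector k) a
    have h2 := congrFun (rep27_isWeightVector k) b
    simp only [h_apply, Pi.smul_apply, smul_eq_mul] at h1 h2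
    rw [tensor_h_apply]
    simp only [sq, Pi.smul_apply, smul_eq_mul, Pi.mul_apply, Pi.ofNat_apply]
    push_cast
    linear_combination u 0 b * h1 + u 0 a * h2
  have he : ∀ k, rep.e k *ᵥ sq (u 0) = 0 := by
    intro k
    ext ⟨a, b⟩
    have h1 := congrFun (e_u_zero k) a
    have h2 := congrFun (e_u_zero k) b
    have : (rep.e k *ᵥ sq (u 0)) (a, b) = _ := tensor_apply (e k) (sq (u 0)) a b
    rw [this]
    have e1 : (fun a' => sq (u 0) (a', b)) = u 0 b • u 0 := by ext; simp [sq, mul_comm]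
    have e2 : (fun b' => sq (u 0) (a, b')) = u 0 a • u 0 := by ext; simp [sq]
    rw [e1, e2, Matrix.mulVec_smul, Matrix.mulVec_smul, e_u_zero]
    simp
  rw [← biv_sq]
  exact SerreRep.apply_eq_zero_of_mem_hwSpan (ρ := rep) ψ h0 hψ
    (SerreRep.group_mem_hwSpan hw he (rep27.mem_tensorSquare_group.2 ⟨g, hg, rfl⟩)
      (SerreRep.self_mem_hwSpan _))

/-- The subspace `V(ω₃)` of the space of bivectors. -/
noncomputable def V₃ : Submodule ℂ (Fin 27 × Fin 27 → ℂ) := rep.hwSpan v₃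

theorem X_subset_V₃ {z : Fin 27 × Fin 27 → ℂ} (hz : z ∈ X) : z ∈ V₃ := by
  obtain ⟨g, hg, c, rfl⟩ := hz
  exact Submodule.smul_mem _ _ (SerreRep.group_mem_hwSpan v₃_isFundamentalVector.isWeightVector
    v₃_isFundamentalVector.2.1 hg (SerreRep.self_mem_hwSpan _))

theorem e_mem_V₃ {z : Fin 27 × Fin 27 → ℂ} (i : Fin 4) (hz : z ∈ V₃) : rep.e i *ᵥ z ∈ V₃ :=
  SerreRep.e_mem_hwSpan v₃_isFundamentalVector.isWeightVector v₃_isFundamentalVector.2.1 i hz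

theorem adjFunctional_V₃ {z : Fin 27 × Fin 27 → ℂ} (hz : z ∈ V₃) : adjFunctional z = 0 :=
  SerreRep.apply_eq_zero_of_mem_hwSpan adjFunctional
    (by simp [adjFunctional, functional_apply, v₃, wedge]) adjFunctional_f hz

theorem e_wedge_mem_V₃ {r : Fin 27 → ℂ} (h : wedge (u 0) r ∈ V₃) (i : Fin 4) :
    wedge (u 0) (e i *ᵥ r) ∈ V₃ := by
  have := e_mem_V₃ i h
  rwa [rep_e_wedge, e_u_zero, wedge_zero_left, zero_add] at this

theorem coord_seven {r : Fin 27 → ℂ} (h : wedge (u 0) r ∈ V₃) : r 7 = 0 := by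
  have := adjFunctional_V₃ h
  simp only [adjFunctional, functional_apply, wedge, u] at this
  simpa using this

theorem e_apply_of_fNbr {i : Fin 4} {a b : Fin 27} (h : fNbr i a = [b]) (r : Fin 27 → ℂ) :
    (e i *ᵥ r) a = r b := by
  simp [e_apply, h]

/-- The bivectors `u 0 ∧ r` in `V(ω₃)`. -/
theorem coords_of_wedge_mem {r : Fin 27 → ℂ} (h : wedge (u 0) r ∈ V₃) :
    r 13 + r 14 = 0 ∧ ∀ c ∈ ({7, 9, 11, 15, 16, 17, 18, 19, 20, 21, 22, 23, 24, 25, 26} :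
      Finset (Fin 27)), r c = 0 := by
  -- Since e_i u₀ = 0, the space of all r with u₀ ∧ r in V(ω₃) is stable under e_i. A coordinate
  -- that vanishes on this space therefore vanishes at its lower neighbour too.
  have step : ∀ (i : Fin 4) (a b : Fin 27), fNbr i a = [b] →
      (∀ r, wedge (u 0) r ∈ V₃ → r a = 0) → ∀ r, wedge (u 0) r ∈ V₃ → r b = 0 := by
    intro i a b hab ha r hr
    rw [← e_apply_of_fNbr hab r]
    exact ha _ (e_wedge_mem_V₃ hr i)
  have h7 : ∀ r, wedge (u 0) r ∈ V₃ → r 7 = 0 := fun r => coord_seven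
  have h9 := step 0 7 9 (by decide) h7
  have h11 := step 1 9 11 (by decide) h9
  -- Vertex 11 has two lower neighbours under `f 2`, in the zero weight space, so only their sum is
  -- controlled.
  have h13 : ∀ r, wedge (u 0) r ∈ V₃ → r 13 + r 14 = 0 := by
    intro r hr
    have := h11 _ (e_wedge_mem_V₃ hr 2)
    simpa [e_apply, fNbr, edges] using this
  have h16 : ∀ r, wedge (u 0) r ∈ V₃ → r 16 = 0 := by
    intro r hr
    have := h13 _ (e_wedge_mem_V₃ hr 2)
    rw [e_apply_of_fNbr (b := 16) (by decide), e_apply_of_fNbr (b := 16) (by decide)] at this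
    linear_combination this / 2
  have h15 : ∀ r, wedge (u 0) r ∈ V₃ → r 15 = 0 := by
    intro r hr
    have := h13 _ (e_wedge_mem_V₃ hr 3)
    simpa [e_apply, fNbr, edges] using this
  have h17 := step 3 16 17 (by decide) h16
  have h18 := step 1 16 18 (by decide) h16
  have h20 := step 0 18 20 (by decide) h18
  have h19 := step 3 18 19 (by decide) h18
  have h22 := step 3 20 22 (by decide) h20
  have h21 := step 2 19 21 (by decide) h19
  have h23 := step 2 22 23 (by decide) h22
  have h24 := step 1 23 24 (by decide) h23
  have h25 := step 2 24 25 (by decide) h24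
  have h26 := step 3 25 26 (by decide) h25
  refine ⟨h13 r h, ?_⟩
  simp [*]

/-- The lines through `v₃` in `X` consisting of bivectors divisible by `u 0`. -/
theorem line_in_X {r : Fin 27 → ℂ} (h1 : r 1 = 0)
    (h : ∀ t : ℂ, wedge (u 0) (u 1 + t • r) ∈ X) :
    (∀ c, c ∉ spin → c ≠ 0 → r c = 0) ∧ r 10 = 0 ∧ quad r = 0 := by
  have hV : wedge (u 0) r ∈ V₃ := by
    have e1 := X_subset_V₃ (h 1)
    have e2 := X_subset_V₃ v₃_mem_X
    have := Submodule.sub_mem _ e1 e2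
    rwa [one_smul, wedge_add_right, v₃_eq, add_sub_cancel_left] at this
  obtain ⟨h13, hr⟩ := coords_of_wedge_mem hV
  have orb : ∀ t : ℂ, ∃ g ∈ gen Set.univ, ∃ c : ℂ, u 1 + t • r = c • glEquiv g (u 0) := by
    intro t
    have hne : wedge (u 1 + t • r) (u 0) ≠ 0 := by
      intro h0
      have := congrFun h0 (1, 0)
      simp [wedge, u, h1] at this
    obtain ⟨ξ, hξ⟩ := exists_contract_eq hne
    have hX : wedge (u 1 + t • r) (u 0) ∈ X := by
      rw [wedge_swap, ← neg_one_smul ℂ]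
      exact smul_mem_X _ (h t)
    rw [← hξ]
    exact exists_contract_mem_orbit hX ξ
  have sq_smul : ∀ (c : ℂ) (y : Fin 27 → ℂ), sq (c • y) = c ^ 2 • sq y := by
    intro c y
    ext p
    simp [sq]
    ring
  -- The zero weight coordinates remain. With r₁₃ = −r₁₄ the trace gives r₁₂ = −2 r₁₄, and the
  -- invariant quadratic equation becomes 6 r₁₄² = 0.
  have htr : r 12 - r 13 + r 14 = 0 := by
    obtain ⟨g, hg, c, hc⟩ := orb 1
    have := congrArg tr hc
    rw [map_smul, tr_orbit hg] at this
    simpa [tr_apply, u] using this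
  have hinv : r 12 * r 12 + r 13 * r 13 + r 14 * r 14 = 0 := by
    obtain ⟨g, hg, c, hc⟩ := orb 1
    have := congrArg (fun y => invFunctional (sq y)) hc
    simp only [sq_smul, map_smul] at this
    rw [functional_sq_orbit invFunctional_f
      (by simp [invFunctional, functional_apply, sq, u]) hg] at this
    simp [invFunctional, functional_apply, sq, u, hr] at this
    linear_combination this
  have h14 : r 14 = 0 := by
    have : r 14 ^ 2 = 0 := by
      have e13 : r 13 = -r 14 := by linear_combination h13
      have e12 : r 12 = -2 * r 14 := by linear_combination htr + e13
      rw [e12, e13] at hinv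
      linear_combination hinv / 6
    exact pow_eq_zero_iff two_ne_zero |>.1 this
  have h13' : r 13 = 0 := by linear_combination h13 - h14
  have h12 : r 12 = 0 := by linear_combination htr + h13' - h14
  -- A polynomial in t that vanishes identically; the values at ±1 separate its linear coefficient,
  -- r₁₀ up to sign, from its quadratic one, `quad r`.
  have hsym : ∀ t : ℂ, -(t * r 10) + t ^ 2 * quad r = 0 := by
    intro t
    obtain ⟨g, hg, c, hc⟩ := orb t
    have := congrArg (fun y => symFunctional (sq y)) hc
    simp only [sq_smul, map_smul] at this
    rw [functional_sq_orbit symFunctional_f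
      (by simp [symFunctional, functional_apply, sq, u]) hg] at this
    simp [symFunctional, functional_apply, sq, u, h1, h12] at this
    simp only [quad, h1]
    linear_combination this / 2
  have s1 := hsym 1
  have s2 := hsym (-1)
  refine ⟨fun c hc hc0 => ?_, by linear_combination (s2 - s1) / 2, by linear_combination (s1 + s2) / 2⟩
  have : c ∈ ({7, 9, 11, 15, 16, 17, 18, 19, 20, 21, 22, 23, 24, 25, 26} : Finset (Fin 27)) ∨
      c = 12 ∨ c = 13 ∨ c = 14 := by
    revert hc hc0
    revert c
    decide
  rcases this with h | rfl | rfl | rfl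
  · exact hr c h
  · exact h12
  · exact h13'
  · exact h14

/-- The group of B₃ fixes u₀ and moves a null vector to a multiple of u₁, so it moves the bivector
to a multiple of `v₃`. -/
theorem wedge_u_zero_mem_X {s : Fin 27 → ℂ} (hs : ∀ c, c ∉ spin → s c = 0) (hq : quad s = 0) :
    wedge (u 0) s ∈ X := by
  obtain ⟨g, hg, c, h⟩ := exists_gen_smul_of_null hs hq
  rw [← biv_mem_X_iff (gen_univ_mono _ hg), biv_wedge, glEquiv_u_zero hg, h, wedge_smul_right]
  exact smul_mem_X c v₃_mem_X

end F4

namespace F4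

/-! ### The varieties of minimal rational tangents of `X` at `v₃` -/

/-- The coordinates of `V(ω₄)` that parametrize the lines through `v₃`. -/
def chartIndex : Fin 6 → Fin 27 := ![2, 3, 4, 5, 6, 8]

/-- The inclusion of the space of the chart coordinates. -/
noncomputable def emb : (Fin 6 → ℂ) →ₗ[ℂ] (Fin 27 → ℂ) where
  toFun r := ∑ k, r k • u (chartIndex k)
  map_add' r r' := by simp [add_smul, Finset.sum_add_distrib]
  map_smul' c r := by simp [mul_smul, Finset.smul_sum]

theorem emb_apply (r : Fin 6 → ℂ) (a : Fin 27) :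
    emb r a = ∑ k, r k * if a = chartIndex k then 1 else 0 := by
  simp [emb, u, Pi.single_apply]

theorem emb_chartIndex (r : Fin 6 → ℂ) (k : Fin 6) : emb r (chartIndex k) = r k := by
  have : ∀ j k : Fin 6, chartIndex k = chartIndex j ↔ j = k := by decide
  simp [emb_apply, this]

theorem emb_eq_zero (r : Fin 6 → ℂ) {a : Fin 27} (ha : ∀ k, a ≠ chartIndex k) : emb r a = 0 := by
  simp [emb_apply, ha]

/-- No two consecutive α₄-arrows start at a chart weight, so `xf 3 t` is affine in t on these
vectors and the chart is only quadratic in t. -/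
theorem f_three_f_three_emb (r : Fin 6 → ℂ) : f 3 *ᵥ (f 3 *ᵥ emb r) = 0 := by
  have h : ∀ k, (fNbr 3 (chartIndex k)).flatMap (fNbr 3) = [] := by decide
  have h' : ∀ k, f 3 *ᵥ (f 3 *ᵥ u (chartIndex k)) = 0 := by
    intro k
    rw [u, ← listVec_singleton, f, adj_mulVec, adj_mulVec, List.flatMap_singleton, h]
    ext
    simp [listVec]
  change f 3 *ᵥ (f 3 *ᵥ ∑ k, r k • u (chartIndex k)) = 0
  simp [Matrix.mulVec_sum, Matrix.mulVec_smul, h', -Matrix.mulVec_mulVec]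

/-- The bivectors `u 0 ∧ emb r`. -/
noncomputable def chartA : (Fin 6 → ℂ) →ₗ[ℂ] (Fin 27 × Fin 27 → ℂ) where
  toFun r := wedge (u 0) (emb r)
  map_add' r r' := by rw [map_add, wedge_add_right]
  map_smul' c r := by rw [map_smul, wedge_smul_right, RingHom.id_apply]

/-- The derivatives of `chartA` under `f 3`. -/
noncomputable def chartB : (Fin 6 → ℂ) →ₗ[ℂ] (Fin 27 × Fin 27 → ℂ) where
  toFun r := wedge (u 1) (emb r) + wedge (u 0) (f 3 *ᵥ emb r)
  map_add' r r' := by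
    rw [map_add, Matrix.mulVec_add, wedge_add_right, wedge_add_right]
    abel
  map_smul' c r := by
    rw [map_smul, Matrix.mulVec_smul, wedge_smul_right, wedge_smul_right, RingHom.id_apply,
      smul_add]

/-- The second derivatives of `chartA` under `f 3`, halved. -/
noncomputable def chartC : (Fin 6 → ℂ) →ₗ[ℂ] (Fin 27 × Fin 27 → ℂ) where
  toFun r := wedge (u 1) (f 3 *ᵥ emb r)
  map_add' r r' := by rw [map_add, Matrix.mulVec_add, wedge_add_right]
  map_smul' c r := by rw [map_smul, Matrix.mulVec_smul, wedge_smul_right, RingHom.id_apply]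

theorem xf_three_u (t : ℂ) :
    glEquiv (xf 3 t) (u 0) = u 0 + t • u 1 ∧ glEquiv (xf 3 t) (u 1) = u 1 := by
  constructor <;> simp [xf_apply, f_u, fNbr, edges, -Matrix.mulVec_mulVec]

/-- The origin of the chart: it is the orbit of the directions u₀ ∧ emb r under the root group of
−α₄, which fixes `v₃`. -/
theorem biv_chartA (t : ℂ) (r : Fin 6 → ℂ) :
    biv (xf 3 t) (chartA r) = chartA r + t • chartB r + t ^ 2 • chartC r := by
  have h : glEquiv (xf 3 t) (emb r) = emb r + t • (f 3 *ᵥ emb r) := by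
    rw [xf_apply, f_three_f_three_emb, smul_zero, add_zero]
  change biv (xf 3 t) (wedge (u 0) (emb r)) = wedge (u 0) (emb r) +
    t • (wedge (u 1) (emb r) + wedge (u 0) (f 3 *ᵥ emb r)) + t ^ 2 • wedge (u 1) (f 3 *ᵥ emb r)
  rw [biv_wedge, h, (xf_three_u t).1, wedge_add_right, wedge_add_left, wedge_add_left,
    wedge_smul_right, wedge_smul_right, wedge_smul_left, wedge_smul_left]
  module

theorem biv_xf_three_v₃ (t : ℂ) : biv (xf 3 t) v₃ = v₃ := by
  rw [v₃_eq, biv_wedge, (xf_three_u t).1, (xf_three_u t).2, wedge_add_left, wedge_smul_left,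
    wedge_self, smul_zero, add_zero]

/-- The chart coordinates of a bivector along `u a`. -/
noncomputable def coordRow (a : Fin 27) : (Fin 27 × Fin 27 → ℂ) →ₗ[ℂ] (Fin 6 → ℂ) :=
  LinearMap.pi fun k => LinearMap.proj (a, chartIndex k)

theorem coordRow_apply (a : Fin 27) (z : Fin 27 × Fin 27 → ℂ) (k : Fin 6) :
    coordRow a z k = z (a, chartIndex k) := rfl

theorem coordRow_v₃ (a : Fin 27) : coordRow a v₃ = 0 := by
  have h : ∀ k, chartIndex k ≠ 0 ∧ chartIndex k ≠ 1 := by decide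
  ext k
  rw [coordRow_apply]
  simp [v₃, wedge, h]

theorem f_three_emb_chartIndex (r : Fin 6 → ℂ) (k : Fin 6) : (f 3 *ᵥ emb r) (chartIndex k) = 0 := by
  have h : ∀ k, eNbr 3 (chartIndex k) = [] := by decide
  rw [f_apply, h]
  rfl

theorem coordRow_wedge {a : Fin 27} {x : Fin 27 → ℂ} {i : Fin 27} (hi : i = 0 ∨ i = 1) :
    coordRow a (wedge (u i) x) = fun k => if a = i then x (chartIndex k) else 0 := by
  have h : ∀ k, chartIndex k ≠ 0 ∧ chartIndex k ≠ 1 := by decide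
  ext k
  rw [coordRow_apply]
  rcases hi with rfl | rfl <;> simp [wedge, u, Pi.single_apply, h]

/-- The symmetric bilinear form of the quadric of the lines. -/
noncomputable def chartForm : (Fin 6 → ℂ) →ₗ[ℂ] (Fin 6 → ℂ) →ₗ[ℂ] ℂ :=
  LinearMap.mk₂ ℂ (fun r s => r 0 * s 5 + r 5 * s 0 - r 1 * s 4 - r 4 * s 1 + r 2 * s 3 + r 3 * s 2)
    (fun r r' s => by simp only [Pi.add_apply]; ring)
    (fun c r s => by simp only [Pi.smul_apply, smul_eq_mul]; ring)
    (fun r s s' => by simp only [Pi.add_apply]; ring)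
    (fun c r s => by simp only [Pi.smul_apply, smul_eq_mul]; ring)

theorem chartForm_apply (r s : Fin 6 → ℂ) : chartForm r s =
    r 0 * s 5 + r 5 * s 0 - r 1 * s 4 - r 4 * s 1 + r 2 * s 3 + r 3 * s 2 := rfl

/-- The vectors `emb r` have no component along u₁ and u₁₀, so the form is `quad` on u₁^⊥/u₁, whose
quadric is that of the lines through [u₁]. -/
theorem chartForm_self (r : Fin 6 → ℂ) : chartForm r r = 2 * quad (emb r) := by
  have h := emb_chartIndex r
  have h0 := h 0
  have h1 := h 1
  have h2 := h 2
  have h3 := h 3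
  have h4 := h 4
  have h5 := h 5
  have h10 : emb r 1 = 0 := emb_eq_zero r (by decide)
  simp only [chartIndex, Matrix.cons_val] at h0 h1 h2 h3 h4 h5
  rw [chartForm_apply, quad, h0, h1, h2, h3, h4, h5, h10]
  ring

/-- The coordinates form hyperbolic pairs (0, 5), (1, 4), (2, 3), so a multiple of the basis vector
paired with a nonzero coordinate is dual and null. -/
theorem exists_chartForm_dual {r : Fin 6 → ℂ} (hr : r ≠ 0) :
    ∃ m, chartForm r m = 1 ∧ chartForm m m = 0 := by
  obtain ⟨k, hk⟩ := Function.ne_iff.1 hr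
  rw [Pi.zero_apply] at hk
  fin_cases k
  · exact ⟨Pi.single 5 (r 0)⁻¹, by simpa [chartForm_apply] using mul_inv_cancel₀ hk, by simp [chartForm_apply]⟩
  · exact ⟨Pi.single 4 (-(r 1)⁻¹), by simpa [chartForm_apply] using mul_inv_cancel₀ hk, by simp [chartForm_apply]⟩
  · exact ⟨Pi.single 3 (r 2)⁻¹, by simpa [chartForm_apply] using mul_inv_cancel₀ hk, by simp [chartForm_apply]⟩
  · exact ⟨Pi.single 2 (r 3)⁻¹, by simpa [chartForm_apply] using mul_inv_cancel₀ hk, by simp [chartForm_apply]⟩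
  · exact ⟨Pi.single 1 (-(r 4)⁻¹), by simpa [chartForm_apply] using mul_inv_cancel₀ hk, by simp [chartForm_apply]⟩
  · exact ⟨Pi.single 0 (r 5)⁻¹, by simpa [chartForm_apply] using mul_inv_cancel₀ hk, by simp [chartForm_apply]⟩

/-- The chart of the variety of minimal rational tangents of `X` at `v₃`. -/
noncomputable def chart :
    QuadricChart (Fin 6 → ℂ) ((Fin 27 × Fin 27 → ℂ) ⧸ (ℂ ∙ v₃ : Submodule ℂ _)) where
  a := LinearMap.toContinuousLinearMap ((Submodule.mkQ _).comp chartA)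
  b := LinearMap.toContinuousLinearMap ((Submodule.mkQ _).comp chartB)
  c := LinearMap.toContinuousLinearMap ((Submodule.mkQ _).comp chartC)
  πa := LinearMap.toContinuousLinearMap (Submodule.liftQ _ (coordRow 0)
    (by rw [Submodule.span_singleton_le_iff_mem]; exact coordRow_v₃ 0))
  πb := LinearMap.toContinuousLinearMap (Submodule.liftQ _ (coordRow 1)
    (by rw [Submodule.span_singleton_le_iff_mem]; exact coordRow_v₃ 1))
  P := LinearMap.toContinuousLinearMap (LinearMap.toContinuousLinearMap.toLinearMap.comp chartForm)
  πa_a r := by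
    change coordRow 0 (wedge (u 0) (emb r)) = r
    rw [coordRow_wedge (.inl rfl)]
    ext k
    exact emb_chartIndex r k
  πa_b r := by
    change coordRow 0 (wedge (u 1) (emb r) + wedge (u 0) (f 3 *ᵥ emb r)) = 0
    rw [map_add, coordRow_wedge (.inl rfl), coordRow_wedge (.inr rfl)]
    ext k
    simp [f_three_emb_chartIndex]
  πa_c r := by
    change coordRow 0 (wedge (u 1) (f 3 *ᵥ emb r)) = 0
    rw [coordRow_wedge (.inr rfl)]
    ext k
    simp
  πb_a r := by
    change coordRow 1 (wedge (u 0) (emb r)) = 0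
    rw [coordRow_wedge (.inl rfl)]
    ext k
    simp
  πb_b r := by
    change coordRow 1 (wedge (u 1) (emb r) + wedge (u 0) (f 3 *ᵥ emb r)) = r
    rw [map_add, coordRow_wedge (.inl rfl), coordRow_wedge (.inr rfl)]
    ext k
    simp [emb_chartIndex]
  πb_c r := by
    change coordRow 1 (wedge (u 1) (f 3 *ᵥ emb r)) = 0
    rw [coordRow_wedge (.inr rfl)]
    ext k
    simp [f_three_emb_chartIndex]
  P_symm r s := by
    change chartForm r s = chartForm s r
    rw [chartForm_apply, chartForm_apply]
    ring
  exists_dual r hr := exists_chartForm_dual hr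

theorem chart_param (t : ℂ) (r : Fin 6 → ℂ) :
    chart.param t r = Submodule.Quotient.mk (biv (xf 3 t) (chartA r)) := by
  rw [biv_chartA]
  rfl

theorem chart_πa (z : Fin 27 × Fin 27 → ℂ) :
    chart.πa (Submodule.Quotient.mk z) = coordRow 0 z := rfl

theorem chart_P (r s : Fin 6 → ℂ) : chart.P r s = chartForm r s := rfl

/-- All points of the line are u₀ ∧ s with s = a u₁ + b emb r, and `quad` of s is b² times that of
emb r. -/
theorem line_chartA_mem_X {r : Fin 6 → ℂ} (hr : chartForm r r = 0) (a b : ℂ) :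
    a • v₃ + b • chartA r ∈ X := by
  have h : a • v₃ + b • chartA r = wedge (u 0) (a • u 1 + b • emb r) := by
    rw [wedge_add_right, wedge_smul_right, wedge_smul_right, v₃_eq]
    rfl
  have hs : ∀ c, c ∉ spin → c ≠ 1 ∧ ∀ k, c ≠ chartIndex k := by decide
  rw [h]
  refine wedge_u_zero_mem_X (fun c hc => ?_) ?_
  · simp [emb_eq_zero r (hs c hc).2, u, (hs c hc).1]
  · rw [chartForm_self] at hr
    have h10 : emb r 10 = 0 := emb_eq_zero r (by decide)
    have h1 : emb r 1 = 0 := emb_eq_zero r (by decide)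
    simp [quad, u, h10, h1] at hr ⊢
    linear_combination b ^ 2 * hr

theorem wedge_u_apply {i j : Fin 27} (a b : Fin 27) : wedge (u i) (u j) (a, b) =
    (if a = i then 1 else 0) * (if b = j then 1 else 0) -
      (if a = j then 1 else 0) * (if b = i then 1 else 0) := by
  simp [wedge, u, Pi.single_apply]

/-- The Plücker equations along the line through `u i ∧ u j` in the direction `w`. -/
theorem isPluecker_line {i j : Fin 27} (hij : i ≠ j) {w : Fin 27 × Fin 27 → ℂ}
    (hw : IsPluecker w) (hw' : IsPluecker (wedge (u i) (u j) + w)) {c d : Fin 27} (hci : c ≠ i)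
    (hcj : c ≠ j) (hdi : d ≠ i) (hdj : d ≠ j) :
    w (c, d) = 0 ∧ w (i, c) * w (j, d) = w (i, d) * w (j, c) := by
  have e1 := hw.2 i j c d
  have e2 := hw'.2 i j c d
  simp only [Pi.add_apply, wedge_u_apply, hci, hcj, hdi, hdj, hij, hij.symm, if_true, if_false] at e2
  norm_num at e2
  -- The Plücker relation for i, j, c, d changes by exactly the linear term w(c, d) when u_i ∧ u_j
  -- is added.
  have e3 : w (c, d) = 0 := by linear_combination e2 - e1
  refine ⟨e3, ?_⟩
  rw [e3] at e1
  linear_combination -e1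

/-- Lines of a Grassmannian are pencils with a common vector: outside the columns i and j the two
rows i and j are proportional, and their ratio t determines the common vector u_i + t u_j. The
nonzero entry in row i excludes the common vector u_j. -/
theorem exists_wedge_of_line {i j : Fin 27} (hij : i ≠ j) {w : Fin 27 × Fin 27 → ℂ}
    (hw : IsPluecker w) (hw' : IsPluecker (wedge (u i) (u j) + w)) {k : Fin 27} (hk : w (i, k) ≠ 0)
    (hki : k ≠ i) (hkj : k ≠ j) : ∃ (t c : ℂ) (r : Fin 27 → ℂ), r i = 0 ∧ r j = 0 ∧
      w = c • wedge (u i) (u j) + wedge (u i + t • u j) r := by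
  have hdiag : ∀ a, w (a, a) = 0 := by
    intro a
    have := hw.1 a a
    linear_combination this / 2
  refine ⟨w (j, k) / w (i, k), w (i, j), fun a => if a = i ∨ a = j then 0 else w (i, a), by simp,
    by simp, ?_⟩
  have row : ∀ d, d ≠ i → d ≠ j → w (j, d) = w (j, k) / w (i, k) * w (i, d) := by
    intro d hdi hdj
    have := (isPluecker_line hij hw hw' hki hkj hdi hdj).2
    field_simp
    linear_combination this
  ext ⟨a, b⟩
  simp only [Pi.add_apply, Pi.smul_apply, smul_eq_mul, wedge]
  simp only [u, Pi.single_apply]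
  by_cases hai : a = i
  · subst hai
    by_cases hbi : b = a
    · subst hbi
      simp [hdiag, hij]
    by_cases hbj : b = j
    · subst hbj
      simp [hij]
    simp [hbi, hbj, hij]
  by_cases haj : a = j
  · subst haj
    by_cases hbi : b = i
    · subst hbi
      simp [hai]
      exact hw.1 a b
    by_cases hbj : b = a
    · subst hbj
      simp [hdiag, hai]
    simp [hbi, hbj, hai]
    exact row b hbi hbj
  by_cases hbi : b = i
  · subst hbi
    simp [hai, haj, hij]
    exact hw.1 a b
  by_cases hbj : b = j
  · subst hbj
    simp [hai, haj, hbi]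
    rw [hw.1 a b, row a hai haj]
    ring
  simp [hai, haj, hbi, hbj]
  exact (isPluecker_line hij hw hw' hai haj hbi hbj).1

/-- A line of `X` through `v₃` is a line of the Grassmannian. Nonvanishing of πa makes u₀ + t u₁ its
common vector, and the root group of −α₄ moves this to u₀, where `line_in_X` applies. -/
theorem chart_isChartOf : chart.IsChartOf (vmrtCone X v₃) := by
  intro β hβ
  constructor
  · rintro ⟨h0, w, rfl, hw⟩
    rw [chart_πa] at hβ
    obtain ⟨k, hk⟩ := Function.ne_iff.1 hβ
    rw [coordRow_apply, Pi.zero_apply] at hk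
    have hJ : ∀ k, chartIndex k ≠ 0 ∧ chartIndex k ≠ 1 := by decide
    obtain ⟨t, c, r, hr0, hr1, rfl⟩ := exists_wedge_of_line (show (0 : Fin 27) ≠ 1 by decide)
      (by simpa using isPluecker_of_mem_X (hw 0 1))
      (by simpa [← v₃_eq] using isPluecker_of_mem_X (hw 1 1)) hk (hJ k).1 (hJ k).2
    rw [← v₃_eq] at hw hk ⊢
    set r' := glEquiv (xf 3 (-t)) r with hr'
    have fz : ∀ (y : Fin 27 → ℂ) (j : Fin 27), y 0 = 0 → (j = 0 ∨ j = 1) → (f 3 *ᵥ y) j = 0 := by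
      intro y j hy hj
      rcases hj with rfl | rfl
      · simp [f_apply, eNbr, edges]
      · simp [f_apply, eNbr, edges, hy]
    have rz : ∀ j : Fin 27, (j = 0 ∨ j = 1) → r j = 0 → r' j = 0 := by
      intro j hj h
      rw [hr', xf_apply]
      simp [h, fz r j hr0 hj, fz (f 3 *ᵥ r) j (fz r 0 hr0 (.inl rfl)) hj, -Matrix.mulVec_mulVec]
    have hline : ∀ b : ℂ, wedge (u 0) (u 1 + b • r') ∈ X := by
      intro b
      -- The coefficient 1 − b c compensates the component c v₃ of the direction.
      have := biv_mem_X (xf_mem_gen (Set.mem_univ 3) (-t)) (hw (1 - b * c) b)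
      convert this using 1
      rw [map_add, map_smul, map_smul, map_add, map_smul, biv_xf_three_v₃, biv_wedge, map_add,
        map_smul, (xf_three_u _).1, (xf_three_u _).2, ← hr', wedge_add_right, wedge_smul_right,
        neg_smul, neg_add_cancel_right, v₃_eq]
      module
    obtain ⟨hs, h10, hq⟩ := line_in_X (rz 1 (.inr rfl) hr1) hline
    have hemb : emb (fun k => r' (chartIndex k)) = r' := by
      ext a
      by_cases ha : ∃ k, a = chartIndex k
      · obtain ⟨k, rfl⟩ := ha
        exact emb_chartIndex _ k
      · push Not at ha
        rw [emb_eq_zero _ ha]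
        have : ∀ a, (∀ k, a ≠ chartIndex k) → a = 0 ∨ a = 1 ∨ a = 10 ∨ a ∉ spin := by decide
        rcases this a ha with rfl | rfl | rfl | h
        · exact (rz 0 (.inl rfl) hr0).symm
        · exact (rz 1 (.inr rfl) hr1).symm
        · exact h10.symm
        · by_cases ha0 : a = 0
          · rw [ha0]
            exact (rz 0 (.inl rfl) hr0).symm
          · exact (hs a h ha0).symm
    refine ⟨t, fun k => r' (chartIndex k), ?_, ?_⟩
    · rw [chart_P, chartForm_self, hemb, hq, mul_zero]
    · rw [chart_param]
      have e1 : biv (xf 3 t) (chartA fun k => r' (chartIndex k)) = wedge (u 0 + t • u 1) r := by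
        change biv (xf 3 t) (wedge (u 0) (emb _)) = _
        rw [hemb, biv_wedge, (xf_three_u t).1, hr', ← xf_inv]
        congr 1
        have := glEquiv_inv_apply (xf 3 t)⁻¹ r
        rwa [inv_inv] at this
      rw [e1, Submodule.Quotient.eq, add_sub_cancel_right]
      exact Submodule.smul_mem _ _ (Submodule.mem_span_singleton_self _)
  · rintro ⟨t, r, hr, rfl⟩
    refine ⟨fun h => hβ (by rw [h, map_zero]), _, (chart_param t r).symm, fun a b => ?_⟩
    have := biv_mem_X (xf_mem_gen (Set.mem_univ 3) t) (line_chartA_mem_X hr a b)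
    rwa [map_add, map_smul, map_smul, biv_xf_three_v₃] at this

end F4

/-! ### Closed cones stable under a Borel subgroup -/

theorem mem_of_forall_ne_zero {E : Type*} [TopologicalSpace E] {Z : Set E} (hZ : IsClosed Z)
    {g : ℂ → E} (hg : Continuous g) (h : ∀ s, s ≠ 0 → g s ∈ Z) : g 0 ∈ Z := by
  have h1 : closure ({0}ᶜ : Set ℂ) ⊆ g ⁻¹' Z :=
    closure_minimal (fun s hs => h s hs) (hZ.preimage hg)
  rw [closure_compl_singleton] at h1
  exact h1 (Set.mem_univ 0)

/-! ### Limits of one-parameter unipotent orbits -/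

section Nilpotent

variable {N : Type} [Fintype N] [DecidableEq N]

theorem exp_smul_mulVec_of_pow_eq_zero {M : Matrix N N ℂ} {n : ℕ} (h : M ^ n = 0) (t : ℂ)
    (z : N → ℂ) : NormedSpace.exp (t • M) *ᵥ z =
      ∑ j ∈ Finset.range n, (t ^ j / j.factorial) • (M ^ j *ᵥ z) := by
  rw [NormedSpace.exp_eq_tsum ℂ]
  simp only
  rw [tsum_eq_sum (s := Finset.range n), Matrix.sum_mulVec]
  · refine Finset.sum_congr rfl fun j _ => ?_
    rw [smul_pow, smul_smul, Matrix.smul_mulVec]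
    congr 1
    rw [div_eq_inv_mul]
  · intro k hk
    have : n ≤ k := by simpa using hk
    rw [smul_pow, pow_eq_zero_of_le this h, smul_zero, smul_zero]

/-- The leading coefficient of a one-parameter unipotent orbit in a closed cone. -/
theorem pow_mulVec_mem {Z : Set (N → ℂ)} (hZ : IsClosed Z) (hc : ∀ (c : ℂ), ∀ z ∈ Z, c • z ∈ Z)
    {M : Matrix N N ℂ} {n : ℕ} (hM : M ^ n = 0)
    (hexp : ∀ t : ℂ, ∀ z ∈ Z, NormedSpace.exp (t • M) *ᵥ z ∈ Z) {z : N → ℂ} (hz : z ∈ Z) {J : ℕ}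
    (hJ : M ^ (J + 1) *ᵥ z = 0) : M ^ J *ᵥ z ∈ Z := by
  have hJ' : ∀ j, J < j → M ^ j *ᵥ z = 0 := by
    intro j hj
    rw [← Nat.sub_add_cancel (show J + 1 ≤ j from hj), pow_add, ← Matrix.mulVec_mulVec, hJ,
      Matrix.mulVec_zero]
  by_cases hJn : J < n
  swap
  · rw [pow_eq_zero_of_le (not_lt.1 hJn) hM, Matrix.zero_mulVec]
    simpa using hc 0 z hz
  -- For s ≠ 0 this is s^J exp(s⁻¹ M) z, which lies in the cone; it extends continuously to s = 0,
  -- where only the leading term M^J z / J! survives.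
  let g : ℂ → N → ℂ := fun s => ∑ j ∈ Finset.range n,
    ((if j ≤ J then s ^ (J - j) else 0) / j.factorial) • (M ^ j *ᵥ z)
  have hg : Continuous g := by
    refine continuous_finsetSum _ fun j _ => ?_
    split_ifs <;> fun_prop
  have h1 : g 0 ∈ Z := by
    refine mem_of_forall_ne_zero hZ hg fun s hs => ?_
    have e1 : g s = s ^ J • (NormedSpace.exp (s⁻¹ • M) *ᵥ z) := by
      rw [exp_smul_mulVec_of_pow_eq_zero hM, Finset.smul_sum]
      refine Finset.sum_congr rfl fun j _ => ?_
      rw [smul_smul]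
      by_cases hj : j ≤ J
      · rw [if_pos hj]
        congr 1
        rw [← Nat.sub_add_cancel hj, pow_add, Nat.sub_add_cancel hj, inv_pow]
        field_simp
      · rw [hJ' j (not_le.1 hj), smul_zero, smul_zero]
    rw [e1]
    exact hc _ _ (hexp _ _ hz)
  have h2 : g 0 = (1 / (J.factorial : ℂ)) • (M ^ J *ᵥ z) := by
    refine (Finset.sum_eq_single J (fun j _ hj => ?_) fun h => ?_).trans ?_
    · by_cases hj' : j ≤ J
      · rw [if_pos hj', zero_pow (by omega), zero_div, zero_smul]
      · rw [if_neg hj', zero_div, zero_smul]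
    · exact absurd (Finset.mem_range.2 hJn) h
    · simp
  rw [h2] at h1
  have h3 := hc (J.factorial : ℂ) _ h1
  rwa [smul_smul, mul_one_div_cancel (Nat.cast_ne_zero.2 J.factorial_ne_zero), one_smul] at h3

theorem isNilpotent_tensorAct {M : Matrix N N ℂ} (h : M * M * M = 0) :
    IsNilpotent (SerreRep.tensorAct M) := by
  refine Commute.isNilpotent_add ?_ ⟨3, ?_⟩ ⟨3, ?_⟩
  · simp [Commute, SemiconjBy, ← Matrix.mul_kronecker_mul]
  · rw [pow_succ, pow_two, ← Matrix.mul_kronecker_mul, ← Matrix.mul_kronecker_mul, h,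
      Matrix.zero_kronecker]
  · rw [pow_succ, pow_two, ← Matrix.mul_kronecker_mul, ← Matrix.mul_kronecker_mul, h,
      Matrix.kronecker_zero]

end Nilpotent

/-! ### Stability under the Borel subgroup -/

namespace SerreRep

variable {n : ℕ} {A : Matrix (Fin n) (Fin n) ℤ} {N : Type} [Fintype N] [DecidableEq N]
  {ρ : SerreRep A N}

theorem exists_tensorGL_of_mem_borel {g : GL (N × N) ℂ} (hg : g ∈ ρ.tensorSquare.borel) :
    ∃ g' ∈ ρ.borel, tensorGL g' = g := by
  induction hg using ρ.tensorSquare.borel_induction with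
  | he i t => exact ⟨_, ρ.exp_e_mem_borel i t, by rw [tensorGL_expGL, tensorAct_smul]; rfl⟩
  | hh i t => exact ⟨_, ρ.exp_h_mem_borel i t, by rw [tensorGL_expGL, tensorAct_smul]; rfl⟩
  | one => exact ⟨1, one_mem _, map_one _⟩
  | mul g g' _ _ h h' =>
    obtain ⟨k, hk, rfl⟩ := h
    obtain ⟨k', hk', rfl⟩ := h'
    exact ⟨_, mul_mem hk hk', map_mul _ _ _⟩

/-- A subspace stable under the positive generators is stable under the Borel subgroup. -/
theorem borel_mulVec_mem {W : Submodule ℂ (N → ℂ)} (he : ∀ k, ∀ w ∈ W, ρ.e k *ᵥ w ∈ W)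
    (hh : ∀ k, ∀ w ∈ W, ρ.h k *ᵥ w ∈ W) {g : GL N ℂ} (hg : g ∈ ρ.borel) :
    ∀ w ∈ W, (g : Matrix N N ℂ) *ᵥ w ∈ W := by
  induction hg using ρ.borel_induction with
  | he i t =>
    intro w hw
    refine exp_mulVec_mem (fun w hw => ?_) hw
    rw [Matrix.smul_mulVec]
    exact W.smul_mem _ (he i w hw)
  | hh i t =>
    intro w hw
    refine exp_mulVec_mem (fun w hw => ?_) hw
    rw [Matrix.smul_mulVec]
    exact W.smul_mem _ (hh i w hw)
  | one => intro w hw; simpa using hw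
  | mul g g' _ _ h h' =>
    intro w hw
    rw [Units.val_mul, ← Matrix.mulVec_mulVec]
    exact h _ (h' _ hw)

theorem hwSpan_le {v : N → ℂ} {W : Submodule ℂ (N → ℂ)} (hv : v ∈ W)
    (hf : ∀ i, ∀ w ∈ W, ρ.f i *ᵥ w ∈ W) : ρ.hwSpan v ≤ W := by
  refine Submodule.span_le.2 ?_
  rintro w ⟨d, hd⟩
  induction hd with
  | base => exact hv
  | step i w d _ ih => exact hf i w ih

end SerreRep

/-! ### Stability properties of orbit closures -/

section OrbitClosure

variable {N : Type} [Fintype N] [DecidableEq N] {H : Subgroup (GL N ℂ)} {v : N → ℂ}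
  {Z : Set (N → ℂ)}

theorem IsOrbitClosure.isClosed (h : IsOrbitClosure H v Z) : IsClosed Z := h.2 ▸ isClosed_closure

theorem IsOrbitClosure.self_mem (h : IsOrbitClosure H v Z) : v ∈ Z := by
  rw [h.2]
  exact subset_closure ⟨1, one_mem _, 1, by simp⟩

theorem IsOrbitClosure.smul_mem (h : IsOrbitClosure H v Z) (c : ℂ) : ∀ z ∈ Z, c • z ∈ Z := by
  intro z hz
  rw [h.2] at hz ⊢
  refine map_mem_closure (continuous_const_smul c) hz ?_
  rintro _ ⟨g, hg, c', rfl⟩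
  exact ⟨g, hg, c * c', by rw [smul_smul]⟩

theorem IsOrbitClosure.mulVec_mem (h : IsOrbitClosure H v Z) {g : GL N ℂ} (hg : g ∈ H) :
    ∀ z ∈ Z, (g : Matrix N N ℂ) *ᵥ z ∈ Z := by
  intro z hz
  rw [h.2] at hz ⊢
  refine map_mem_closure (Continuous.matrix_mulVec continuous_const continuous_id) hz ?_
  rintro _ ⟨g', hg', c', rfl⟩
  exact ⟨g * g', mul_mem hg hg', c', by
    rw [Matrix.mulVec_smul, Matrix.mulVec_mulVec, Units.val_mul]⟩

theorem IsOrbitClosure.subset (h : IsOrbitClosure H v Z) {T : Set (N → ℂ)} (hT : IsClosed T)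
    (hv : ∀ g ∈ H, ∀ c : ℂ, c • ((g : Matrix N N ℂ) *ᵥ v) ∈ T) : Z ⊆ T := by
  rw [h.2]
  refine closure_minimal ?_ hT
  rintro _ ⟨g, hg, c, rfl⟩
  exact hv g hg c

end OrbitClosure

/-! ### Highest weight vectors in closed cones and in planes -/

namespace F4

/-- The height of the difference of the weights of `u 0` and `u a`. -/
def ht : Fin 27 → ℕ := ![0, 1, 2, 3, 4, 4, 5, 5, 6, 6, 7, 7, 8, 8, 8, 9, 9, 10, 10, 11, 11, 12, 12,
  13, 14, 15, 16]

theorem ht_fNbr : ∀ i a, ∀ b ∈ fNbr i a, ht b = ht a + 1 := by decide +kernel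

theorem ht_lt : ∀ a, ht a < 17 := by decide

theorem sum_map_eq_zero {l : List (Fin 27)} {φ : Fin 27 → ℂ} (h : ∀ b ∈ l, φ b = 0) :
    (l.map φ).sum = 0 := by
  apply List.sum_eq_zero
  simpa using h

theorem e_height {n : ℕ} {r : Fin 27 → ℂ} (h : ∀ a, n + 1 ≤ ht a → r a = 0) (k : Fin 4) :
    ∀ a, n ≤ ht a → (e k *ᵥ r) a = 0 := by
  intro a ha
  rw [e_apply]
  exact sum_map_eq_zero fun b hb => h b (by rw [ht_fNbr k a b hb]; omega)

theorem rep_e_height {n : ℕ} {z : Fin 27 × Fin 27 → ℂ}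
    (h : ∀ a b, n + 1 ≤ ht a + ht b → z (a, b) = 0) (k : Fin 4) :
    ∀ a b, n ≤ ht a + ht b → (rep.e k *ᵥ z) (a, b) = 0 := by
  intro a b hab
  rw [tensor_e_apply, sum_map_eq_zero, sum_map_eq_zero, add_zero]
  · exact fun c hc => h _ _ (by rw [ht_fNbr k b c hc]; omega)
  · exact fun c hc => h _ _ (by rw [ht_fNbr k a c hc]; omega)

theorem rep_e_pow_height {n : ℕ} {z : Fin 27 × Fin 27 → ℂ}
    (h : ∀ a b, n + 1 ≤ ht a + ht b → z (a, b) = 0) (k : Fin 4) (J : ℕ) :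
    ∀ a b, n ≤ ht a + ht b → (rep.e k ^ (J + 1) *ᵥ z) (a, b) = 0 := by
  induction J with
  | zero => simpa using rep_e_height h k
  | succ J ih =>
    rw [pow_succ', ← Matrix.mulVec_mulVec]
    exact rep_e_height (fun a b hab => ih a b (by omega)) k

/-- An elementary form of Borel's fixed point theorem. If e_k z ≠ 0, the last nonzero e_k^j z lies
in the cone by `pow_mulVec_mem` and has smaller height, so the process ends at a vector killed by
all e_k. -/
theorem exists_highest_vector {Z : Set (Fin 27 × Fin 27 → ℂ)} (hZ : IsClosed Z)
    (hc : ∀ (c : ℂ), ∀ z ∈ Z, c • z ∈ Z)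
    (he : ∀ k (t : ℂ), ∀ z ∈ Z, NormedSpace.exp (t • rep.e k) *ᵥ z ∈ Z) (n : ℕ) :
    ∀ z ∈ Z, z ≠ 0 → (∀ a b, n ≤ ht a + ht b → z (a, b) = 0) →
      ∃ z ∈ Z, z ≠ 0 ∧ ∀ k, rep.e k *ᵥ z = 0 := by
  induction n with
  | zero =>
    intro z _ hz0 h
    exact absurd (funext fun ⟨a, b⟩ => h a b (Nat.zero_le _)) hz0
  | succ n ih =>
    intro z hz hz0 h
    by_cases hk : ∀ k, rep.e k *ᵥ z = 0
    · exact ⟨z, hz, hz0, hk⟩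
    push Not at hk
    obtain ⟨k, hk⟩ := hk
    obtain ⟨m, hm⟩ : IsNilpotent (rep.e k) := isNilpotent_tensorAct (e_pow_three k)
    have hex : ∃ j, rep.e k ^ j *ᵥ z = 0 := ⟨m, by rw [hm, Matrix.zero_mulVec]⟩
    classical
    have h1 := Nat.find_spec hex
    have h2 : ∀ j, j < Nat.find hex → rep.e k ^ j *ᵥ z ≠ 0 := fun j hj => Nat.find_min hex hj
    -- J + 1 is the exponent of the last nonzero power; it is positive because e_k z ≠ 0, which is
    -- what makes the height drop.
    obtain ⟨J, hJ⟩ : ∃ J, Nat.find hex = J + 1 + 1 := by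
      refine ⟨Nat.find hex - 2, ?_⟩
      have a0 : Nat.find hex ≠ 0 := by
        intro h0
        rw [h0, pow_zero, Matrix.one_mulVec] at h1
        exact hz0 h1
      have a1 : Nat.find hex ≠ 1 := by
        intro h0
        rw [h0, pow_one] at h1
        exact hk h1
      omega
    rw [hJ] at h1 h2
    exact ih _ (pow_mulVec_mem hZ hc hm (he k) hz h1) (h2 _ (Nat.lt_succ_self _))
      (rep_e_pow_height h k J)

/-- For z killed by e_k this product rule says that e_k maps contractions of z to contractions of z;
for decomposable z, it preserves the plane. -/
theorem contract_rep_e (k : Fin 4) (ξ : Fin 27 → ℂ) (z : Fin 27 × Fin 27 → ℂ) :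
    contract ξ (rep.e k *ᵥ z) = contract (ξ ᵥ* e k) z + e k *ᵥ contract ξ z := by
  ext b
  have h : ∀ a, (rep.e k *ᵥ z) (a, b) = _ := fun a => tensor_apply (e k) z a b
  simp only [contract_apply, h, Pi.add_apply, mul_add, Finset.sum_add_distrib]
  congr 1
  · simp only [Matrix.mulVec, Matrix.vecMul, dotProduct, Finset.mul_sum, Finset.sum_mul]
    rw [Finset.sum_comm]
    exact Finset.sum_congr rfl fun _ _ => Finset.sum_congr rfl fun _ _ => by ring
  · simp only [Matrix.mulVec, dotProduct, contract_apply, Finset.mul_sum]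
    rw [Finset.sum_comm]
    exact Finset.sum_congr rfl fun _ _ => Finset.sum_congr rfl fun _ _ => by ring

/-- The height descent of `exists_highest_vector`, carried out among the contractions of z. -/
theorem exists_highest_contract {z : Fin 27 × Fin 27 → ℂ} (he : ∀ k, rep.e k *ᵥ z = 0) (n : ℕ) :
    ∀ ξ, contract ξ z ≠ 0 → (∀ a, n ≤ ht a → contract ξ z a = 0) →
      ∃ ξ, contract ξ z ≠ 0 ∧ ∀ k, e k *ᵥ contract ξ z = 0 := by
  induction n with
  | zero =>
    intro ξ h0 h
    exact absurd (funext fun a => h a (Nat.zero_le _)) h0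
  | succ n ih =>
    intro ξ h0 h
    by_cases hk : ∀ k, e k *ᵥ contract ξ z = 0
    · exact ⟨ξ, h0, hk⟩
    push Not at hk
    obtain ⟨k, hk⟩ := hk
    have h1 : contract (-(ξ ᵥ* e k)) z = e k *ᵥ contract ξ z := by
      have := contract_rep_e k ξ z
      rw [he k, map_zero] at this
      have h2 : contract (-(ξ ᵥ* e k)) z = -contract (ξ ᵥ* e k) z := by
        ext b
        simp [contract_apply]
      rw [h2]
      exact neg_eq_of_add_eq_zero_right this.symm
    exact ih _ (by rwa [h1]) (by rw [h1]; exact e_height h k)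

/-- A traceless vector killed by the `e k` is a multiple of `u 0`. -/
theorem eq_smul_u_zero {r : Fin 27 → ℂ} (h : ∀ k, e k *ᵥ r = 0) (ht : tr r = 0) :
    r = r 0 • u 0 := by
  have step : ∀ (k : Fin 4) (a b : Fin 27), fNbr k a = [b] → r b = 0 := by
    intro k a b hab
    rw [← e_apply_of_fNbr hab r, h k, Pi.zero_apply]
  have h1 : ∀ b, b ≠ 0 → b ≠ 12 → b ≠ 13 → b ≠ 14 → r b = 0 := by
    intro b h0 h12 h13 h14
    have : ∀ b : Fin 27, b ≠ 0 → b ≠ 12 → b ≠ 13 → b ≠ 14 → ∃ k a, fNbr k a = [b] := by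
      decide +kernel
    obtain ⟨k, a, hab⟩ := this b h0 h12 h13 h14
    exact step k a b hab
  have e1 : r 13 + r 14 = 0 := by
    have := congrFun (h 2) 11
    simpa [e_apply, fNbr, edges] using this
  have e2 : r 12 + r 13 = 0 := by
    have := congrFun (h 3) 10
    simpa [e_apply, fNbr, edges] using this
  rw [tr_apply] at ht
  have h13 : r 13 = 0 := by linear_combination (e1 + e2 - ht) / 3
  have h12 : r 12 = 0 := by linear_combination e2 - h13
  have h14 : r 14 = 0 := by linear_combination e1 - h13
  ext b
  by_cases h0 : b = 0
  · subst h0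
    simp [u]
  have : r b = 0 := by
    by_cases b12 : b = 12
    · rw [b12, h12]
    by_cases b13 : b = 13
    · rw [b13, h13]
    by_cases b14 : b = 14
    · rw [b14, h14]
    exact h1 b h0 b12 b13 b14
  simp [u, h0, this]

theorem exists_wedge_eq_of_contract {ξ p q : Fin 27 → ℂ} (h : contract ξ (wedge p q) ≠ 0) :
    ∃ q', wedge p q = wedge (contract ξ (wedge p q)) q' := by
  rw [contract_wedge] at h ⊢
  set s := ∑ a, ξ a * p a
  set t := ∑ a, ξ a * q a
  by_cases hs : s = 0
  · have ht : t ≠ 0 := by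
      rintro ht
      simp [hs, ht] at h
    refine ⟨-t⁻¹ • q, ?_⟩
    ext x
    simp only [hs, wedge, Pi.sub_apply, Pi.smul_apply, smul_eq_mul]
    field_simp
    ring
  · refine ⟨-s⁻¹ • p, ?_⟩
    ext x
    simp only [wedge, Pi.sub_apply, Pi.smul_apply, smul_eq_mul]
    field_simp
    ring

/-- The tensors all of whose rows are traceless form a subspace that contains `v₃` and, as `tr`
kills the ranges of the lowering operators, is stable under them. -/
theorem tr_contract {z : Fin 27 × Fin 27 → ℂ} (hz : z ∈ V₃) (ξ : Fin 27 → ℂ) :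
    tr (contract ξ z) = 0 := by
  let W : Submodule ℂ (Fin 27 × Fin 27 → ℂ) :=
    { carrier := {z | ∀ a, tr (fun b => z (a, b)) = 0}
      add_mem' := by
        intro z z' h h' a
        have := congrArg₂ (· + ·) (h a) (h' a)
        rw [add_zero, ← map_add] at this
        exact this
      zero_mem' := fun a => map_zero tr
      smul_mem' := by
        intro c z h a
        have := congrArg (c • ·) (h a)
        simp only [← map_smul, smul_zero] at this
        exact this }
  have hW : V₃ ≤ W := by
    refine SerreRep.hwSpan_le ?_ fun i z hz => ?_
    · intro a
      simp [tr_apply, v₃, wedge]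
    · intro a
      have h1 : (fun b => (rep.f i *ᵥ z) (a, b)) =
          ((eNbr i a).map fun a' => fun b => z (a', b)).sum + f i *ᵥ fun b => z (a, b) := by
        ext b
        rw [Pi.add_apply, f_apply, tensor_f_apply]
        congr 1
        induction eNbr i a with
        | nil => simp
        | cons c l ih => simp [ih]
      rw [h1, map_add, tr_f, add_zero]
      induction eNbr i a with
      | nil => simp
      | cons c l ih => simp only [List.map_cons, List.sum_cons, map_add, ih, add_zero]; exact hz c
  have h1 : contract ξ z = ∑ a, ξ a • fun b => z (a, b) := by
    ext b
    simp [contract_apply]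
  rw [h1, map_sum]
  refine Finset.sum_eq_zero fun a _ => ?_
  rw [map_smul, hW hz a, smul_zero]

/-- Highest weight vectors in the cone of decomposable vectors of `V(ω₃)`. -/
theorem eq_smul_v₃_of_highest {z : Fin 27 × Fin 27 → ℂ} (hP : IsPluecker z) (hV : z ∈ V₃)
    (h0 : z ≠ 0) (he : ∀ k, rep.e k *ᵥ z = 0) : ∃ c : ℂ, c ≠ 0 ∧ z = c • v₃ := by
  obtain ⟨p, q, rfl⟩ := hP.exists_wedge
  obtain ⟨ξ, hξ, hξe⟩ : ∃ ξ, contract ξ (wedge p q) ≠ 0 ∧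
      ∀ k, e k *ᵥ contract ξ (wedge p q) = 0 := by
    obtain ⟨⟨a, b⟩, hab⟩ := Function.ne_iff.1 h0
    refine exists_highest_contract he 17 (u a) (fun h => hab ?_) fun a ha =>
      absurd (ht_lt a) (not_lt.2 ha)
    have := congrFun h b
    simpa [contract_apply, u, Pi.single_apply] using this
  obtain ⟨q', hq'⟩ := exists_wedge_eq_of_contract hξ
  -- The trace excludes the trivial summand of ℂ²⁷, so the highest vector of the plane can only be a
  -- multiple of u₀.
  have hu := eq_smul_u_zero hξe (tr_contract hV ξ)
  rw [hu, wedge_smul_left, ← wedge_smul_right] at hq'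
  generalize (contract ξ (wedge p q) 0) • q' = q₀ at hq'
  rw [hq'] at hV h0 he ⊢
  have htr : tr q₀ = 0 := by
    have h1 := tr_contract hV (u 0)
    rw [contract_wedge, map_sub, map_smul, map_smul] at h1
    simpa [u, tr_apply, Pi.single_apply] using h1
  have hq₀ : ∀ k a, a ≠ 0 → (e k *ᵥ q₀) a = 0 := by
    intro k a ha
    have := congrFun (he k) (0, a)
    rw [rep_e_wedge, e_u_zero, wedge_zero_left, zero_add] at this
    simpa [wedge, u, ha] using this
  -- All e_k q₀ are multiples of u₀, and u₀ is reached only from u₁, so removing the coordinate at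
  -- u₁ leaves a vector killed by every e_k.
  have hker : ∀ k, e k *ᵥ (q₀ - q₀ 0 • u 0 - q₀ 1 • u 1) = 0 := by
    intro k
    ext a
    rw [Matrix.mulVec_sub, Matrix.mulVec_sub, Matrix.mulVec_smul, Matrix.mulVec_smul, e_u_zero]
    by_cases ha : a = 0
    · subst ha
      have h3 : (e k *ᵥ q₀) 0 = q₀ 1 * (e k *ᵥ u 1) 0 := by
        rw [e_apply, e_apply]
        fin_cases k <;> simp [fNbr, edges, u]
      simp [h3]
    · have h3 : (e k *ᵥ u 1) a = 0 := by
        rw [e_u]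
        fin_cases k <;> simp [eNbr, edges, u, ha]
      simp [h3, hq₀ k a ha]
  have htr' : tr (q₀ - q₀ 0 • u 0 - q₀ 1 • u 1) = 0 := by
    rw [map_sub, map_sub, htr]
    simp [tr_apply, u]
  have h2 : q₀ - q₀ 0 • u 0 - q₀ 1 • u 1 = 0 := by
    rw [eq_smul_u_zero hker htr']
    simp [u]
  rw [sub_sub, sub_eq_zero] at h2
  have h3 : wedge (u 0) q₀ = q₀ 1 • v₃ := by
    rw [h2, wedge_add_right, wedge_smul_right, wedge_smul_right, wedge_self, v₃_eq]
    simp [u]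
  refine ⟨q₀ 1, fun h => h0 ?_, h3⟩
  rw [h3, h, zero_smul]

end F4

/-! ### Weight spaces in a sum of two highest weight modules -/

namespace SerreRep

variable {n : ℕ} {A : Matrix (Fin n) (Fin n) ℤ} {N : Type} [Fintype N] [DecidableEq N]
  {ρ : SerreRep A N}

theorem FWord.eq_of_zero {v w : N → ℂ} {d : Fin n → ℕ} (h : ρ.FWord v w d) (hd : d = 0) :
    w = v := by
  cases h with
  | base => rfl
  | step i w d h =>
    have := congrFun hd i
    simp at this

/-- The projection to the coordinates of weight `ν`. -/
def weightProj (ω : Fin n → N → ℤ) (ν : Fin n → ℤ) : (N → ℂ) →ₗ[ℂ] (N → ℂ) where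
  toFun z p := if ∀ k, ω k p = ν k then z p else 0
  map_add' z z' := by
    ext p
    simp only [Pi.add_apply]
    split_ifs <;> simp
  map_smul' c z := by
    ext p
    simp

theorem weightProj_eq {ω : Fin n → N → ℤ} (hω : ∀ k z p, (ρ.h k *ᵥ z) p = ω k p * z p)
    {μ ν : Fin n → ℤ} {z : N → ℂ} (hz : ρ.IsWeightVector μ z) :
    weightProj ω ν z = if μ = ν then z else 0 := by
  have h1 : ∀ p, z p ≠ 0 → ∀ k, ω k p = μ k := by
    intro p hp k
    have := congrFun (hz k) p
    rw [hω, Pi.smul_apply, smul_eq_mul] at this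
    exact_mod_cast mul_right_cancel₀ hp this
  ext p
  change (if ∀ k, ω k p = ν k then z p else 0) = _
  by_cases hp : z p = 0
  · split_ifs <;> simp [hp]
  · have h2 : (∀ k, ω k p = ν k) ↔ μ = ν := by
      simp only [h1 p hp]
      exact funext_iff.symm
    simp only [h2]
    split_ifs <;> rfl

/-- The vectors of weight `ν` in the sum of two highest weight modules, where `ν` is the highest
weight of the second one and not a weight of the first one. -/
theorem eq_smul_of_mem_hwSpan_sup {ω : Fin n → N → ℤ}
    (hω : ∀ k z p, (ρ.h k *ᵥ z) p = ω k p * z p) {μ ν : Fin n → ℤ} {v w z : N → ℂ}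
    (hv : ρ.IsWeightVector μ v) (hw : ρ.IsWeightVector ν w) (hz : ρ.IsWeightVector ν z)
    (h1 : ∀ d : Fin n → ℕ, (∀ k, ∑ i, d i * A i k = 0) → d = 0)
    (h2 : ∀ d : Fin n → ℕ, ¬ ∀ k, μ k - ∑ i, d i * A i k = ν k)
    (h : z ∈ ρ.hwSpan v ⊔ ρ.hwSpan w) : ∃ c : ℂ, z = c • w := by
  obtain ⟨a, ha, b, hb, rfl⟩ := Submodule.mem_sup.1 h
  have ea : weightProj ω ν a = 0 := by
    have : ρ.hwSpan v ≤ LinearMap.ker (weightProj ω ν) := by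
      refine Submodule.span_le.2 ?_
      rintro y ⟨d, hd⟩
      rw [SetLike.mem_coe, LinearMap.mem_ker, weightProj_eq hω (hd.weight hv), if_neg]
      exact fun h => h2 d (congrFun h)
    exact this ha
  have eb : weightProj ω ν b ∈ (ℂ ∙ w : Submodule ℂ (N → ℂ)) := by
    have : ρ.hwSpan w ≤ (ℂ ∙ w : Submodule ℂ (N → ℂ)).comap (weightProj ω ν) := by
      refine Submodule.span_le.2 ?_
      rintro y ⟨d, hd⟩
      rw [SetLike.mem_coe, Submodule.mem_comap, weightProj_eq hω (hd.weight hw)]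
      split_ifs with h0
      · have hd0 : d = 0 := h1 d fun k => by simpa using congrFun h0 k
        rw [hd.eq_of_zero hd0]
        exact Submodule.mem_span_singleton_self w
      · exact zero_mem _
    exact this hb
  have ez := weightProj_eq hω (ν := ν) hz
  rw [if_pos rfl, map_add, ea, zero_add] at ez
  rw [ez] at eb
  obtain ⟨c, hc⟩ := Submodule.mem_span_singleton.1 eb
  exact ⟨c, hc.symm⟩

end SerreRep

namespace F4

/-! ### Schubert varieties in `X` -/

section Schubert

variable {Z : Set (Fin 27 × Fin 27 → ℂ)}

theorem schubert_subset_V₃ (hZ : IsSchubertVariety rep X Z) {z : Fin 27 × Fin 27 → ℂ}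
    (hz : z ∈ Z) : z ∈ V₃ := by
  obtain ⟨x, hx, hO⟩ := hZ
  refine hO.subset (T := (V₃ : Set _)) V₃.closed_of_finiteDimensional (fun g hg c => ?_) hz
  exact V₃.smul_mem c (SerreRep.borel_mulVec_mem (fun k _ => e_mem_V₃ k)
    (fun k _ => SerreRep.h_mem_hwSpan v₃_isFundamentalVector.isWeightVector k) hg _
    (X_subset_V₃ hx))

theorem schubert_isPluecker (hZ : IsSchubertVariety rep X Z) {z : Fin 27 × Fin 27 → ℂ}
    (hz : z ∈ Z) : IsPluecker z := by
  obtain ⟨x, hx, hO⟩ := hZ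
  refine hO.subset isClosed_isPluecker (fun g hg c => ?_) hz
  obtain ⟨g', _, rfl⟩ := rep27.exists_tensorGL_of_mem_borel hg
  exact ((isPluecker_of_mem_X hx).biv g').smul c

/-- The closed Borel-stable cone contains a nonzero vector killed by the e_k. It is decomposable and
lies in V(ω₃), because both conditions are closed and Borel-stable, so it is a multiple of `v₃`. -/
theorem v₃_mem_schubert (hZ : IsSchubertVariety rep X Z) : v₃ ∈ Z := by
  obtain ⟨x, hx, hO⟩ := id hZ
  -- Heights of basis vectors are at most 16, so no entry of a bivector has height 33 or more.
  obtain ⟨z, hz, hz0, he⟩ := exists_highest_vector hO.isClosed hO.smul_mem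
    (fun k t z hz => hO.mulVec_mem (rep.exp_e_mem_borel k t) z hz) 33 x hO.self_mem hO.1
    (fun a b hab => by have := ht_lt a; have := ht_lt b; omega)
  obtain ⟨c, hc, rfl⟩ := eq_smul_v₃_of_highest (schubert_isPluecker hZ hz)
    (schubert_subset_V₃ hZ hz) hz0 he
  have := hO.smul_mem c⁻¹ _ hz
  rwa [smul_smul, inv_mul_cancel₀ hc, one_smul] at this

end Schubert

theorem rep_h_eq_diagonal (k : Fin 4) :
    rep.h k = Matrix.diagonal fun p => ((wt k p.1 + wt k p.2 : ℤ) : ℂ) := by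
  apply Matrix.ext_of_mulVec_single
  rintro p
  ext ⟨a, b⟩
  rw [tensor_h_apply, Matrix.mulVec_diagonal]
  push_cast
  rfl

theorem exp_h_mulVec {k : Fin 4} {μ : ℂ} {z : Fin 27 × Fin 27 → ℂ} (hz : rep.h k *ᵥ z = μ • z)
    (t : ℂ) : NormedSpace.exp (t • rep.h k) *ᵥ z = Complex.exp (t * μ) • z := by
  have h1 : t • rep.h k = Matrix.diagonal (t • fun p => ((wt k p.1 + wt k p.2 : ℤ) : ℂ)) := by
    rw [rep_h_eq_diagonal, Matrix.diagonal_smul]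
  rw [h1, Matrix.exp_diagonal]
  ext p
  rw [Matrix.mulVec_diagonal, Pi.coe_exp, Pi.smul_apply, Pi.smul_apply, smul_eq_mul, smul_eq_mul,
    ← Complex.exp_eq_exp_ℂ]
  by_cases hp : z p = 0
  · simp [hp]
  · have := congrFun hz p
    rw [rep_h_eq_diagonal, Matrix.mulVec_diagonal, Pi.smul_apply, smul_eq_mul] at this
    rw [mul_right_cancel₀ hp this]

/-- The second base point `u 1 ∧ u 2`. -/
noncomputable def y₃ : Fin 27 × Fin 27 → ℂ := wedge (u 1) (u 2)

/-- Bivectors of weight `ω₂` for the subdiagram of `α₂`, `α₃` on a line of `X` through `v₃`. -/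
theorem eq_smul_y₃ {v : Fin 27 × Fin 27 → ℂ} (hP : IsPluecker v) (hP' : IsPluecker (v₃ + v))
    (hV : v ∈ V₃) (he : rep.e 2 *ᵥ v = 0) (h1 : rep.h 1 *ᵥ v = v) (h2 : rep.h 2 *ᵥ v = 0) :
    ∃ c : ℂ, v = c • y₃ := by
  have hcd : ∀ c d, c ≠ 0 → c ≠ 1 → d ≠ 0 → d ≠ 1 → v (c, d) = 0 := fun c d hc0 hc1 hd0 hd1 =>
    (isPluecker_line (by decide) hP (by rwa [← v₃_eq]) hc0 hc1 hd0 hd1).1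
  -- The Plücker equations leave only entries meeting {0, 1}. Of these, the two weight conditions
  -- allow in row 0 only column 9, and in row 1 only columns 2, 6, 17, 23.
  have hwt : ∀ a b, v (a, b) ≠ 0 → wt 1 a + wt 1 b = 1 ∧ wt 2 a + wt 2 b = 0 := by
    intro a b hab
    have e1 := congrFun h1 (a, b)
    have e2 := congrFun h2 (a, b)
    rw [tensor_h_apply] at e1 e2
    constructor
    · have : ((wt 1 a : ℂ) + wt 1 b) = 1 := mul_right_cancel₀ hab (by rw [e1, one_mul])
      exact_mod_cast this
    · have : ((wt 2 a : ℂ) + wt 2 b) = 0 := (mul_eq_zero.1 e2).resolve_right hab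
      exact_mod_cast this
  have hrow : ∀ b, v (0, b) ≠ 0 → b = 9 := by
    intro b hb
    have : ∀ b, wt 1 0 + wt 1 b = 1 ∧ wt 2 0 + wt 2 b = 0 → b = 9 := by decide +kernel
    exact this b (hwt 0 b hb)
  have hrow' : ∀ b, v (1, b) ≠ 0 → b = 2 ∨ b = 6 ∨ b = 17 ∨ b = 23 := by
    intro b hb
    have : ∀ b, wt 1 1 + wt 1 b = 1 ∧ wt 2 1 + wt 2 b = 0 → b = 2 ∨ b = 6 ∨ b = 17 ∨ b = 23 := by
      decide +kernel
    exact this b (hwt 1 b hb)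
  have kill : ∀ a b : Fin 27, a ≠ 0 → a ≠ 1 → fNbr 2 a = [b] → v (1, b) = 0 := by
    intro a b h0 h1 hab
    have := congrFun he (1, a)
    rw [tensor_e_apply, hab] at this
    simpa [fNbr, edges, hcd 2 a (by decide) (by decide) h0 h1] using this
  have h6 := kill 4 6 (by decide) (by decide) (by decide)
  have h17 := kill 15 17 (by decide) (by decide) (by decide)
  have h23 := kill 22 23 (by decide) (by decide) (by decide)
  -- The entry (0, 9) is compatible with the weights; `rep.e 0` moves it to (0, 7), where the
  -- functional of the highest root detects it.
  have h9 : v (0, 9) = 0 := by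
    have := adjFunctional_V₃ (e_mem_V₃ 0 hV)
    simp [adjFunctional, functional_apply, tensor_e_apply, fNbr, edges, h6,
      hP.1 6 1, hP.1 9 0, hcd 2 4, hcd 4 2] at this
    exact this
  have r0 : ∀ b, v (0, b) = 0 := by
    intro b
    by_contra hb
    rw [hrow b hb] at hb
    exact hb h9
  have r1 : ∀ b, b ≠ 2 → v (1, b) = 0 := by
    intro b hb2
    by_contra hb
    rcases hrow' b hb with rfl | rfl | rfl | rfl
    · exact hb2 rfl
    · exact hb h6
    · exact hb h17
    · exact hb h23
  refine ⟨v (1, 2), ?_⟩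
  ext ⟨a, b⟩
  rw [Pi.smul_apply, smul_eq_mul, y₃, wedge_u_apply]
  by_cases a0 : a = 0
  · simp [a0, r0]
  by_cases b0 : b = 0
  · simp [b0, hP.1 a 0, r0]
  by_cases a1 : a = 1
  · subst a1
    by_cases b2 : b = 2
    · simp [b2]
    · simp [b2, r1]
  by_cases b1 : b = 1
  · subst b1
    rw [hP.1 a 1]
    by_cases a2 : a = 2
    · simp [a2]
    · simp [a1, a2, r1]
  simp [a1, b1, hcd a b a0 a1 b0 b1]

/-- The possible pairs of a subdiagram and the set of the weights of its representation generated
by `u 1`. -/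
def IsSubdiagram (I : Set (Fin 4)) (T : Finset (Fin 27)) : Prop :=
  I = {0, 1, 2} ∧ T = spin ∨ I = {1, 2} ∧ T = {1, 2, 3, 5}

theorem range_eq_B {ι : Fin 3 → Fin 4} (h : CartanMatrix.F₄.submatrix ι ι = CartanMatrix.B 3) :
    ι = ![0, 1, 2] := by
  revert ι
  decide +kernel

/-- The order is reversed because the first root of C₂ is short, hence α₃, and the second is long,
hence α₂. -/
theorem range_eq_C {ι : Fin 2 → Fin 4} (h : CartanMatrix.F₄.submatrix ι ι = CartanMatrix.C 2) :
    ι = ![2, 1] := by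
  revert ι
  decide +kernel

/-- The vector `v₃` lies in `Z` and has L-weight ω_j, which does not occur in the module of v and
has multiplicity one in that of w, so w is proportional to `v₃`. The torus acts on v and w by
different characters, so the closed cone `Z` contains their whole span. Hence v and v + v₃ are
decomposable, and `eq_smul_y₃` identifies v. -/
theorem exists_model_aux {Z : Set (Fin 27 × Fin 27 → ℂ)} (hZ : IsSchubertVariety rep X Z) {m : ℕ}
    {ι : Fin m ↪ Fin 4} {i j : Fin m} (hi : ι i = 1) (hj : ι j = 2)
    (h1 : ∀ d : Fin m → ℕ, (∀ k, ∑ l, d l * CartanMatrix.F₄ (ι l) (ι k) = 0) → d = 0)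
    (h2 : ∀ d : Fin m → ℕ, ¬ ∀ k, (Pi.single i 1 : Fin m → ℤ) k -
      ∑ l, d l * CartanMatrix.F₄ (ι l) (ι k) = (Pi.single j 1 : Fin m → ℤ) k)
    (hH : IsHorospherical (rep.restrict ι) i j Z) :
    (∃ α γ : ℂ, IsOrbitClosure (rep.restrict ι).group (α • y₃ + γ • v₃) Z) ∧
      ∀ a b : ℂ, a • y₃ + b • v₃ ∈ Z := by
  obtain ⟨v, w, hv, hw, hO⟩ := hH
  have hij : i ≠ j := by
    rintro rfl
    rw [hi] at hj
    exact absurd hj (by decide)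
  have hsup : v₃ ∈ (rep.restrict ι).hwSpan v ⊔ (rep.restrict ι).hwSpan w := by
    refine hO.subset (T := (((rep.restrict ι).hwSpan v ⊔ (rep.restrict ι).hwSpan w : Submodule ℂ _) :
      Set _)) (Submodule.closed_of_finiteDimensional _) (fun g hg c => ?_) (v₃_mem_schubert hZ)
    refine Submodule.smul_mem _ c ?_
    rw [Matrix.mulVec_add]
    exact Submodule.add_mem_sup
      (SerreRep.group_mem_hwSpan hv.isWeightVector hv.2.1 hg (SerreRep.self_mem_hwSpan _))
      (SerreRep.group_mem_hwSpan hw.isWeightVector hw.2.1 hg (SerreRep.self_mem_hwSpan _))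
  have hv₃ : (rep.restrict ι).IsWeightVector (Pi.single j 1) v₃ := by
    intro k
    have := v₃_isFundamentalVector.2.2 (ι k)
    change rep.h (ι k) *ᵥ v₃ = _
    rw [this]
    by_cases hk : k = j
    · subst hk; simp [hj]
    · have : ι k ≠ 2 := fun h => hk (ι.injective (h.trans hj.symm))
      simp [hk, this]
  obtain ⟨c, hc⟩ := SerreRep.eq_smul_of_mem_hwSpan_sup (ρ := rep.restrict ι)
    (ω := fun k p => wt (ι k) p.1 + wt (ι k) p.2)
    (fun k z p => by
      have : ((rep.restrict ι).h k *ᵥ z) p = _ := tensor_h_apply (ι k) z p.1 p.2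
      rw [this]
      push_cast
      rfl) hv.isWeightVector hw.isWeightVector hv₃ h1 h2 hsup
  have hc0 : c ≠ 0 := by
    rintro rfl
    rw [zero_smul] at hc
    exact v₃_isFundamentalVector.1 hc
  obtain ⟨x, hx, hB⟩ := id hZ
  have e1 : rep.h 1 *ᵥ v = (1 : ℂ) • v := by
    have := hv.2.2 i
    rw [if_pos rfl] at this
    rw [one_smul, ← hi]
    exact this
  have e2 : rep.h 1 *ᵥ w = (0 : ℂ) • w := by
    have := hw.2.2 i
    rw [if_neg hij] at this
    rw [zero_smul, ← hi]
    exact this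
  have e3 : rep.h 2 *ᵥ v = 0 := by
    have := hv.2.2 j
    rw [if_neg hij.symm] at this
    rw [← hj]
    exact this
  -- h₁ acts by 1 on v and by 0 on w, so its exponentials rescale v alone; scalars and limits then
  -- give all combinations.
  have l1 : ∀ a : ℂ, a ≠ 0 → a • v + w ∈ Z := by
    intro a ha
    have : NormedSpace.exp (Complex.log a • rep.h 1) *ᵥ (v + w) ∈ Z :=
      hB.mulVec_mem (rep.exp_h_mem_borel 1 (Complex.log a)) _ hO.self_mem
    rwa [Matrix.mulVec_add, exp_h_mulVec e1, exp_h_mulVec e2, mul_one, Complex.exp_log ha, mul_zero,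
      Complex.exp_zero, one_smul] at this
  have l2 : ∀ a b : ℂ, a ≠ 0 → b ≠ 0 → a • v + b • w ∈ Z := by
    intro a b ha hb
    have := hO.smul_mem b _ (l1 (a / b) (div_ne_zero ha hb))
    rwa [smul_add, smul_smul, mul_div_cancel₀ _ hb] at this
  have l3 : ∀ a b : ℂ, a ≠ 0 → a • v + b • w ∈ Z := by
    intro a b ha
    by_cases hb : b = 0
    · subst hb
      exact mem_of_forall_ne_zero hO.isClosed (g := fun s => a • v + s • w) (by fun_prop)
        fun s hs => l2 a s ha hs
    · exact l2 a b ha hb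
  have l4 : ∀ a b : ℂ, a • v + b • w ∈ Z := by
    intro a b
    by_cases ha : a = 0
    · subst ha
      exact mem_of_forall_ne_zero hO.isClosed (g := fun s => s • v + b • w) (by fun_prop)
        fun s hs => l3 s b hs
    · exact l3 a b ha
  have hvZ : v ∈ Z := by simpa using l4 1 0
  obtain ⟨α, hα⟩ := eq_smul_y₃ (schubert_isPluecker hZ hvZ)
    (by
      have := schubert_isPluecker hZ (l4 1 c)
      rwa [one_smul, ← hc, add_comm] at this)
    (schubert_subset_V₃ hZ hvZ) (by have := hv.2.1 j; rw [← hj]; exact this)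
    (by rw [e1, one_smul]) e3
  have hα0 : α ≠ 0 := by
    rintro rfl
    rw [zero_smul] at hα
    exact hv.1 hα
  have hw' : w = c⁻¹ • v₃ := by rw [hc, smul_smul, inv_mul_cancel₀ hc0, one_smul]
  refine ⟨⟨α, c⁻¹, by rwa [← hα, ← hw']⟩, fun a b => ?_⟩
  have := l4 (a / α) (b * c)
  rwa [hα, hw', smul_smul, smul_smul, div_mul_cancel₀ _ hα0, mul_assoc, mul_inv_cancel₀ hc0,
    mul_one] at this

theorem exists_model {Z : Set (Fin 27 × Fin 27 → ℂ)} (hZ : IsSchubertVariety rep X Z)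
    (hType : IsOfType rep (CartanMatrix.B 3) 1 2 Z ∨ IsOfType rep (CartanMatrix.C 2) 1 0 Z) :
    ∃ I T, IsSubdiagram I T ∧
      (∃ α γ : ℂ, Z = closure {z | ∃ g ∈ gen I, ∃ c : ℂ, z = c • biv g (α • y₃ + γ • v₃)}) ∧
      ∀ a b : ℂ, a • y₃ + b • v₃ ∈ Z := by
  have fin : ∀ {m : ℕ} {ι : Fin m ↪ Fin 4} {I : Set (Fin 4)}, Set.range ι = I →
      (∃ α γ : ℂ, IsOrbitClosure (rep.restrict ι).group (α • y₃ + γ • v₃) Z) →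
      ∃ α γ : ℂ, Z = closure {z | ∃ g ∈ gen I, ∃ c : ℂ, z = c • biv g (α • y₃ + γ • v₃)} := by
    rintro m ι I rfl ⟨α, γ, h⟩
    refine ⟨α, γ, h.2.trans (congrArg closure ?_)⟩
    ext z
    exact mem_orbitCone_restrict
  rcases hType with ⟨ι, hA, hH⟩ | ⟨ι, hA, hH⟩
  · have hι := range_eq_B hA
    obtain ⟨h1, h2⟩ := exists_model_aux hZ (by simp [hι]) (by simp [hι])
      (by
        intro d hd
        -- Only the zero combination of the simple roots is zero: the Cartan matrix is nonsingular.
        have a0 := hd 0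
        have a1 := hd 1
        have a2 := hd 2
        simp [hι, Fin.sum_univ_three, CartanMatrix.F₄] at a0 a1 a2
        ext k
        fin_cases k <;> simp <;> omega)
      (by
        intro d hd
        -- A parity obstruction: the α₃-coroot takes the even value 2 d₂ − 2 d₁ on the lowering
        -- terms, but the two fundamental weights differ by 1 there. The same argument serves for
        -- C₂.
        have a2 := hd 2
        simp [hι, Fin.sum_univ_three, CartanMatrix.F₄] at a2
        omega) hH
    refine ⟨{0, 1, 2}, spin, .inl ⟨rfl, rfl⟩, fin ?_ h1, h2⟩
    rw [hι]
    ext k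
    fin_cases k <;> simp
  · have hι := range_eq_C hA
    obtain ⟨h1, h2⟩ := exists_model_aux hZ (by simp [hι]) (by simp [hι])
      (by
        intro d hd
        have a0 := hd 0
        have a1 := hd 1
        simp [hι, Fin.sum_univ_two, CartanMatrix.F₄] at a0 a1
        ext k
        fin_cases k <;> simp <;> omega)
      (by
        intro d hd
        have a2 := hd 0
        simp [hι, Fin.sum_univ_two, CartanMatrix.F₄] at a2
        omega) hH
    refine ⟨{1, 2}, {1, 2, 3, 5}, .inr ⟨rfl, rfl⟩, fin ?_ h1, h2⟩
    rw [hι]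
    ext k
    fin_cases k <;> simp

end F4

namespace F4

/-! ### The horospherical subvarieties of `X` -/

namespace IsSubdiagram

variable {I : Set (Fin 4)} {T : Finset (Fin 27)}

theorem subset_spin (h : IsSubdiagram I T) : T ⊆ spin := by
  rcases h with ⟨-, rfl⟩ | ⟨-, rfl⟩ <;> decide

theorem gen_le (h : IsSubdiagram I T) : gen I ≤ gen {0, 1, 2} := by
  rcases h with ⟨rfl, -⟩ | ⟨rfl, -⟩
  · exact le_rfl
  · exact gen_mono (Set.subset_insert _ _)

theorem one_mem_index (h : IsSubdiagram I T) : (1 : Fin 4) ∈ I := by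
  rcases h with ⟨rfl, -⟩ | ⟨rfl, -⟩ <;> simp

theorem two_mem_index (h : IsSubdiagram I T) : (2 : Fin 4) ∈ I := by
  rcases h with ⟨rfl, -⟩ | ⟨rfl, -⟩ <;> simp

theorem gen_two_le (h : IsSubdiagram I T) : gen {2} ≤ gen I := gen_mono (Set.singleton_subset_iff.2 h.two_mem_index)

theorem zero_mem_of_mem (h : IsSubdiagram I T) (h4 : 4 ∈ T) : (0 : Fin 4) ∈ I := by
  rcases h with ⟨rfl, -⟩ | ⟨-, rfl⟩
  · simp
  · exact absurd h4 (by decide)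

theorem mem_of_le (h : IsSubdiagram I T) {a : Fin 27} (h1 : a = 1 ∨ a = 2 ∨ a = 3) : a ∈ T := by
  rcases h with ⟨-, rfl⟩ | ⟨-, rfl⟩ <;> rcases h1 with rfl | rfl | rfl <;> decide

/-- No arrow of the subdiagram joins {0} ∪ T to its complement, so the span of u₀ and the u_c with c
in T is L-stable. -/
theorem nbr_mem (h : IsSubdiagram I T) {i : Fin 4} (hi : i ∈ I) : ∀ c ∈ (insert 0 T)ᶜ,
    (∀ d ∈ fNbr i c, d ∈ (insert 0 T)ᶜ) ∧ ∀ d ∈ eNbr i c, d ∈ (insert 0 T)ᶜ := by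
  rcases h with ⟨rfl, rfl⟩ | ⟨rfl, rfl⟩
  · rcases hi with rfl | rfl | rfl <;> decide +kernel
  · rcases hi with rfl | rfl <;> decide +kernel

theorem glEquiv_vanish (h : IsSubdiagram I T) {g : GL (Fin 27) ℂ} (hg : g ∈ gen I) :
    ∀ y : Fin 27 → ℂ, (∀ c ∈ (insert 0 T)ᶜ, y c = 0) → ∀ c ∈ (insert 0 T)ᶜ, glEquiv g y c = 0 := by
  induction hg using gen_induction with
  | he i hi t => exact fun y => vanish_xe (fun c hc => (h.nbr_mem hi c hc).1) t
  | hf i hi t => exact fun y => vanish_xf (fun c hc => (h.nbr_mem hi c hc).2) t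
  | one => intro y hy; rwa [glEquiv_one]
  | mul g g' _ _ h h' =>
    intro y hy
    simp only [glEquiv_mul]
    exact h _ (h' y hy)

theorem exists_gen_smul_u_one (h : IsSubdiagram I T) {p : Fin 27 → ℂ} (hp : ∀ c, c ∉ T → p c = 0) (hq : quad p = 0) :
    ∃ g ∈ gen I, ∃ c : ℂ, glEquiv g p = c • u 1 := by
  rcases h with ⟨rfl, rfl⟩ | ⟨rfl, rfl⟩
  · exact exists_gen_smul_of_null hp hq
  · exact exists_gen_smul_of_vanish hp

/-- On u₂, u₃, u₄ the roots α₁, α₂ act as on the standard representation of SL₃. Using only these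
roots keeps u₁ fixed; when L lacks α₁, the coordinate at 4 is zero and the SL₂ of α₂ suffices. -/
theorem exists_gen_smul_u_two (h : IsSubdiagram I T) {w : Fin 27 → ℂ}
    (hw : ∀ c, c ∉ ({2, 3, 4} : Finset (Fin 27)) → w c = 0)
    (h4 : 4 ∉ T → w 4 = 0) :
    ∃ g ∈ gen I, g ∈ gen {0, 1} ∧ ∃ c : ℂ, glEquiv g w = c • u 2 := by
  have step : ∃ g ∈ gen I, g ∈ gen {0, 1} ∧
      ∀ c ∈ ({2, 3}ᶜ : Finset (Fin 27)), glEquiv g w c = 0 := by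
    by_cases hT : 4 ∈ T
    · obtain ⟨s, t, z, k⟩ := exists_eliminate 0 3 4 {2, 3, 4}ᶜ (by decide) (by decide) w
        fun c hc => hw c (Finset.mem_compl.1 hc)
      refine ⟨_, xf_mul_xe_mem (h.zero_mem_of_mem hT) s t, xf_mul_xe_mem (by simp) s t,
        fun c hc => ?_⟩
      by_cases h : c = 4
      · rw [h]; exact z
      · refine k c ?_
        revert hc h
        revert c
        decide
    · refine ⟨1, one_mem _, one_mem _, fun c hc => ?_⟩
      rw [glEquiv_one]
      by_cases h : c = 4
      · rw [h]; exact h4 hT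
      · refine hw c ?_
        revert hc h
        revert c
        decide
  obtain ⟨g, hg, hg', k⟩ := step
  obtain ⟨s, t, z, k⟩ := exists_eliminate 1 2 3 {2, 3}ᶜ (by decide) (by decide) (glEquiv g w) k
  rw [← glEquiv_mul] at z
  simp only [← glEquiv_mul] at k
  refine ⟨_, mul_mem (xf_mul_xe_mem h.one_mem_index s t) hg, mul_mem (xf_mul_xe_mem (by simp) s t) hg',
    _, eq_smul_u_of_vanish fun c hc => ?_⟩
  by_cases h : c = 3
  · rw [h]; exact z
  · refine k c ?_
    revert hc h
    revert c
    decide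

end IsSubdiagram

/-! ### Equations and explicit points of the models -/

theorem continuous_biv (g : GL (Fin 27) ℂ) : Continuous (biv g) :=
  LinearMap.continuous_of_finiteDimensional (biv g).toLinearMap

theorem continuous_contract (ξ : Fin 27 → ℂ) : Continuous (contract ξ) :=
  LinearMap.continuous_of_finiteDimensional _

/-- The skew functional of the highest weight of `Λ²` of the spin representation. -/
noncomputable def spinFunctional : (Fin 27 × Fin 27 → ℂ) →ₗ[ℂ] ℂ :=
  functional [(1, 5, 1), (5, 1, -1), (2, 3, -1), (3, 2, 1)]

theorem spinFunctional_f {i : Fin 4} (hi : i ≠ 3) (z : Fin 27 × Fin 27 → ℂ) :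
    spinFunctional (rep.f i *ᵥ z) = 0 := by
  simp only [spinFunctional, functional_apply, List.map_cons, List.map_nil, List.sum_cons,
    List.sum_nil, tensor_f_apply]
  fin_cases i <;> first | exact absurd rfl hi | (simp [eNbr, edges]; try ring)

/-- The subdiagram of type `B₃`. -/
def subB : Fin 3 ↪ Fin 4 := Fin.castSuccEmb

theorem range_subB : Set.range subB = {0, 1, 2} := by
  ext k
  constructor
  · rintro ⟨j, rfl⟩
    fin_cases j <;> simp [subB]
  · rintro (rfl | rfl | rfl)
    exacts [⟨0, rfl⟩, ⟨1, rfl⟩, ⟨2, rfl⟩]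

/-- The representation of `B₃` generated by `v₃` and `y₃`. -/
noncomputable def modB : Submodule ℂ (Fin 27 × Fin 27 → ℂ) :=
  (rep.restrict subB).hwSpan y₃ ⊔ (rep.restrict subB).hwSpan v₃

theorem restrict_e_u (k : Fin 3) : e (subB k) *ᵥ u 1 = 0 ∧
    (e (subB k) *ᵥ u 2 = 0 ∨ e (subB k) *ᵥ u 2 = u 1) := by
  rw [e_u, e_u]
  have h1 : ∀ k, eNbr (subB k) 1 = [] := by decide
  have h2 : ∀ k, eNbr (subB k) 2 = [] ∨ eNbr (subB k) 2 = [1] := by decide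
  rw [h1]
  refine ⟨by simp, ?_⟩
  rcases h2 k with h | h <;> simp [h]

theorem restrict_e_y₃ (k : Fin 3) : (rep.restrict subB).e k *ᵥ y₃ = 0 := by
  change rep.e (subB k) *ᵥ wedge (u 1) (u 2) = 0
  obtain ⟨h1, h2⟩ := restrict_e_u k
  rw [rep_e_wedge, h1, wedge_zero_left, zero_add]
  rcases h2 with h | h <;> rw [h]
  · exact wedge_zero_right _
  · exact wedge_self _

theorem rep_h_wedge_u (k : Fin 4) (a b : Fin 27) :
    rep.h k *ᵥ wedge (u a) (u b) = ((wt k a + wt k b : ℤ) : ℂ) • wedge (u a) (u b) := by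
  ext ⟨c, d⟩
  rw [tensor_h_apply, Pi.smul_apply, smul_eq_mul, wedge_u_apply]
  by_cases ha : c = a <;> by_cases hb : d = b <;> by_cases ha' : c = b <;> by_cases hb' : d = a <;>
    simp_all [add_comm]

theorem restrict_weight_y₃ :
    (rep.restrict subB).IsWeightVector (fun k => wt (subB k) 1 + wt (subB k) 2) y₃ :=
  fun k => rep_h_wedge_u (subB k) 1 2

theorem restrict_weight_v₃ :
    (rep.restrict subB).IsWeightVector (fun k => wt (subB k) 0 + wt (subB k) 1) v₃ :=
  fun k => rep_h_wedge_u (subB k) 0 1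

theorem restrict_e_v₃ (k : Fin 3) : (rep.restrict subB).e k *ᵥ v₃ = 0 :=
  v₃_isFundamentalVector.2.1 (subB k)

theorem biv_mem_modB {g : GL (Fin 27) ℂ} (hg : g ∈ gen {0, 1, 2}) (α γ : ℂ) :
    biv g (α • y₃ + γ • v₃) ∈ modB := by
  rw [← range_subB, ← restrict_group_eq] at hg
  have hg' : tensorGL g ∈ (rep.restrict subB).group :=
    (rep27.restrict subB).mem_tensorSquare_group.2 ⟨g, hg, rfl⟩
  rw [map_add, map_smul, map_smul]
  exact Submodule.add_mem_sup
    (Submodule.smul_mem _ _ (SerreRep.group_mem_hwSpan restrict_weight_y₃ restrict_e_y₃ hg'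
      (SerreRep.self_mem_hwSpan _)))
    (Submodule.smul_mem _ _ (SerreRep.group_mem_hwSpan restrict_weight_v₃ restrict_e_v₃ hg'
      (SerreRep.self_mem_hwSpan _)))

theorem rep_e_mem_modB {z : Fin 27 × Fin 27 → ℂ} (hz : z ∈ modB) (k : Fin 3) :
    rep.e (subB k) *ᵥ z ∈ modB := by
  obtain ⟨a, ha, b, hb, rfl⟩ := Submodule.mem_sup.1 hz
  rw [Matrix.mulVec_add]
  exact Submodule.add_mem_sup (SerreRep.e_mem_hwSpan restrict_weight_y₃ restrict_e_y₃ k ha)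
    (SerreRep.e_mem_hwSpan restrict_weight_v₃ restrict_e_v₃ k hb)

/-- Both generators are killed, as are the ranges of the lowering operators of B₃. The functional
has B₃-weight ω₁, so this equation separates the submodule generated by `y₃` from the V(ω₁) summand
of Λ² of the spin representation. -/
theorem spinFunctional_modB {z : Fin 27 × Fin 27 → ℂ} (hz : z ∈ modB) : spinFunctional z = 0 := by
  obtain ⟨a, ha, b, hb, rfl⟩ := Submodule.mem_sup.1 hz
  have hf : ∀ (i : Fin 3) (w : Fin 27 × Fin 27 → ℂ),
      spinFunctional ((rep.restrict subB).f i *ᵥ w) = 0 := fun i w =>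
    spinFunctional_f (i := subB i) (by revert i; decide) w
  rw [map_add, SerreRep.apply_eq_zero_of_mem_hwSpan spinFunctional ?_ hf ha,
    SerreRep.apply_eq_zero_of_mem_hwSpan spinFunctional ?_ hf hb, add_zero]
  · simp [spinFunctional, functional_apply, v₃, wedge]
  · simp [spinFunctional, functional_apply, y₃, wedge, u]

/-- The bivectors `u 1 ∧ r` in the representation generated by `v₃` and `y₃`. -/
theorem coords_of_wedge_mem_modB {r : Fin 27 → ℂ} (h : wedge (u 1) r ∈ modB) :
    r 5 = 0 ∧ r 6 = 0 ∧ r 8 = 0 ∧ r 10 = 0 := by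
  have hstep : ∀ (k : Fin 3) (r : Fin 27 → ℂ), wedge (u 1) r ∈ modB →
      wedge (u 1) (e (subB k) *ᵥ r) ∈ modB := by
    intro k r hr
    have := rep_e_mem_modB hr k
    rwa [rep_e_wedge, (restrict_e_u k).1, wedge_zero_left, zero_add] at this
  have h5 : ∀ r : Fin 27 → ℂ, wedge (u 1) r ∈ modB → r 5 = 0 := by
    intro r hr
    have := spinFunctional_modB hr
    simp [spinFunctional, functional_apply, wedge, u] at this
    exact this
  have step : ∀ (k : Fin 3) (a b : Fin 27), fNbr (subB k) a = [b] →
      (∀ r, wedge (u 1) r ∈ modB → r a = 0) → ∀ r, wedge (u 1) r ∈ modB → r b = 0 := by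
    intro k a b hab ha r hr
    rw [← e_apply_of_fNbr hab r]
    exact ha _ (hstep k r hr)
  have h6 := step 0 5 6 (by decide) h5
  have h8 := step 1 6 8 (by decide) h6
  have h10 := step 2 8 10 (by decide) h8
  exact ⟨h5 r h, h6 r h, h8 r h, h10 r h⟩

/-- `Z` is the variety generated by the bivectors `α y₃ + γ v₃` and the group of a subdiagram. -/
structure IsModel (Z : Set (Fin 27 × Fin 27 → ℂ)) (I : Set (Fin 4)) (T : Finset (Fin 27)) :
    Prop where
  sub : IsSubdiagram I T
  eq_closure : ∃ α γ : ℂ, Z = closure {z | ∃ g ∈ gen I, ∃ c : ℂ, z = c • biv g (α • y₃ + γ • v₃)}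
  base_mem : ∀ a b : ℂ, a • y₃ + b • v₃ ∈ Z

theorem smul_y₃_add_smul_v₃ (α γ : ℂ) :
    α • y₃ + γ • v₃ = wedge (u 1) (α • u 2 + -γ • u 0) := by
  rw [wedge_add_right, wedge_smul_right, wedge_smul_right, wedge_swap (u 0) (u 1), y₃, v₃_eq]
  module

/-- A representative of the simple reflection. -/
noncomputable def sw (i : Fin 4) : GL (Fin 27) ℂ := xe i 1 * xf i (-1) * xe i 1

theorem sw_mem_gen {I : Set (Fin 4)} {i : Fin 4} (hi : i ∈ I) : sw i ∈ gen I :=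
  mul_mem (mul_mem (xe_mem_gen hi _) (xf_mem_gen hi _)) (xe_mem_gen hi _)

/-- The product of three elementary matrices that represents the Weyl reflection in SL₂; the sign is
that of this representative. -/
theorem sw_u (i : Fin 4) {a b : Fin 27}
    (hab : fNbr i a = [b] ∧ eNbr i b = [a] ∧ eNbr i a = [] ∧ fNbr i b = []) :
    glEquiv (sw i) (u a) = -u b ∧ glEquiv (sw i) (u b) = u a := by
  obtain ⟨h1, h2, h3, h4⟩ := hab
  have ea : ∀ t, glEquiv (xe i t) (u a) = u a := fun t => by
    simp [xe_apply, e_u, h3, -Matrix.mulVec_mulVec]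
  have eb : ∀ t, glEquiv (xe i t) (u b) = u b + t • u a := fun t => by
    simp [xe_apply, e_u, h2, h3, -Matrix.mulVec_mulVec]
  have fa : ∀ t, glEquiv (xf i t) (u a) = u a + t • u b := fun t => by
    simp [xf_apply, f_u, h1, h4, -Matrix.mulVec_mulVec]
  have fb : ∀ t, glEquiv (xf i t) (u b) = u b := fun t => by
    simp [xf_apply, f_u, h4, -Matrix.mulVec_mulVec]
  constructor
  · rw [sw, glEquiv_mul, glEquiv_mul, ea, fa, map_add, map_smul, ea, eb]
    module
  · rw [sw, glEquiv_mul, glEquiv_mul, eb, map_add, map_smul, fa, fb, map_add, map_smul, map_add,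
      map_smul, ea, eb]
    module

theorem sw_u_of_nil (i : Fin 4) {a : Fin 27} (ha : fNbr i a = [] ∧ eNbr i a = []) :
    glEquiv (sw i) (u a) = u a := by
  refine glEquiv_gen_fix (fun j hj => ?_) (sw_mem_gen (Set.mem_singleton i))
  rw [Set.mem_singleton_iff.1 hj, e_u, f_u, ha.1, ha.2]
  simp

/-- The reflection in α₄ turns u₁ ∧ (α u₂ − γ u₀) into u₀ ∧ (α u₂ + γ u₁), whose second factor is a
null vector. -/
theorem smul_y₃_add_smul_v₃_mem_X (α γ : ℂ) : α • y₃ + γ • v₃ ∈ X := by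
  rw [← biv_mem_X_iff (sw_mem_gen (Set.mem_univ 3)), smul_y₃_add_smul_v₃, biv_wedge, map_add,
    map_smul, map_smul, (sw_u 3 (a := 0) (b := 1) (by decide)).2,
    (sw_u 3 (a := 0) (b := 1) (by decide)).1, sw_u_of_nil 3 (a := 2) (by decide)]
  refine wedge_u_zero_mem_X (fun c hc => ?_) ?_
  · have : c ≠ 1 ∧ c ≠ 2 := by
      revert hc
      revert c
      decide
    simp [u, this]
  · simp [quad, u]

namespace IsModel

variable {Z : Set (Fin 27 × Fin 27 → ℂ)} {I : Set (Fin 4)} {T : Finset (Fin 27)}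

theorem smul_mem (h : IsModel Z I T) (c : ℂ) {z : Fin 27 × Fin 27 → ℂ} (hz : z ∈ Z) : c • z ∈ Z := by
  obtain ⟨α, γ, hZ⟩ := h.eq_closure
  rw [hZ] at hz ⊢
  refine map_mem_closure (continuous_const_smul c) hz ?_
  rintro _ ⟨g, hg, c', rfl⟩
  exact ⟨g, hg, c * c', by rw [smul_smul]⟩

theorem biv_mem (h : IsModel Z I T) {g : GL (Fin 27) ℂ} (hg : g ∈ gen I) {z : Fin 27 × Fin 27 → ℂ} (hz : z ∈ Z) :
    biv g z ∈ Z := by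
  obtain ⟨α, γ, hZ⟩ := h.eq_closure
  rw [hZ] at hz ⊢
  refine map_mem_closure (continuous_biv g) hz ?_
  rintro _ ⟨g', hg', c', rfl⟩
  exact ⟨g * g', mul_mem hg hg', c', by rw [map_smul, biv_mul]⟩

/-- The closed condition is checked for all α and γ, so the coefficients of the model never matter.
-/
theorem subset_of_isClosed (h : IsModel Z I T) {C : Set (Fin 27 × Fin 27 → ℂ)} (hC : IsClosed C)
    (hmem : ∀ g ∈ gen I, ∀ c α γ : ℂ, c • biv g (α • y₃ + γ • v₃) ∈ C) : Z ⊆ C := by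
  obtain ⟨α, γ, hZ⟩ := h.eq_closure
  rw [hZ]
  refine closure_minimal ?_ hC
  rintro _ ⟨g, hg, c, rfl⟩
  exact hmem g hg c α γ

theorem isPluecker (h : IsModel Z I T) {z : Fin 27 × Fin 27 → ℂ} (hz : z ∈ Z) : IsPluecker z := by
  refine h.subset_of_isClosed isClosed_isPluecker (fun g _ c α γ => ?_) hz
  rw [smul_y₃_add_smul_v₃]
  exact ((isPluecker_wedge _ _).biv g).smul c

theorem vanish (h : IsModel Z I T) {z : Fin 27 × Fin 27 → ℂ} (hz : z ∈ Z) {a b : Fin 27} (hb : b ∈ (insert 0 T)ᶜ) :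
    z (a, b) = 0 := by
  refine h.subset_of_isClosed (C := {z | z (a, b) = 0})
    (isClosed_eq (by fun_prop) continuous_const) (fun g hg c α γ => ?_) hz
  have hT := fun i (hi : i = 1 ∨ i = 2 ∨ i = 3) => h.sub.mem_of_le hi
  have hu : ∀ i, i ∈ insert 0 T → ∀ c ∈ (insert 0 T)ᶜ, u i c = 0 := by
    intro i hi c hc
    have : c ≠ i := by
      rintro rfl
      exact Finset.mem_compl.1 hc hi
    simp [u, this]
  have u0 := hu 0 (Finset.mem_insert_self _ _)
  have u1 := hu 1 (Finset.mem_insert_of_mem (hT 1 (by decide)))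
  have u2 := hu 2 (Finset.mem_insert_of_mem (hT 2 (by decide)))
  have e1 := h.sub.glEquiv_vanish hg _ u1 b hb
  have e2 := h.sub.glEquiv_vanish hg (α • u 2 + -γ • u 0)
    (fun c hc => by simp [u0 c hc, u2 c hc]) b hb
  rw [smul_y₃_add_smul_v₃, biv_wedge]
  change c * (_ - _) = (0 : ℂ)
  rw [e1, e2]
  ring

/-- A vector in the plane of an orbit point is g applied to a combination of u₀, u₁, u₂; `quad` is
L-invariant and vanishes on those. Contraction is continuous, so this passes to the closure. -/
theorem quad_contract (h : IsModel Z I T) {z : Fin 27 × Fin 27 → ℂ} (hz : z ∈ Z) (ξ : Fin 27 → ℂ) :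
    quad (contract ξ z) = 0 := by
  refine h.subset_of_isClosed (C := {z | quad (contract ξ z) = 0})
    (isClosed_eq ?_ continuous_const) (fun g hg c α γ => ?_) hz
  · have := continuous_contract ξ
    have h1 : ∀ a, Continuous fun z => contract ξ z a := fun a => (continuous_apply a).comp this
    have := h1 1
    have := h1 2
    have := h1 3
    have := h1 4
    have := h1 5
    have := h1 6
    have := h1 8
    have := h1 10
    unfold quad
    fun_prop
  · rw [smul_y₃_add_smul_v₃, biv_wedge, Set.mem_ofPred_eq, map_smul, contract_wedge]
    set s := ∑ a, ξ a * glEquiv g (u 1) a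
    set t := ∑ a, ξ a * glEquiv g (α • u 2 + -γ • u 0) a
    have : c • (s • glEquiv g (α • u 2 + -γ • u 0) - t • glEquiv g (u 1)) =
        glEquiv g (c • (s • (α • u 2 + -γ • u 0) - t • u 1)) := by
      simp only [map_smul, map_sub]
    rw [this, quad_gen (h.sub.gen_le hg)]
    simp [quad, u]

theorem mem_modB (h : IsModel Z I T) {z : Fin 27 × Fin 27 → ℂ} (hz : z ∈ Z) : z ∈ modB := by
  refine h.subset_of_isClosed (C := (modB : Set _)) modB.closed_of_finiteDimensional
    (fun g hg c α γ => ?_) hz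
  exact modB.smul_mem c (biv_mem_modB (h.sub.gen_le hg) α γ)

/-- The bivectors divisible by `u 1` in `Z`. -/
theorem coords_of_wedge_mem (h : IsModel Z I T) {r : Fin 27 → ℂ} (hr : wedge (u 1) r ∈ Z) :
    (∀ c, c ∉ ({0, 1, 2, 3, 4} : Finset (Fin 27)) → r c = 0) ∧ (4 ∉ T → r 4 = 0) := by
  obtain ⟨h5, h6, h8, h10⟩ := coords_of_wedge_mem_modB (h.mem_modB hr)
  have hv : ∀ b, b ≠ 1 → b ∈ (insert 0 T)ᶜ → r b = 0 := by
    intro b hb1 hb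
    have := h.vanish hr (a := 1) hb
    simpa [wedge, u, hb1] using this
  constructor
  · intro c hc
    by_cases hcT : c ∈ insert 0 spin
    · have : ∀ c, c ∉ ({0, 1, 2, 3, 4} : Finset (Fin 27)) → c ∈ insert 0 spin →
          c = 5 ∨ c = 6 ∨ c = 8 ∨ c = 10 := by decide
      rcases this c hc hcT with rfl | rfl | rfl | rfl <;> assumption
    · refine hv c ?_ (Finset.mem_compl.2 fun h' => hcT ?_)
      · rintro rfl
        exact hc (by decide)
      · exact Finset.insert_subset_insert 0 h.sub.subset_spin h'
  · intro h4
    exact hv 4 (by decide) (by simpa using h4)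

/-- Conversely, the bivectors of this shape lie in `Z` and in `X`. -/
theorem wedge_mem (h : IsModel Z I T) {r : Fin 27 → ℂ} (hr : ∀ c, c ∉ ({0, 1, 2, 3, 4} : Finset (Fin 27)) → r c = 0)
    (h4 : 4 ∉ T → r 4 = 0) : wedge (u 1) r ∈ Z ∧ wedge (u 1) r ∈ X := by
  -- The u₁-part of r disappears in u₁ ∧ r and the u₀-part contributes the multiple of `v₃`, so only
  -- the coordinates 2, 3, 4 need to be moved.
  set w : Fin 27 → ℂ := r - r 0 • u 0 - r 1 • u 1 with hw
  obtain ⟨g, hg, hg', c, hc⟩ := h.sub.exists_gen_smul_u_two (w := w)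
    (by
      intro a ha
      by_cases h0 : a = 0
      · simp [hw, h0, u]
      by_cases h1 : a = 1
      · simp [hw, h1, u]
      have : a ∉ ({0, 1, 2, 3, 4} : Finset (Fin 27)) := by simpa [h0, h1] using ha
      simp [hw, u, h0, h1, hr a this])
    (by
      intro hT
      simp [hw, u, h4 hT])
  have e1 : biv g (wedge (u 1) r) = c • y₃ + -r 0 • v₃ := by
    have : r = w + r 0 • u 0 + r 1 • u 1 := by rw [hw]; module
    rw [smul_y₃_add_smul_v₃, biv_wedge, glEquiv_u_one hg', this, map_add, map_add, hc, map_smul,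
      map_smul, glEquiv_u_one hg', glEquiv_u_zero (h.sub.gen_le hg), wedge_add_right _ _ (_ • u 1),
      wedge_smul_right _ (u 1), wedge_self, smul_zero, add_zero, neg_neg]
    simp [hw, u]
  constructor
  · have := h.biv_mem (inv_mem hg) (h.base_mem c (-r 0))
    rwa [← e1, biv_inv_apply] at this
  · rw [← biv_mem_X_iff (gen_univ_mono _ hg), e1]
    exact smul_y₃_add_smul_v₃_mem_X _ _

end IsModel

end F4

namespace F4

/-! ### Automorphisms of the pair `(X, Z)` -/

/-- The linear automorphism `Φ` preserves `X` and `Z`. -/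
def Preserves (Z : Set (Fin 27 × Fin 27 → ℂ))
    (Φ : (Fin 27 × Fin 27 → ℂ) ≃ₗ[ℂ] (Fin 27 × Fin 27 → ℂ)) : Prop :=
  Φ '' X = X ∧ Φ '' Z = Z

theorem image_eq_of_mem {V : Type*} [AddCommGroup V] [Module ℂ V] {Φ : V ≃ₗ[ℂ] V} {S : Set V}
    (h : ∀ z ∈ S, Φ z ∈ S) (h' : ∀ z ∈ S, Φ.symm z ∈ S) : Φ '' S = S := by
  refine Set.Subset.antisymm ?_ fun z hz => ⟨_, h' z hz, Φ.apply_symm_apply z⟩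
  rintro _ ⟨z, hz, rfl⟩
  exact h z hz

theorem image_symm_eq {V : Type*} [AddCommGroup V] [Module ℂ V] {Φ : V ≃ₗ[ℂ] V} {S S' : Set V}
    (h : Φ '' S = S') : Φ.symm '' S' = S := by
  rw [← h, Set.image_image]
  simp

theorem biv_symm (g : GL (Fin 27) ℂ) (z : Fin 27 × Fin 27 → ℂ) : (biv g).symm z = biv g⁻¹ z := by
  rw [LinearEquiv.symm_apply_eq]
  have := biv_inv_apply g⁻¹ z
  rw [inv_inv] at this
  exact this.symm

theorem Preserves.trans {Z : Set (Fin 27 × Fin 27 → ℂ)}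
    {Φ Ψ : (Fin 27 × Fin 27 → ℂ) ≃ₗ[ℂ] (Fin 27 × Fin 27 → ℂ)} (h : Preserves Z Φ)
    (h' : Preserves Z Ψ) : Preserves Z (Φ.trans Ψ) := by
  have : ⇑(Φ.trans Ψ) = Ψ ∘ Φ := rfl
  constructor
  · rw [this, Set.image_comp, h.1, h'.1]
  · rw [this, Set.image_comp, h.2, h'.2]

theorem biv_image_X {g : GL (Fin 27) ℂ} (hg : g ∈ gen Set.univ) : biv g '' X = X :=
  image_eq_of_mem (fun _ hz => biv_mem_X hg hz) fun z hz => by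
    rw [biv_symm]
    exact biv_mem_X (inv_mem hg) hz

theorem preserves_biv {Z : Set (Fin 27 × Fin 27 → ℂ)} {g : GL (Fin 27) ℂ}
    (hg : g ∈ gen Set.univ) (h : ∀ z ∈ Z, biv g z ∈ Z) (h' : ∀ z ∈ Z, biv g⁻¹ z ∈ Z) :
    Preserves Z (biv g) :=
  ⟨biv_image_X hg, image_eq_of_mem h fun z hz => by rw [biv_symm]; exact h' z hz⟩

theorem IsModel.preserves_biv {Z : Set (Fin 27 × Fin 27 → ℂ)} {I : Set (Fin 4)}
    {T : Finset (Fin 27)} (h : IsModel Z I T) {g : GL (Fin 27) ℂ} (hg : g ∈ gen I) :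
    Preserves Z (biv g) :=
  F4.preserves_biv (gen_univ_mono _ hg) (fun _ => h.biv_mem hg) fun _ => h.biv_mem (inv_mem hg)

theorem IsModel.preserves_smul {Z : Set (Fin 27 × Fin 27 → ℂ)} {I : Set (Fin 4)}
    {T : Finset (Fin 27)} (h : IsModel Z I T) {c : ℂ} (hc : c ≠ 0) :
    Preserves Z (LinearEquiv.smulOfNeZero ℂ _ c hc) :=
  ⟨image_eq_of_mem (fun _ hz => smul_mem_X c hz) fun _ hz => smul_mem_X c⁻¹ hz,
    image_eq_of_mem (fun _ hz => h.smul_mem c hz) fun _ hz => h.smul_mem c⁻¹ hz⟩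

/-! ### General points -/

section GeneralPoint

variable {Z : Set (Fin 27 × Fin 27 → ℂ)} {I : Set (Fin 4)} {T : Finset (Fin 27)}
  {x : Fin 27 × Fin 27 → ℂ}

theorem preserves_xe (hx : IsOrbitClosure rep.borel x Z) (k : Fin 4) (t : ℂ) :
    Preserves Z (biv (xe k t)) := by
  have h : ∀ t, ∀ z ∈ Z, biv (xe k t) z ∈ Z := by
    intro t z hz
    have := hx.mulVec_mem (rep.exp_e_mem_borel k t) z hz
    have e1 : tensorGL (xe k t) = expGL (t • rep.e k) := by
      rw [xe, tensorGL_expGL, SerreRep.tensorAct_smul]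
      rfl
    rwa [← e1] at this
  refine preserves_biv (xe_mem_gen (Set.mem_univ k) t) (h t) ?_
  rw [xe_inv]
  exact h (-t)

/-- A general point is not divisible by `u 0`. -/
theorem IsModel.ne_wedge_u_zero (h : IsModel Z I T) (hx : IsOrbitClosure rep.borel x Z)
    (p : Fin 27 → ℂ) : x ≠ wedge p (u 0) := by
  intro hp
  -- The tensors supported on row and column 0. The raising operators never produce an entry outside
  -- them, since coordinate 0 is no lower neighbour, so they form a Borel-stable closed subspace. It
  -- would contain `Z`, but not `y₃`.
  let W : Submodule ℂ (Fin 27 × Fin 27 → ℂ) :=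
    { carrier := {z | ∀ a b, a ≠ 0 → b ≠ 0 → z (a, b) = 0}
      add_mem' := by
        intro z z' h h' a b ha hb
        rw [Pi.add_apply, h a b ha hb, h' a b ha hb, add_zero]
      zero_mem' := fun a b _ _ => rfl
      smul_mem' := by
        intro c z h a b ha hb
        rw [Pi.smul_apply, h a b ha hb, smul_zero] }
  have hN : ∀ k a, 0 ∉ fNbr k a := by decide +kernel
  have hne : ∀ k a, ∀ b ∈ fNbr k a, b ≠ 0 := by
    rintro k a b hb rfl
    exact hN k a hb
  have hxW : x ∈ W := by
    intro a b ha hb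
    simp [hp, wedge, u, ha, hb]
  have hZW : Z ⊆ W := by
    refine hx.subset W.closed_of_finiteDimensional fun g hg c => W.smul_mem c ?_
    refine SerreRep.borel_mulVec_mem (fun k z hz a b ha hb => ?_) (fun k z hz a b ha hb => ?_) hg x
      hxW
    · rw [tensor_e_apply, sum_map_eq_zero, sum_map_eq_zero, add_zero]
      · exact fun d hd => hz _ _ ha (hne k b d hd)
      · exact fun d hd => hz _ _ (hne k a d hd) hb
    · rw [tensor_h_apply, hz a b ha hb, mul_zero]
  have := hZW (h.base_mem 1 0) 1 2 (by decide) (by decide)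
  simp [y₃, wedge, u] at this

/-- The group L brings a general point to d y₃ − r₀ v₃. To remove `v₃` one must leave L: the root
group of α₄ lies in the Borel subgroup, which preserves `Z` because `Z` is the closure of a Borel
orbit. -/
theorem IsModel.exists_map_y₃ (h : IsModel Z I T) (hx : IsOrbitClosure rep.borel x Z) :
    ∃ Φ, Preserves Z Φ ∧ Φ x = y₃ := by
  have hxZ := hx.self_mem
  have hP := h.isPluecker hxZ
  -- A plane meets the hyperplane of vectors with zero coordinate 0. If row 0 of x is nonzero it is
  -- such a vector by skew-symmetry; otherwise any nonzero row is.
  obtain ⟨ξ, hξ, hξ0⟩ : ∃ ξ, contract ξ x ≠ 0 ∧ contract ξ x 0 = 0 := by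
    have hu : ∀ a b, contract (u a) x b = x (a, b) := by
      intro a b
      simp [contract_apply, u, Pi.single_apply]
    by_cases h0 : contract (u 0) x = 0
    · obtain ⟨⟨a, b⟩, hab⟩ := Function.ne_iff.1 hx.1
      refine ⟨u a, fun h => hab ?_, ?_⟩
      · rw [← hu, h]
        rfl
      · have := congrFun h0 a
        rw [hu] at this
        rw [hu, hP.1, this, Pi.zero_apply, neg_zero]
    · refine ⟨u 0, h0, ?_⟩
      rw [hu]
      have := hP.1 0 0
      linear_combination this / 2
  obtain ⟨p, q, hpq⟩ := hP.exists_wedge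
  obtain ⟨q', hq'⟩ : ∃ q', x = wedge (contract ξ x) q' := by
    rw [hpq] at hξ ⊢
    exact exists_wedge_eq_of_contract hξ
  have hsupp : ∀ c, c ∉ T → contract ξ x c = 0 := by
    intro c hc
    by_cases hc0 : c = 0
    · rw [hc0, hξ0]
    · rw [contract_apply]
      exact Finset.sum_eq_zero fun a _ => by
        rw [h.vanish hxZ (by simp [hc, hc0]), mul_zero]
  obtain ⟨g, hg, c, hc⟩ := h.sub.exists_gen_smul_u_one hsupp (h.quad_contract hxZ ξ)
  have hx1 : biv g x = wedge (u 1) (c • glEquiv g q') := by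
    rw [hq', biv_wedge, hc, wedge_smul_left, wedge_smul_right]
  generalize c • glEquiv g q' = r at hx1
  have hrZ : wedge (u 1) r ∈ Z := hx1 ▸ h.biv_mem hg hxZ
  obtain ⟨hr, hr4⟩ := h.coords_of_wedge_mem hrZ
  set w : Fin 27 → ℂ := r - r 0 • u 0 - r 1 • u 1 with hw
  obtain ⟨g', hg', hg'', d, hd⟩ := h.sub.exists_gen_smul_u_two (w := w)
    (by
      intro a ha
      by_cases h0 : a = 0
      · simp [hw, h0, u]
      by_cases h1 : a = 1
      · simp [hw, h1, u]
      have : a ∉ ({0, 1, 2, 3, 4} : Finset (Fin 27)) := by simpa [h0, h1] using ha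
      simp [hw, u, h0, h1, hr a this])
    (by
      intro hT
      simp [hw, u, hr4 hT])
  have e1 : biv g' (wedge (u 1) r) = d • y₃ + -r 0 • v₃ := by
    have : r = w + r 0 • u 0 + r 1 • u 1 := by rw [hw]; module
    rw [smul_y₃_add_smul_v₃, biv_wedge, glEquiv_u_one hg'', this, map_add, map_add, hd, map_smul,
      map_smul, glEquiv_u_one hg'', glEquiv_u_zero (h.sub.gen_le hg'), wedge_add_right _ _ (_ • u 1),
      wedge_smul_right _ (u 1), wedge_self, smul_zero, add_zero, neg_neg]
    simp [hw, u]
  -- With d = 0 the point would be divisible by u₀, since L fixes u₀.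
  have hd0 : d ≠ 0 := by
    rintro rfl
    refine h.ne_wedge_u_zero hx (r 0 • glEquiv (g' * g)⁻¹ (u 1)) ?_
    have e2 : biv (g' * g) x = r 0 • wedge (u 1) (u 0) := by
      rw [biv_mul, hx1, e1, zero_smul, zero_add, v₃_eq, wedge_swap (u 0) (u 1)]
      module
    have e3 := congrArg (biv (g' * g)⁻¹) e2
    rw [biv_inv_apply, map_smul, biv_wedge,
      glEquiv_u_zero (h.sub.gen_le (inv_mem (mul_mem hg' hg)))] at e3
    rw [e3, wedge_smul_left]
  -- Applied directly, the root group of α₄ would alter `y₃` by u₀ ∧ u₂, not by `v₃`. The reflection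
  -- in α₃ first gives −u₂ ∧ (d u₁ + r₀ u₀), in which u₁ ↦ u₁ − (r₀/d) u₀ removes u₀.
  refine ⟨((((biv g).trans (biv g')).trans (biv (sw 2))).trans (biv (xe 3 (-(r 0) / d)))).trans
    (LinearEquiv.smulOfNeZero ℂ _ d⁻¹ (inv_ne_zero hd0)),
    ((((h.preserves_biv hg).trans (h.preserves_biv hg')).trans
      (h.preserves_biv (sw_mem_gen h.sub.two_mem_index))).trans
        (preserves_xe hx 3 _)).trans (h.preserves_smul _), ?_⟩
  change d⁻¹ • biv (xe 3 (-(r 0) / d)) (biv (sw 2) (biv g' (biv g x))) = y₃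
  have x0 : ∀ t, glEquiv (xe 3 t) (u 0) = u 0 := fun t => by
    simp [xe_apply, e_u, eNbr, edges, -Matrix.mulVec_mulVec]
  have x1 : ∀ t, glEquiv (xe 3 t) (u 1) = u 1 + t • u 0 := fun t => by
    simp [xe_apply, e_u, eNbr, edges, -Matrix.mulVec_mulVec]
  have x2 : ∀ t, glEquiv (xe 3 t) (u 2) = u 2 := fun t => by
    simp [xe_apply, e_u, eNbr, edges, -Matrix.mulVec_mulVec]
  have hsw := sw_u 2 (a := 1) (b := 2) (by decide)
  rw [hx1, e1, smul_y₃_add_smul_v₃, biv_wedge, map_add, map_smul, map_smul, hsw.1, hsw.2,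
    sw_u_of_nil 2 (a := 0) (by decide), biv_wedge, map_neg, map_add, map_smul, map_smul, x0, x1, x2]
  have e4 : d • (u 1 + (-(r 0) / d) • u 0) + - -r 0 • u 0 = d • u 1 := by
    rw [smul_add, smul_smul, mul_div_cancel₀ _ hd0]
    module
  rw [e4, wedge_smul_right, smul_smul, inv_mul_cancel₀ hd0, one_smul, ← neg_one_smul ℂ,
    wedge_smul_left, wedge_swap (u 1) (u 2), y₃]
  module

end GeneralPoint

/-! ### The variety of minimal rational tangents of `Z` at `y₃` -/

theorem biv_y₃ {g : GL (Fin 27) ℂ} (hg : g ∈ gen {2}) : biv g y₃ = y₃ := by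
  induction hg using gen_induction with
  | he i hi t =>
    rw [Set.mem_singleton_iff] at hi
    subst hi
    have e1 : glEquiv (xe 2 t) (u 1) = u 1 := by
      simp [xe_apply, e_u, eNbr, edges, -Matrix.mulVec_mulVec]
    have e2 : glEquiv (xe 2 t) (u 2) = u 2 + t • u 1 := by
      simp [xe_apply, e_u, eNbr, edges, -Matrix.mulVec_mulVec]
    rw [y₃, biv_wedge, e1, e2, wedge_add_right, wedge_smul_right, wedge_self, smul_zero, add_zero]
  | hf i hi t =>
    rw [Set.mem_singleton_iff] at hi
    subst hi
    have e1 : glEquiv (xf 2 t) (u 1) = u 1 + t • u 2 := by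
      simp [xf_apply, f_u, fNbr, edges, -Matrix.mulVec_mulVec]
    have e2 : glEquiv (xf 2 t) (u 2) = u 2 := by
      simp [xf_apply, f_u, fNbr, edges, -Matrix.mulVec_mulVec]
    rw [y₃, biv_wedge, e1, e2, wedge_add_left, wedge_smul_left, wedge_self, smul_zero, add_zero]
  | one => exact biv_one _
  | mul g g' _ _ h h' => rw [biv_mul, h', h]

/-- The bivectors spanning a line of the Grassmannian together with `y₃`. -/
theorem exists_wedge_of_line_y₃ {w : Fin 27 × Fin 27 → ℂ} (hw : IsPluecker w)
    (h₁ : IsPluecker (y₃ + w)) (h₂ : IsPluecker (-y₃ + w)) :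
    ∃ (s t c : ℂ) (r : Fin 27 → ℂ), w = c • y₃ + wedge (s • u 1 + t • u 2) r := by
  by_cases hk : ∃ k, k ≠ 1 ∧ k ≠ 2 ∧ w (1, k) ≠ 0
  · obtain ⟨k, hk1, hk2, hk⟩ := hk
    obtain ⟨t, c, r, -, -, h⟩ := exists_wedge_of_line (by decide) hw h₁ hk hk1 hk2
    exact ⟨1, t, c, r, by rw [one_smul, y₃, ← h]⟩
  by_cases hk' : ∃ k, k ≠ 1 ∧ k ≠ 2 ∧ w (2, k) ≠ 0
  · obtain ⟨k, hk1, hk2, hk⟩ := hk'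
    -- Exchanging the roles of u₁ and u₂ replaces `y₃` by its negative, hence the need for `h₂`.
    obtain ⟨t, c, r, -, -, h⟩ := exists_wedge_of_line (i := 2) (j := 1) (by decide) hw
      (by rwa [wedge_swap (u 1) (u 2)]) hk hk2 hk1
    refine ⟨t, 1, -c, r, ?_⟩
    rw [one_smul, y₃, add_comm (t • u 1)]
    rw [wedge_swap (u 1) (u 2)] at h
    rw [h]
    module
  push Not at hk hk'
  refine ⟨0, 0, w (1, 2), 0, ?_⟩
  have hdiag : ∀ a, w (a, a) = 0 := by
    intro a
    have := hw.1 a a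
    linear_combination this / 2
  have main : ∀ a b, a = 1 ∨ a = 2 → w (a, b) = w (1, 2) * y₃ (a, b) := by
    intro a b ha
    rw [y₃, wedge_u_apply]
    rcases ha with rfl | rfl
    · by_cases b1 : b = 1
      · simp [b1, hdiag]
      by_cases b2 : b = 2
      · simp [b2]
      · simp [b2, hk b b1 b2]
    · by_cases b1 : b = 1
      · simp [b1, hw.1 2 1]
      by_cases b2 : b = 2
      · simp [b2, hdiag]
      · simp [b1, hk' b b1 b2]
  rw [wedge_zero_right, add_zero]
  ext ⟨a, b⟩
  rw [Pi.smul_apply, smul_eq_mul]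
  by_cases ha : a = 1 ∨ a = 2
  · exact main a b ha
  by_cases hb : b = 1 ∨ b = 2
  · rw [hw.1, main b a hb, y₃, (isPluecker_wedge (u 1) (u 2)).1 a b]
    ring
  push Not at ha hb
  rw [(isPluecker_line (by decide) hw h₁ ha.1 ha.2 hb.1 hb.2).1, y₃, wedge_u_apply]
  simp [ha, hb]

theorem eq_sum_of_vanish {r : Fin 27 → ℂ}
    (hr : ∀ c, c ∉ ({0, 1, 2, 3, 4} : Finset (Fin 27)) → r c = 0) :
    r = r 0 • u 0 + r 1 • u 1 + r 2 • u 2 + r 3 • u 3 + r 4 • u 4 := by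
  ext c
  by_cases hc : c ∈ ({0, 1, 2, 3, 4} : Finset (Fin 27))
  · simp only [Finset.mem_insert, Finset.mem_singleton] at hc
    rcases hc with rfl | rfl | rfl | rfl | rfl <;> simp [u]
  · rw [hr c hc]
    simp only [Finset.mem_insert, Finset.mem_singleton, not_or] at hc
    simp [u, hc]

/-- The directions of the lines through `y₃` in `Z`, up to rotation. -/
theorem IsModel.exists_of_mem_vmrtCone {Z : Set (Fin 27 × Fin 27 → ℂ)} {I : Set (Fin 4)}
    {T : Finset (Fin 27)} (h : IsModel Z I T) {β : (Fin 27 × Fin 27 → ℂ) ⧸ (ℂ ∙ y₃ : Submodule ℂ _)}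
    (hβ : β ∈ vmrtCone Z y₃) : ∃ g ∈ gen {2}, ∃ r₀ r₃ r₄ : ℂ, (4 ∉ T → r₄ = 0) ∧
      β = Submodule.Quotient.mk (biv g (wedge (u 1) (r₀ • u 0 + r₃ • u 3 + r₄ • u 4))) := by
  obtain ⟨h0, w, rfl, hw⟩ := hβ
  obtain ⟨s, t, c, r, rfl⟩ := exists_wedge_of_line_y₃ (by simpa using h.isPluecker (hw 0 1))
    (by simpa using h.isPluecker (hw 1 1)) (by simpa using h.isPluecker (hw (-1) 1))
  -- The SL₂ of α₃ fixes `y₃` and acts on its plane, so the common vector of the pencil can be moved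
  -- to a multiple of u₁.
  obtain ⟨s', t', z, k⟩ := exists_eliminate 2 1 2 {1, 2}ᶜ (by decide) (by decide)
    (s • u 1 + t • u 2) (by
      intro a ha
      simp only [Finset.mem_compl, Finset.mem_insert, Finset.mem_singleton, not_or] at ha
      simp [u, ha])
  have hg : xf 2 t' * xe 2 s' ∈ gen {2} := xf_mul_xe_mem (Set.mem_singleton 2) s' t'
  generalize xf 2 t' * xe 2 s' = g at hg z k
  have hp : glEquiv g (s • u 1 + t • u 2) = glEquiv g (s • u 1 + t • u 2) 1 • u 1 := by
    refine eq_smul_u_of_vanish fun a ha => ?_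
    by_cases h2 : a = 2
    · rw [h2]; exact z
    · exact k a (by simp [ha, h2])
  have e1 : biv g (wedge (s • u 1 + t • u 2) r) =
      wedge (u 1) (glEquiv g (s • u 1 + t • u 2) 1 • glEquiv g r) := by
    rw [biv_wedge, wedge_smul_right, ← wedge_smul_left, ← hp]
  generalize glEquiv g (s • u 1 + t • u 2) 1 • glEquiv g r = r' at e1
  have hZ : wedge (u 1) r' ∈ Z := by
    rw [← e1]
    refine h.biv_mem (h.sub.gen_two_le hg) ?_
    have := hw (-c) 1
    rwa [one_smul, neg_smul, neg_add_cancel_left] at this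
  obtain ⟨hr, hr4⟩ := h.coords_of_wedge_mem hZ
  refine ⟨g⁻¹, inv_mem hg, r' 0, r' 3, r' 4, hr4, ?_⟩
  have e2 : wedge (u 1) r' = r' 2 • y₃ + wedge (u 1) (r' 0 • u 0 + r' 3 • u 3 + r' 4 • u 4) := by
    conv_lhs => rw [eq_sum_of_vanish hr]
    simp only [wedge_add_right, wedge_smul_right, wedge_self, y₃]
    module
  have e3 := congrArg (biv g⁻¹) (e1.trans e2)
  rw [biv_inv_apply, map_add, map_smul, biv_y₃ (inv_mem hg)] at e3
  rw [e3, ← add_assoc, ← add_smul, Submodule.Quotient.eq, add_sub_cancel_right]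
  exact Submodule.smul_mem _ _ (Submodule.mem_span_singleton_self _)

theorem vanish_line (a b r₀ r₃ r₄ : ℂ) : ∀ c, c ∉ ({0, 1, 2, 3, 4} : Finset (Fin 27)) →
    (a • u 2 + b • (r₀ • u 0 + r₃ • u 3 + r₄ • u 4)) c = 0 := by
  intro c hc
  simp only [Finset.mem_insert, Finset.mem_singleton, not_or] at hc
  simp [u, hc]

theorem smul_y₃_add_wedge (a b : ℂ) (r : Fin 27 → ℂ) :
    a • y₃ + b • wedge (u 1) r = wedge (u 1) (a • u 2 + b • r) := by
  rw [wedge_add_right, wedge_smul_right, wedge_smul_right, y₃]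

/-- Only the explicit lines are compared: `wedge_mem` puts their points in `X` as well as in `Z`, so
neither closedness of `X` nor an inclusion of `Z` in `X` is required. -/
theorem IsModel.vmrtCone_subset {Z : Set (Fin 27 × Fin 27 → ℂ)} {I : Set (Fin 4)}
    {T : Finset (Fin 27)} (h : IsModel Z I T) : vmrtCone Z y₃ ⊆ vmrtCone X y₃ := by
  intro β hβ
  obtain ⟨g, hg, r₀, r₃, r₄, h4, rfl⟩ := h.exists_of_mem_vmrtCone hβ
  refine ⟨hβ.1, _, rfl, fun a b => ?_⟩
  have := biv_mem_X (gen_univ_mono _ hg) (h.wedge_mem (vanish_line a b r₀ r₃ r₄)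
    (fun hT => by simp [u, h4 hT])).2
  rwa [← smul_y₃_add_wedge, map_add, map_smul, map_smul, biv_y₃ hg] at this

end F4

namespace F4

/-! ### Transport to `v₃` -/

/-- A group element carrying `y₃` to `v₃`. -/
noncomputable def carry : GL (Fin 27) ℂ := sw 2 * sw 3

theorem carry_mem : carry ∈ gen Set.univ :=
  mul_mem (sw_mem_gen (Set.mem_univ 2)) (sw_mem_gen (Set.mem_univ 3))

theorem carry_u : glEquiv carry (u 0) = u 2 ∧ glEquiv carry (u 1) = u 0 ∧
    glEquiv carry (u 2) = u 1 ∧ glEquiv carry (u 3) = -u 5 ∧ glEquiv carry (u 4) = -u 6 ∧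
    glEquiv carry (u 5) = -u 7 ∧ glEquiv carry (u 6) = -u 9 := by
  have h01 := sw_u 3 (a := 0) (b := 1) (by decide)
  have h57 := sw_u 3 (a := 5) (b := 7) (by decide)
  have h69 := sw_u 3 (a := 6) (b := 9) (by decide)
  have h12 := sw_u 2 (a := 1) (b := 2) (by decide)
  have h35 := sw_u 2 (a := 3) (b := 5) (by decide)
  have h46 := sw_u 2 (a := 4) (b := 6) (by decide)
  have n2 := sw_u_of_nil 3 (a := 2) (by decide)
  have n3 := sw_u_of_nil 3 (a := 3) (by decide)
  have n4 := sw_u_of_nil 3 (a := 4) (by decide)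
  have m0 := sw_u_of_nil 2 (a := 0) (by decide)
  have m7 := sw_u_of_nil 2 (a := 7) (by decide)
  have m9 := sw_u_of_nil 2 (a := 9) (by decide)
  simp only [carry, glEquiv_mul, h01, h57, h69, n2, n3, n4, map_neg, h12, h35, h46, m0, m7, m9,
    neg_neg, and_self]

theorem carry_y₃ : biv carry y₃ = v₃ := by
  rw [y₃, biv_wedge, carry_u.2.1, carry_u.2.2.1, v₃_eq]

/-- The reflection `carry` conjugates the root subgroup of `-α₃` to that of `-α₄`. -/
theorem carry_xf (τ : ℂ) {v : Fin 27 → ℂ}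
    (hv : ∀ c, c ∉ ({0, 1, 2, 3, 4} : Finset (Fin 27)) → v c = 0) :
    glEquiv (xf 3 τ) (glEquiv carry v) = glEquiv carry (glEquiv (xf 2 τ) v) := by
  obtain ⟨c0, c1, c2, c3, c4, c5, c6⟩ := carry_u
  have fa : ∀ (i : Fin 4) (a b : Fin 27), fNbr i a = [b] → fNbr i b = [] →
      glEquiv (xf i τ) (u a) = u a + τ • u b := fun i a b h h' => by
    simp [xf_apply, f_u, h, h', -Matrix.mulVec_mulVec]
  have fn : ∀ (i : Fin 4) (a : Fin 27), fNbr i a = [] → glEquiv (xf i τ) (u a) = u a :=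
    fun i a h => by simp [xf_apply, f_u, h, -Matrix.mulVec_mulVec]
  rw [eq_sum_of_vanish hv]
  simp only [map_add, map_smul, map_neg, c0, c1, c2, c3, c4, c5, c6,
    fa 3 0 1 (by decide) (by decide), fn 3 1 (by decide), fn 3 2 (by decide),
    fa 3 5 7 (by decide) (by decide), fa 3 6 9 (by decide) (by decide), fn 2 0 (by decide),
    fa 2 1 2 (by decide) (by decide), fn 2 2 (by decide), fa 2 3 5 (by decide) (by decide),
    fa 2 4 6 (by decide) (by decide), smul_neg]
  module

theorem carry_wedge (r₀ r₃ r₄ : ℂ) :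
    biv carry (wedge (u 1) (r₀ • u 0 + r₃ • u 3 + r₄ • u 4)) =
      chartA ![r₀, 0, 0, -r₃, -r₄, 0] := by
  obtain ⟨c0, c1, c2, c3, c4, -⟩ := carry_u
  change _ = wedge (u 0) (∑ k, (![r₀, 0, 0, -r₃, -r₄, 0] : Fin 6 → ℂ) k • u (chartIndex k))
  rw [biv_wedge, map_add, map_add, map_smul, map_smul, map_smul, c0, c1, c3, c4]
  simp [Fin.sum_univ_six, chartIndex]

/-! ### Nondegeneracy at the standard base points -/

section Lines

variable {Z : Set (Fin 27 × Fin 27 → ℂ)} {I : Set (Fin 4)} {T : Finset (Fin 27)}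

theorem IsModel.vmrtCone_carry_subset (h : IsModel Z I T) :
    vmrtCone (biv carry '' Z) v₃ ⊆ vmrtCone X v₃ := by
  rw [← quotEquiv_image (biv carry) carry_y₃ rfl,
    ← quotEquiv_image (biv carry) carry_y₃ (biv_image_X carry_mem)]
  exact Set.image_mono h.vmrtCone_subset

/-- The root group of −α₃ lies in L and becomes, after `carry`, the root group of −α₄ that defines
the chart parameter. The nonzero entries 0, 3, 4 belong to three different hyperbolic pairs, so
these vectors form an isotropic space. -/
theorem IsModel.param_mem (h : IsModel Z I T) (τ : ℂ) {r₀ r₃ r₄ : ℂ} (h4 : 4 ∉ T → r₄ = 0)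
    (h0 : ![r₀, 0, 0, r₃, r₄, 0] ≠ 0) :
    chart.param τ ![r₀, 0, 0, r₃, r₄, 0] ∈ vmrtCone (biv carry '' Z) v₃ := by
  refine ⟨fun hz => h0 ?_, _, (chart_param _ _).symm, fun a b => ?_⟩
  · rw [← chart.πa_param τ ![r₀, 0, 0, r₃, r₄, 0], hz, map_zero]
  have hv := vanish_line a b r₀ (-r₃) (-r₄)
  refine ⟨biv (xf 2 τ) (wedge (u 1) (a • u 2 + b • (r₀ • u 0 + -r₃ • u 3 + -r₄ • u 4))), ?_, ?_⟩
  · exact h.biv_mem (xf_mem_gen h.sub.two_mem_index τ)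
      (h.wedge_mem hv (fun hT => by simp [u, h4 hT])).1
  · rw [biv_wedge, biv_wedge, ← carry_xf τ hv, ← carry_xf τ (v := u 1), ← biv_wedge, ← biv_wedge,
      ← smul_y₃_add_wedge, map_add, map_add, map_smul, map_smul, map_smul, map_smul, carry_y₃,
      carry_wedge, biv_xf_three_v₃, neg_neg, neg_neg]
    intro c hc
    have : c ≠ 1 := by
      rintro rfl
      exact hc (by decide)
    simp [u, this]

/-- A two-dimensional space is not contained in a line. Entry 4 is left out so that the direction is
available for C₂ too. -/
theorem exists_not_mem_span (s : Fin 6 → ℂ) :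
    ∃ a b : ℂ, ![a, 0, 0, b, 0, 0] ∉ (ℂ ∙ s : Submodule ℂ (Fin 6 → ℂ)) := by
  by_contra! hall
  obtain ⟨a, ha⟩ := Submodule.mem_span_singleton.1 (hall 1 0)
  obtain ⟨b, hb⟩ := Submodule.mem_span_singleton.1 (hall 0 1)
  have a0 := congrFun ha 0
  have a3 := congrFun ha 3
  have b3 := congrFun hb 3
  simp at a0 a3 b3
  rcases a3 with h | h
  · simp [h] at a0
  · simp [h] at b3

/-- Varying the chart parameter gives the tangent vector b r, and moving linearly inside the
isotropic space gives a second one a r₂; these are the two vectors that the criterion asks for. -/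
theorem IsModel.nondegAt_carry (h : IsModel Z I T) {r₀ r₃ r₄ : ℂ} (h4 : 4 ∉ T → r₄ = 0)
    (h0 : ![r₀, 0, 0, r₃, r₄, 0] ≠ 0) :
    NondegAt (vmrtCone X v₃) (vmrtCone (biv carry '' Z) v₃)
      (Submodule.Quotient.mk (chartA ![r₀, 0, 0, r₃, r₄, 0])) := by
  obtain ⟨a, b, hab⟩ := exists_not_mem_span ![r₀, 0, 0, r₃, r₄, 0]
  have hpath : ∀ (t : ℂ → ℂ) (s : ℂ → Fin 6 → ℂ) (t' : ℂ) (s' : Fin 6 → ℂ), AnalyticAt ℂ t 0 →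
      AnalyticAt ℂ s 0 → t 0 = 0 → s 0 = ![r₀, 0, 0, r₃, r₄, 0] → HasDerivAt t t' 0 →
      HasDerivAt s s' 0 → (∀ τ, chart.param (t τ) (s τ) ∈ vmrtCone (biv carry '' Z) v₃) →
      chart.a s' + t' • chart.b ![r₀, 0, 0, r₃, r₄, 0] ∈
        tangent (vmrtCone (biv carry '' Z) v₃) (chart.a ![r₀, 0, 0, r₃, r₄, 0]) := by
    intro t s t' s' ht hs ht0 hs0 htd hsd hmem
    refine Submodule.subset_span ⟨fun τ => chart.param (t τ) (s τ),
      ⟨chart.analyticAt_param ht hs, ?_, Filter.Eventually.of_forall hmem⟩, ?_⟩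
    · simp [QuadricChart.param, ht0, hs0]
    · rw [(chart.hasDerivAt_param htd hsd).deriv]
      simp [QuadricChart.dparam, ht0, hs0]
  refine chart_isChartOf.nondegAt chart (r₂ := ![a, 0, 0, b, 0, 0]) h.vmrtCone_carry_subset h0
    ?_ ?_ ?_ hab
  · rw [chart_P, chartForm_apply]
    simp
  · have := hpath (fun τ => τ) (fun _ => ![r₀, 0, 0, r₃, r₄, 0]) 1 0 analyticAt_id
      analyticAt_const rfl rfl (hasDerivAt_id 0) (hasDerivAt_const _ _)
      (fun τ => h.param_mem τ h4 h0)
    simpa using this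
  · have hd : HasDerivAt (fun τ : ℂ => ![r₀, 0, 0, r₃, r₄, 0] + τ • ![a, 0, 0, b, 0, 0])
        ![a, 0, 0, b, 0, 0] 0 := by
      have := ((hasDerivAt_id (0 : ℂ)).smul_const ![a, 0, 0, b, 0, 0]).const_add
        ![r₀, 0, 0, r₃, r₄, 0]
      simpa using this
    have := hpath (fun _ => 0) (fun τ => ![r₀, 0, 0, r₃, r₄, 0] + τ • ![a, 0, 0, b, 0, 0]) 0 _
      analyticAt_const (analyticAt_const.add (analyticAt_id.smul analyticAt_const)) rfl (by simp)
      (hasDerivAt_const _ _) hd (fun τ => by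
        have e1 : ![r₀, 0, 0, r₃, r₄, 0] + τ • ![a, 0, 0, b, 0, 0] =
            ![r₀ + τ * a, 0, 0, r₃ + τ * b, r₄, 0] := by simp
        rw [e1]
        -- The straight path avoids the vertex, because its direction is not proportional to its
        -- starting vector.
        refine h.param_mem 0 h4 fun h1 => ?_
        rw [← e1] at h1
        by_cases hτ : τ = 0
        · rw [hτ, zero_smul, add_zero] at h1
          exact h0 h1
        · refine hab (Submodule.mem_span_singleton.2 ⟨-τ⁻¹, ?_⟩)
          rw [eq_neg_of_add_eq_zero_left h1, smul_neg, neg_smul, neg_neg, smul_smul,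
            inv_mul_cancel₀ hτ, one_smul])
    simpa using this

/-- Each direction is rotated by the SL₂ of α₃ before being carried to `v₃`, so it is always
examined at chart parameter 0 and the directions outside the chart need no separate treatment. -/
theorem IsModel.isNondegeneratePair (h : IsModel Z I T) :
    IsNondegeneratePair (vmrtCone X y₃) (vmrtCone Z y₃) := by
  refine ⟨h.vmrtCone_subset, fun β hβ => ?_⟩
  obtain ⟨g, hg, r₀, r₃, r₄, h4, rfl⟩ := h.exists_of_mem_vmrtCone hβ
  refine nondegAt_vmrtCone_map (biv g) (biv_y₃ hg) (biv_image_X (gen_univ_mono _ hg))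
    (h.preserves_biv (h.sub.gen_two_le hg)).2 ?_
  have h0 : ![r₀, 0, 0, -r₃, -r₄, 0] ≠ 0 := by
    intro h0
    have e0 := congrFun h0 0
    have e3 := congrFun h0 3
    have e4 := congrFun h0 4
    simp at e0 e3 e4
    refine hβ.1 ?_
    rw [e0, e3, e4, zero_smul, zero_smul, zero_smul, add_zero, add_zero, wedge_zero_right, map_zero]
    rfl
  have hsymm : (biv carry).symm v₃ = y₃ := by
    rw [LinearEquiv.symm_apply_eq, carry_y₃]
  have := nondegAt_vmrtCone_map (biv carry).symm hsymm (image_symm_eq (biv_image_X carry_mem))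
    (image_symm_eq rfl) (h.nondegAt_carry (fun hT => by rw [h4 hT, neg_zero]) h0)
  rwa [← carry_wedge, LinearEquiv.symm_apply_apply] at this

end Lines

end F4

theorem mainTheorem4
    (Z : Set (Fin 27 × Fin 27 → ℂ))
    (hZ : IsSchubertVariety F4.rep F4.X Z)
    (hType : IsOfType F4.rep (CartanMatrix.B 3) 1 2 Z ∨ IsOfType F4.rep (CartanMatrix.C 2) 1 0 Z)
    (x : Fin 27 × Fin 27 → ℂ) (hx : IsGeneralPoint F4.rep Z x) :
    IsNondegeneratePair (vmrtCone F4.X x) (vmrtCone Z x) := by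
  obtain ⟨I, T, hsub, hcl, hbase⟩ := F4.exists_model hZ hType
  have h : F4.IsModel Z I T := ⟨hsub, hcl, hbase⟩
  -- Generality of x enters only here, through the density of its Borel orbit in `Z`.
  obtain ⟨Φ, hΦ, hΦx⟩ := h.exists_map_y₃ hx.2
  exact isNondegeneratePair_vmrtCone_map Φ.symm (by rw [← hΦx, Φ.symm_apply_apply])
    (F4.image_symm_eq hΦ.1) (F4.image_symm_eq hΦ.2) h.isNondegeneratePair
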